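/- Let $\mathfrak R=\mathbb Z$ or $\mathfrak R=\mathbb Z/N$ with $N\ge 2$ even, and let $\rho\in\mathbb Z$. Let $\mathbf L$ be a bordered Legendrian graph of type $(\ell,r)$ in $[-M,M]\times\mathbb R^2_{yz}\subset(\mathbb R^3,\ker(dz-y\,dx))$, given by a regular front with an $\mathfrak R$-valued Maslov potential $\mu$ (a function on the arcs between vertices and cusps which at each cusp is larger by $1$ on the upper arc). Let $\hat{\mathbf L}^{\mathrm{left}}$ be $\mathbf L$ with its $\ell$ left ends joined by arcs to one vertex $0$ (all $\ell$ edges on the right of $0$), and let the closure $\hat{\mathbf L}$ be $\hat{\mathbf L}^{\mathrm{left}}$ with its $r$ right ends joined by arcs to one vertex $\infty$ (all $r$ edges on the left of $\infty$). Let $D$ be the Lagrangian projection obtained from a front by Ng's resolution: left cusps are rounded, right cusps become a crossing followed by a rounded end, at each crossing the strand of smaller slope passes over, and the left edges of each vertex undergo a half twist (every two of them cross once) just before they reach it. Let $\mathcal A(D)$ be the free unital associative $\mathbb Z$-algebra on the crossings of $D$ and on symbols $v_{i,j}$ for each vertex $v$, $i\in\mathbb Z/\mathrm{val}(v)$, $j\ge1$,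 where the half-edges of $v$ are numbered clockwise: those on the right from top to bottom, then those on the left from bottom to top. Degrees in $\mathfrak R$ are $|c|=\mu(\text{over strand})-\mu(\text{under strand})$ and $|v_{i,j}|=\mu(i)-\mu(i+j)+(n-1)$, where $n$ is the number of times that a clockwise spiral around $v$ from half-edge $i$ through $j$ sectors meets the vertical line through $v$. The differential satisfies the graded Leibniz rule $\partial(ab)=(\partial a)b+(-1)^{|a|}a\,\partial b$ and $$\partial v_{i,j}=\delta_{j,\mathrm{val}(v)}+\sum_{j_1+j_2=j}(-1)^{|v_{i,j_1}|-1}v_{i,j_1}v_{i+j_1,j_2},\qquad \partial c=\sum_f \operatorname{sgn}(f,\mathbf x_0)\,\tilde f(\mathbf x_1)\cdots\tilde f(\mathbf x_t).$$ Here $f$ runs over the orientation preserving immersed polygons of degree $1$ with boundary on $D$, up to reparametrization, whose corner $\mathbf x_0$ is convex and fills the left or right quadrant at $c$, and whose other corners $\mathbf x_1,\dots,\mathbf x_t$ (counterclockwise from $\mathbf x_0$) either are convex and fill the top or bottom quadrant of a crossing $c'$, in which case $\tilde f(\mathbf x_i)=\pm c'$, or lie at a vertex $v$ and cover $j\ge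 1$ sectors clockwise from the incoming boundary half-edge $i'$, in which case $\tilde f(\mathbf x_i)=v_{i',j}$. The degree of $f$ is $|c|-\sum_{i\ge1}|\tilde f(\mathbf x_i)|$. The signs are $+$ for the left and the top quadrant and $(-1)^{|c|-1}$ for the right and the bottom quadrant of a crossing $c$. Put $\mathcal A(\mathbf L):=\mathcal A(\text{resolution of }\hat{\mathbf L}^{\mathrm{left}})$ and $\mathcal A(\hat{\mathbf L}):=\mathcal A(\text{resolution of }\hat{\mathbf L})$. A $\rho$-graded augmentation is a unital ring homomorphism $\epsilon:\mathcal A(D)\to\mathbb Z$ with $\epsilon\circ\partial=0$ and $\epsilon(g)=0$ for every generator $g$ with $|g|\notin\rho\mathfrak R$. Theorem. In both projections the number of immersed polygons of degree $1$ at each crossing is finite, so that the differentials are defined, and $\mathcal A(\mathbf L)$ has a $\rho$-graded augmentation if and only if $\mathcal A(\hat{\mathbf L})$ has one. -/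

import Mathlib

/-!
Bordered Legendrian graphs with Maslov potential, their closures, Ng's resolution, and the
algebra with differential that counts immersed polygons.  Gradings lie in `ZMod N`; here
`N = 0` means `ℤ`.

Conventions.  The strands over a generic vertical line are listed from top to bottom and numbered
`0, 1, 2, …`.  A diagram in general position is cut by vertical lines, the slices `0, 1, 2, …`,
into slabs with exactly one singular point each; slab `k` lies between slice `k` and slice `k + 1`.
-/

namespace LegendrianGraph

variable {N : ℕ}

/-! ### Regular fronts with a Maslov potential -/

/-- The singular points of a regular front, with the values of the Maslov potential on the
arcs that meet there: a double point at which the arc with value `x` comes from the upper left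
and the arc with value `y` from the lower left; a left or right cusp with value `x` on its lower
and `x + 1` on its upper arc; a vertex with arcs `X` on its left and `Y` on its right (both from
top to bottom), whose values are unconstrained. -/
inductive FrontPoint (N : ℕ) : Type
  | crossing (x y : ZMod N)
  | leftCusp (x : ZMod N)
  | rightCusp (x : ZMod N)
  | vertex (X Y : List (ZMod N))

/-- The potentials of the arcs that end at the point from the left, from top to bottom. -/
def FrontPoint.incoming : FrontPoint N → List (ZMod N)
  | .crossing x y => [x, y]
  | .leftCusp _ => []
  | .rightCusp x => [x + 1, x]
  | .vertex X _ => X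

/-- The potentials of the arcs that leave the point to the right, from top to bottom. -/
def FrontPoint.outgoing : FrontPoint N → List (ZMod N)
  | .crossing x y => [y, x]
  | .leftCusp x => [x + 1, x]
  | .rightCusp _ => []
  | .vertex _ Y => Y

/-- A slab of a front: one singular point, the strands above it and the strands below it. -/
structure FrontSlab (N : ℕ) : Type where
  above : List (ZMod N)
  point : FrontPoint N
  below : List (ZMod N)

/-- The potentials of the strands at the left end of the slab. -/
def FrontSlab.source (e : FrontSlab N) : List (ZMod N) := e.above ++ e.point.incoming ++ e.below

/-- The potentials of the strands at the right end of the slab. -/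
def FrontSlab.target (e : FrontSlab N) : List (ZMod N) := e.above ++ e.point.outgoing ++ e.below

/-- The slabs `es` fit together to a front that starts with the strands `s` on the left and ends
with the strands `t` on the right, with matching Maslov potentials. -/
def IsFront : List (ZMod N) → List (FrontSlab N) → List (ZMod N) → Prop
  | s, [], t => s = t
  | s, e :: es, t => s = e.source ∧ IsFront e.target es t

theorem IsFront.append {s t u : List (ZMod N)} {es fs : List (FrontSlab N)}
    (h₁ : IsFront s es t) (h₂ : IsFront t fs u) : IsFront s (es ++ fs) u := by
  induction es generalizing s with
  | nil => cases h₁; exact h₂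
  | cons e es ih => exact ⟨h₁.1, ih h₁.2⟩

/-- A bordered Legendrian graph with a Maslov potential in `ZMod N`, given by its regular front.
It has type `(left.length, right.length)`, and `left`, `right` are the potentials at its
left and right border. -/
structure BorderedGraph (N : ℕ) : Type where
  left : List (ZMod N)
  right : List (ZMod N)
  slabs : List (FrontSlab N)
  isFront : IsFront left slabs right

/-- Concatenation of bordered graphs whose potentials agree along the common border. -/
def BorderedGraph.concat (L₁ L₂ : BorderedGraph N) (h : L₁.right = L₂.left) :
    BorderedGraph N where
  left := L₁.left
  right := L₂.right
  slabs := L₁.slabs ++ L₂.slabs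
  isFront := L₁.isFront.append (h ▸ L₂.isFront)

/-- The corolla of type `(0, ℓ)`: one vertex with `ℓ` edges, all going to the right. -/
def zeroCorolla (μ : List (ZMod N)) : BorderedGraph N where
  left := []
  right := μ
  slabs := [⟨[], .vertex [] μ, []⟩]
  isFront := by simp [IsFront, FrontSlab.source, FrontSlab.target, FrontPoint.incoming,
    FrontPoint.outgoing]

/-- The corolla of type `(r, 0)`: one vertex with `r` edges, all going to the left. -/
def inftyCorolla (μ : List (ZMod N)) : BorderedGraph N where
  left := μ
  right := []
  slabs := [⟨[], .vertex μ [], []⟩]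
  isFront := by simp [IsFront, FrontSlab.source, FrontSlab.target, FrontPoint.incoming,
    FrontPoint.outgoing]

/-- The left closure `0_ℓ · L`. -/
def BorderedGraph.leftClosure (L : BorderedGraph N) : BorderedGraph N :=
  (zeroCorolla L.left).concat L rfl

/-- The closure `0_ℓ · L · ∞_r`. -/
def BorderedGraph.closure (L : BorderedGraph N) : BorderedGraph N :=
  L.leftClosure.concat (inftyCorolla L.right) rfl

/-! ### Lagrangian projections -/

/-- The singular points of a Lagrangian projection that is cut into slabs: a crossing (the strand
with potential `x`, which goes from the upper left to the lower right, passes over the strand with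
potential `y`); a point with vertical tangent where two strands to its right (`cup`) or to its
left (`cap`) meet smoothly; a vertex with edges `X` on its left and `Y` on its right. -/
inductive LagPoint (N : ℕ) : Type
  | crossing (x y : ZMod N)
  | cup (x : ZMod N)
  | cap (x : ZMod N)
  | vertex (X Y : List (ZMod N))

/-- The number of strands that end at the point from the left. -/
def LagPoint.numIn : LagPoint N → ℕ
  | .crossing _ _ => 2
  | .cup _ => 0
  | .cap _ => 2
  | .vertex X _ => X.length

/-- The number of strands that leave the point to the right. -/
def LagPoint.numOut : LagPoint N → ℕ
  | .crossing _ _ => 2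
  | .cup _ => 2
  | .cap _ => 0
  | .vertex _ Y => Y.length

/-- A slab of a Lagrangian projection. -/
structure LagSlab (N : ℕ) : Type where
  above : List (ZMod N)
  point : LagPoint N
  below : List (ZMod N)

/-- The crossings of a strand `x` that goes down across the strands `Z`, from left to right;
the strands `A` are above and the strands `B` below. -/
def passDown (A : List (ZMod N)) (x : ZMod N) : List (ZMod N) → List (ZMod N) → List (LagSlab N)
  | [], _ => []
  | z :: Z, B => ⟨A, .crossing x z, Z ++ B⟩ :: passDown (A ++ [z]) x Z B

/-- The half twist on the strands `X`: first the half twist on all strands but the top one, and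
then the top strand crosses over all the others. -/
def halfTwist : List (ZMod N) → List (ZMod N) → List (ZMod N) → List (LagSlab N)
  | _, [], _ => []
  | A, x :: X, B => halfTwist (A ++ [x]) X B ++ passDown A x X.reverse B

/-- Ng's resolution of one slab: left cusps are rounded, right cusps become a crossing followed
by a rounded end, and the left edges of a vertex undergo a half twist before they reach it. -/
def FrontSlab.res : FrontSlab N → List (LagSlab N)
  | ⟨A, .crossing x y, B⟩ => [⟨A, .crossing x y, B⟩]
  | ⟨A, .leftCusp x, B⟩ => [⟨A, .cup x, B⟩]
  | ⟨A, .rightCusp x, B⟩ => [⟨A, .crossing (x + 1) x, B⟩, ⟨A, .cap x, B⟩]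
  | ⟨A, .vertex X Y, B⟩ => halfTwist A X B ++ [⟨A, .vertex X.reverse Y, B⟩]

/-- Ng's resolution of a front, as it stands (without closing it on the left). -/
def BorderedGraph.res (L : BorderedGraph N) : List (LagSlab N) := L.slabs.flatMap FrontSlab.res

/-! ### Generators and their degrees -/

/-- The generators: one for each crossing, and `v_{h,j}`, `j ≥ 1`, for each vertex `v` and each
half-edge `h` of `v`.  The half-edges of a vertex are numbered clockwise from `0`: first
the edges on the right from top to bottom, then the edges on the left from bottom to top. -/
inductive Gen (D : List (LagSlab N)) : Type
  | crossing (k : ℕ) (A : List (ZMod N)) (x y : ZMod N) (B : List (ZMod N))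
      (hk : D[k]? = some ⟨A, .crossing x y, B⟩) : Gen D
  | vertex (k : ℕ) (A X Y B : List (ZMod N)) (hk : D[k]? = some ⟨A, .vertex X Y, B⟩)
      (h : Fin (Y.length + X.length)) (j : ℕ+) : Gen D

/-- The half-edge that is reached from the half-edge `h` by passing `j` sectors clockwise. -/
def rotate {n : ℕ} (h : Fin n) (j : ℕ) : Fin n :=
  ⟨(h + j) % n, Nat.mod_lt _ (Nat.lt_of_le_of_lt (Nat.zero_le _) h.isLt)⟩

/-- The potential on the half-edge `h` of a vertex. -/
def halfEdgePotential (X Y : List (ZMod N)) (h : Fin (Y.length + X.length)) : ZMod N :=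
  (Y ++ X.reverse).get (h.cast (by simp))

/-- The number of intersections of the vertical line through a vertex of type `(a, b)` with the
spiral that starts at half-edge `h` and passes `j` sectors clockwise.  Half-edges are counted
on as `h + 1, h + 2, …`; the upper half of the line is met immediately before the half-edges
congruent to `0`, the lower half immediately before those congruent to `b` modulo `b + a`. -/
def spiralCrossings (a b h j : ℕ) : ℕ :=
  ((Finset.Ioc h (h + j)).filter fun m => m ≡ 0 [MOD b + a]).card +
    ((Finset.Ioc h (h + j)).filter fun m => m ≡ b [MOD b + a]).card

/-- The degree of a generator. -/
def Gen.degree {D : List (LagSlab N)} : Gen D → ZMod N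
  | .crossing _ _ x y _ _ => x - y
  | .vertex _ _ X Y _ _ h j =>
      halfEdgePotential X Y h - halfEdgePotential X Y (rotate h j) +
        ((spiralCrossings X.length Y.length h j : ZMod N) - 1)

/-- The sign `(-1)^g`; it is used only for even `N`, where it is well defined. -/
def koszul (g : ZMod N) : ℤ := (-1) ^ g.val

/-! ### Immersed polygons

The preimages of the slices cut the domain of an immersed polygon into pieces, each of which lies
over one slab.  Two neighbouring pieces meet along a gate, a segment of a slice between two
strands.  As the domain is simply connected, the pieces form a tree.  Thus an immersed polygon, up
to reparametrization, is a tree of pieces.  Boundaries of pieces and polygons are read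
counterclockwise. -/

/-- The two vertical sides of a slab. -/
inductive Wall : Type
  | left
  | right

/-- A gate of a piece: a segment of the left or right side of the slab, from the strand number
`top` to the strand number `bottom` of the corresponding slice. -/
structure Gate : Type where
  wall : Wall
  top : ℕ
  bottom : ℕ

/-- The slice that contains the gate of a piece over slab `k`. -/
def Gate.slice (g : Gate) (k : ℕ) : ℕ :=
  match g.wall with
  | .left => k
  | .right => k + 1

/-- A corner of a polygon other than its positive one: a signed generator. -/
structure Corner (D : List (LagSlab N)) : Type where
  gen : Gen D
  sign : ℤ

/-- A strand which runs through a slab above or below its singular point has number `l` on the left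
and number `r` on the right side of the slab. -/
inductive Passes (e : LagSlab N) : ℕ → ℕ → Prop
  | above (q : ℕ) (hq : q < e.above.length) : Passes e q q
  | below (m : ℕ) (hm : m < e.below.length) :
      Passes e (e.above.length + e.point.numIn + m) (e.above.length + e.point.numOut + m)

/-- A boundary arc through slab `k`, from strand `r` on the right to strand `l` on the left, with
the polygon below it, and the corners on it.  At a crossing it may go straight, or turn at a
corner that fills the bottom quadrant, which is Reeb-negative and has orientation sign
`(-1)^(|c| - 1)`. -/
inductive UpperArc (D : List (LagSlab N)) (k : ℕ) : ℕ → ℕ → List (Corner D) → Prop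
  | pass (e : LagSlab N) (hk : D[k]? = some e) (l r : ℕ) (h : Passes e l r) : UpperArc D k l r []
  | over (A : List (ZMod N)) (x y : ZMod N) (B : List (ZMod N))
      (hk : D[k]? = some ⟨A, .crossing x y, B⟩) : UpperArc D k A.length (A.length + 1) []
  | under (A : List (ZMod N)) (x y : ZMod N) (B : List (ZMod N))
      (hk : D[k]? = some ⟨A, .crossing x y, B⟩) : UpperArc D k (A.length + 1) A.length []
  | corner (A : List (ZMod N)) (x y : ZMod N) (B : List (ZMod N))
      (hk : D[k]? = some ⟨A, .crossing x y, B⟩) :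
      UpperArc D k (A.length + 1) (A.length + 1) [⟨.crossing k A x y B hk, koszul (x - y - 1)⟩]

/-- A boundary arc through slab `k`, from strand `l` on the left to strand `r` on the right, with
the polygon above it, and the corners on it.  At a crossing it may go straight, or turn at a
corner that fills the top quadrant, which is Reeb-negative and has orientation sign `1`. -/
inductive LowerArc (D : List (LagSlab N)) (k : ℕ) : ℕ → ℕ → List (Corner D) → Prop
  | pass (e : LagSlab N) (hk : D[k]? = some e) (l r : ℕ) (h : Passes e l r) : LowerArc D k l r []
  | over (A : List (ZMod N)) (x y : ZMod N) (B : List (ZMod N))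
      (hk : D[k]? = some ⟨A, .crossing x y, B⟩) : LowerArc D k A.length (A.length + 1) []
  | under (A : List (ZMod N)) (x y : ZMod N) (B : List (ZMod N))
      (hk : D[k]? = some ⟨A, .crossing x y, B⟩) : LowerArc D k (A.length + 1) A.length []
  | corner (A : List (ZMod N)) (x y : ZMod N) (B : List (ZMod N))
      (hk : D[k]? = some ⟨A, .crossing x y, B⟩) :
      LowerArc D k A.length A.length [⟨.crossing k A x y B hk, 1⟩]

/-- The spirals around a vertex with `p` strands above it, `c` strands below it, `a` edges on the
left (strands `p, …, p + a - 1` of the left side) and `b` edges on the right (strands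
`p, …, p + b - 1` of the right side).  `Sweep p a b c w x j gs` describes a piece of an immersed
surface that turns clockwise around the vertex: it starts on the side `w` at the strand `x`
(an edge of the vertex, or a strand above or below the vertex along which the piece came over from
the other side), it reaches `j` edges of the vertex, the last of which is the one where it stops,
and its gates are `gs`, in clockwise order.  Each time it turns past the vertical line through the
vertex, above or below, it is bounded there by some strand above or below the vertex. -/
inductive Sweep (p a b c : ℕ) : Wall → ℕ → ℕ → List Gate → Prop
  | leftStop (x y : ℕ) (hx : x < p + a + c) (hy : p ≤ y) (hya : y < p + a) (hyx : y < x) :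
      Sweep p a b c .left x (min x (p + a) - y) [⟨.left, y, x⟩]
  | leftCross (x s j : ℕ) (gs : List Gate) (hx : x < p + a + c) (hpx : p ≤ x) (hs : s < p)
      (h : Sweep p a b c .right s j gs) :
      Sweep p a b c .left x (min x (p + a) - p + j) (⟨.left, s, x⟩ :: gs)
  | rightStop (x y : ℕ) (hy : p ≤ y) (hyb : y < p + b) (hxy : x < y) :
      Sweep p a b c .right x (y + 1 - max (x + 1) p) [⟨.right, x, y⟩]
  | rightCross (x m j : ℕ) (gs : List Gate) (hx : x < p + b) (hm : m < c)
      (h : Sweep p a b c .left (p + a + m) j gs) :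
      Sweep p a b c .right x (p + b - max (x + 1) p + j) (⟨.right, x, p + b + m⟩ :: gs)

/-- The side on which the half-edge `h` of a vertex with `b` edges on the right lies. -/
def halfEdgeWall (b h : ℕ) : Wall := if h < b then .right else .left

/-- The number of the strand of the half-edge `h` of a vertex of type `(a, b)` with `p` strands
above it. -/
def halfEdgeStrand (p a b h : ℕ) : ℕ := if h < b then p + h else p + (b + a - 1 - h)

/-- The pieces over slab `k` of immersed polygons, apart from the triangles at the positive corner.
A piece is recorded by its gates in counterclockwise order, each with the corners that
follow it on the boundary up to the next gate. -/
inductive BasePiece (D : List (LagSlab N)) (k : ℕ) : List (Gate × List (Corner D)) → Prop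
    /-- A strip between two boundary arcs that run through the slab. -/
  | strip (tl tr bl br : ℕ) (ct cb : List (Corner D)) (ht : UpperArc D k tl tr ct)
      (hb : LowerArc D k bl br cb) (hl : tl < bl) (hr : tr < br) :
      BasePiece D k [(⟨.left, tl, bl⟩, cb), (⟨.right, tr, br⟩, ct)]
    /-- The half-disk inside a rounded left end. -/
  | cupInner (A : List (ZMod N)) (x : ZMod N) (B : List (ZMod N))
      (hk : D[k]? = some ⟨A, .cup x, B⟩) :
      BasePiece D k [(⟨.right, A.length, A.length + 1⟩, [])]
    /-- A piece which surrounds a rounded left end from the outside. -/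
  | cupOuter (A : List (ZMod N)) (x : ZMod N) (B : List (ZMod N))
      (hk : D[k]? = some ⟨A, .cup x, B⟩) (t m : ℕ) (ht : t < A.length) (hm : m < B.length) :
      BasePiece D k [(⟨.left, t, A.length + m⟩, []),
        (⟨.right, A.length + 1, A.length + 2 + m⟩, []), (⟨.right, t, A.length⟩, [])]
    /-- The half-disk inside a rounded right end. -/
  | capInner (A : List (ZMod N)) (x : ZMod N) (B : List (ZMod N))
      (hk : D[k]? = some ⟨A, .cap x, B⟩) :
      BasePiece D k [(⟨.left, A.length, A.length + 1⟩, [])]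
    /-- A piece which surrounds a rounded right end from the outside. -/
  | capOuter (A : List (ZMod N)) (x : ZMod N) (B : List (ZMod N))
      (hk : D[k]? = some ⟨A, .cap x, B⟩) (t m : ℕ) (ht : t < A.length) (hm : m < B.length) :
      BasePiece D k [(⟨.right, t, A.length + m⟩, []), (⟨.left, t, A.length⟩, []),
        (⟨.left, A.length + 1, A.length + 2 + m⟩, [])]
    /-- A piece with a vertex corner: the boundary arrives at the vertex along the half-edge `h`,
    and the piece covers `j` sectors, clockwise from `h`. -/
  | fan (A X Y B : List (ZMod N)) (hk : D[k]? = some ⟨A, .vertex X Y, B⟩)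
      (h : Fin (Y.length + X.length)) (j : ℕ+) (g : Gate) (gs : List Gate)
      (hs : Sweep A.length X.length Y.length B.length (halfEdgeWall Y.length h)
        (halfEdgeStrand A.length X.length Y.length h) j (g :: gs)) :
      BasePiece D k ((g, [⟨.vertex k A X Y B hk h j, 1⟩]) :: gs.reverse.map fun g' => (g', []))

/-- A piece, whose boundary may be read from any of its gates on. -/
def Piece (D : List (LagSlab N)) (k : ℕ) (bd : List (Gate × List (Corner D))) : Prop :=
  ∃ bd₀, BasePiece D k bd₀ ∧ bd₀.IsRotated bd

/-- `Half D .left s t b` is the type of the parts of immersed polygons that are cut off by a gate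
on slice `s` between the strands `t` and `b`, lie to the left of the gate and do not contain the
positive corner; `Half D .right s t b` is the same to the right of the gate.  Such a part
consists of the piece next to the gate and of a further part behind each of the other gates of this
piece. -/
inductive Half (D : List (LagSlab N)) : Wall → ℕ → ℕ → ℕ → Type
  | leftOf (k t b : ℕ) (c : List (Corner D)) (rest : List (Gate × List (Corner D)))
      (h : Piece D k ((⟨.right, t, b⟩, c) :: rest))
      (child : ∀ i : Fin rest.length, Half D (rest.get i).1.wall ((rest.get i).1.slice k)
        (rest.get i).1.top (rest.get i).1.bottom) : Half D .left (k + 1) t b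
  | rightOf (k t b : ℕ) (c : List (Corner D)) (rest : List (Gate × List (Corner D)))
      (h : Piece D k ((⟨.left, t, b⟩, c) :: rest))
      (child : ∀ i : Fin rest.length, Half D (rest.get i).1.wall ((rest.get i).1.slice k)
        (rest.get i).1.top (rest.get i).1.bottom) : Half D .right k t b

/-- The corners of a part of a polygon, counterclockwise from gate to gate. -/
def Half.word {D : List (LagSlab N)} {w : Wall} {s t b : ℕ} : Half D w s t b → List (Corner D)
  | .leftOf _ _ _ c rest _ child =>
      c ++ (List.ofFn fun i => (child i).word ++ (rest.get i).2).flatten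
  | .rightOf _ _ _ c rest _ child =>
      c ++ (List.ofFn fun i => (child i).word ++ (rest.get i).2).flatten

/-- The immersed polygons with positive corner at the crossing in slab `k`, between the strands
`p` and `p + 1`.  The positive corner fills the left quadrant (`inl`) or the right quadrant
(`inr`) of the crossing. -/
abbrev Polygon (D : List (LagSlab N)) (k p : ℕ) : Type :=
  Half D .left k p (p + 1) ⊕ Half D .right (k + 1) p (p + 1)

/-- The corners of a polygon other than the positive one, counterclockwise from the latter. -/
def Polygon.word {D : List (LagSlab N)} {k p : ℕ} (f : Polygon D k p) : List (Corner D) :=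
  Sum.elim Half.word Half.word f

/-- The orientation sign of the positive corner, for a crossing of degree `g`. -/
def Polygon.sign {D : List (LagSlab N)} {k p : ℕ} (g : ZMod N) (f : Polygon D k p) : ℤ :=
  Sum.elim (fun _ => 1) (fun _ => koszul (g - 1)) f

/-- The polygons of degree `1` with positive corner at a crossing of degree `g`. -/
def moduli (D : List (LagSlab N)) (k p : ℕ) (g : ZMod N) : Set (Polygon D k p) :=
  {f | g - (f.word.map fun c => c.gen.degree).sum = 1}

/-- For each crossing, the number of polygons of degree `1` is finite. -/
def FinitelyManyPolygons (D : List (LagSlab N)) : Prop :=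
  ∀ (k : ℕ) (A : List (ZMod N)) (x y : ZMod N) (B : List (ZMod N)),
    D[k]? = some ⟨A, .crossing x y, B⟩ → (moduli D k A.length (x - y)).Finite

/-! ### The algebra, its differential, and augmentations -/

/-- The free unital associative algebra over `ℤ` on the generators. -/
abbrev Alg (D : List (LagSlab N)) : Type := FreeAlgebra ℤ (Gen D)

/-- The differential of a generator. -/
noncomputable def dGen {D : List (LagSlab N)} : Gen D → Alg D
  | .crossing k A x y _ _ =>
      ∑ᶠ f ∈ moduli D k A.length (x - y),
        f.sign (x - y) • (f.word.map fun c => c.sign • FreeAlgebra.ι ℤ c.gen).prod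
  | .vertex k A X Y B hk h j =>
      (if (j : ℕ) = Y.length + X.length then 1 else 0) +
        ∑ q ∈ Finset.Iio j,
          koszul ((Gen.vertex k A X Y B hk h q).degree - 1) •
            (FreeAlgebra.ι ℤ (Gen.vertex k A X Y B hk h q) *
              FreeAlgebra.ι ℤ (Gen.vertex k A X Y B hk (rotate h q) (j - q)))

/-- Auxiliary homomorphism `a ↦ !![(-1)^|a| a, ∂ a; 0, a]`. -/
noncomputable def dMatrix (D : List (LagSlab N)) : Alg D →ₐ[ℤ] Matrix (Fin 2) (Fin 2) (Alg D) :=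
  FreeAlgebra.lift ℤ fun g =>
    !![koszul g.degree • FreeAlgebra.ι ℤ g, dGen g; 0, FreeAlgebra.ι ℤ g]

/-- The differential: the linear extension of `dGen` with the graded Leibniz rule
`∂ (a * b) = ∂ a * b + (-1)^|a| a * ∂ b`. -/
noncomputable def d (D : List (LagSlab N)) : Alg D →ₗ[ℤ] Alg D where
  toFun a := dMatrix D a 0 1
  map_add' a b := by simp
  map_smul' m a := by rw [map_smul]; rfl

theorem d_ι {D : List (LagSlab N)} (g : Gen D) : d D (FreeAlgebra.ι ℤ g) = dGen g := by
  simp [d, dMatrix]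

theorem dMatrix_diag (D : List (LagSlab N)) (a : Alg D) :
    dMatrix D a 1 0 = 0 ∧ dMatrix D a 1 1 = a := by
  induction a using FreeAlgebra.induction with
  | grade0 r => rw [AlgHom.commutes]; simp [Matrix.algebraMap_matrix_apply]
  | grade1 x => simp [dMatrix]
  | mul a b ha hb => simp [Matrix.mul_apply, ha.1, ha.2, hb.1, hb.2]
  | add a b ha hb => simp [ha.1, ha.2, hb.1, hb.2]

/-- The graded Leibniz rule for products with a generator on the left. -/
theorem d_ι_mul {D : List (LagSlab N)} (g : Gen D) (a : Alg D) :
    d D (FreeAlgebra.ι ℤ g * a) =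
      dGen g * a + koszul g.degree • (FreeAlgebra.ι ℤ g * d D a) := by
  have h := (dMatrix_diag D a).2
  have hg : dMatrix D (FreeAlgebra.ι ℤ g) =
      !![koszul g.degree • FreeAlgebra.ι ℤ g, dGen g; 0, FreeAlgebra.ι ℤ g] := by
    simp only [dMatrix, FreeAlgebra.lift_ι_apply]
  change dMatrix D (FreeAlgebra.ι ℤ g * a) 0 1 = _ + _ • (_ * dMatrix D a 0 1)
  rw [map_mul, hg, Matrix.mul_apply, Fin.sum_univ_two, h]
  simp only [Matrix.of_apply, Matrix.cons_val', Matrix.cons_val_zero, Matrix.cons_val_one,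
    Matrix.cons_val_fin_one, smul_mul_assoc]
  exact add_comm _ _

/-- A `ρ`-graded augmentation: a morphism of differential graded algebras to `ℤ` (with zero
differential, in degree `0`), where degrees are taken modulo `ρ`. -/
structure Augmentation (D : List (LagSlab N)) (ρ : ℤ) : Type where
  toAlgHom : Alg D →ₐ[ℤ] ℤ
  map_d : ∀ a, toAlgHom (d D a) = 0
  graded : ∀ g : Gen D, ¬ ((ρ : ZMod N) ∣ g.degree) → toAlgHom (FreeAlgebra.ι ℤ g) = 0

end LegendrianGraph

/-! Cut the diagram along a slice and let a solution `φ` of the equations `ε ∘ ∂ = 0` weigh the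
words of polygons. For strands `t < b` of the slice there are two signed counts: of the halves to
the left of the gate between `t` and `b`, and of those to its right. The left counts fill the part
above the diagonal of a square matrix on the strands, the right counts the part below it
(`Layout.coeff`). The central claim (`Layout.isAcyclic_diff`) is that this matrix is a contractible
differential over the integers on every slice, provided that the diagram starts with no strands.

The claim is proved by moving the slice to the right across one singular point at a time. Halves are
trees of pieces, so their weighted count satisfies a recursion over the piece next to the gate
(`Layout.halfSum_left`, `Layout.halfSum_right`). At a crossing `c` this recursion is conjugation by
an elementary matrix with entry `φ c`, followed by a transposition; the equation `φ (∂ c) = 0` says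
precisely that the entry moved from above to below the diagonal becomes the right count. At a
rounded end an acyclic block of rank two appears or is cancelled. At a vertex the equations for all
`v_{i,j}` together say that the matrices `M_w` of values on corners of winding number `w` satisfy
`(∑ M_w z^w)² = -z` (`levelMatrix_iff`). Thus `M_0` is a differential contracted by `-M_1`. It has
the form of a mapping cone, so the differential on the left edges is homotopy equivalent to the one
on the right edges. The passage replaces one block by the other (`IsAcyclic.replaceBlock`).

On the slice where the left closure ends no strands are inverted, so there are no right halves and
the matrix `U` is strictly upper triangular and contractible. A contraction `h` can be chosen with
`h * h = 0` and of the correct degree modulo `ρ` (`exists_graded_contraction`). The augmentation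
then extends over the vertex `∞` (`IsSolution.exists_extend`): crossings of the half twist get the
value zero, corners of winding number `0` get the entries of `U` and those of winding number `1` the
entries of `h`, up to signs, and all others get zero. The vertex equations become `U² = 0`, `U h + h
U = 1`, `h² = 0`, and each crossing equation of the half twist cancels a left count against a right
count.

For the converse, no polygon with positive corner in the left closure extends past its final slice,
since there are no right halves there; hence a solution for the closure restricts
(`IsSolution.restrict`).

Two facts make the counts usable. An integer-valued energy, a substitute for area, decreases along
the tree of pieces; it gives finiteness and decides which gates can bound left or right halves
(`Layout.basePiece_energy`, `Layout.finite_half`). The Maslov potential fixes the degree of the word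
of every half, so each polygon automatically has degree `1` (`Layout.half_deg`,
`Layout.moduli_eq_univ`). -/

namespace LegendrianGraph

variable {N : ℕ}

/-! ### Layouts

A layout records, for each slice, the Maslov potentials of the strands and their order in the
front direction.  The strands `t < b` of a slice are inverted if the order of their labels is not
`t` before `b`. -/

/-- The transposition of `p` and `p + 1`. -/
def swapAt (p t : ℕ) : ℕ := if t = p then p + 1 else if t = p + 1 then p else t

/-- The reversal of the block `p, …, p + a - 1`. -/
def revBlock (p a t : ℕ) : ℕ := if p ≤ t ∧ t < p + a then 2 * p + a - 1 - t else t

/-- The cyclic shift of `p, …, p + n`. -/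
def cycleBlock (p n t : ℕ) : ℕ :=
  if p ≤ t ∧ t < p + n then t + 1 else if t = p + n then p else t

/-- The passage through one slab of a resolved front. -/
inductive Step : List (ZMod N) → (ℕ → ℕ) → LagSlab N → List (ZMod N) → (ℕ → ℕ) → Prop
  | crossing (A : List (ZMod N)) (x y : ZMod N) (B : List (ZMod N)) (σ τ : ℕ → ℕ)
      (h : τ = id ∨ (σ A.length < σ (A.length + 1) ∧ τ = σ ∘ swapAt A.length)) :
      Step (A ++ x :: y :: B) σ ⟨A, .crossing x y, B⟩ (A ++ y :: x :: B) τ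
  | cup (A : List (ZMod N)) (x : ZMod N) (B : List (ZMod N)) :
      Step (A ++ B) id ⟨A, .cup x, B⟩ (A ++ (x + 1) :: x :: B) id
  | cap (A : List (ZMod N)) (x : ZMod N) (B : List (ZMod N)) :
      Step (A ++ x :: (x + 1) :: B) (swapAt A.length) ⟨A, .cap x, B⟩ (A ++ B) id
  | vertex (A X Y B : List (ZMod N)) :
      Step (A ++ X ++ B) (revBlock A.length X.length) ⟨A, .vertex X Y, B⟩ (A ++ Y ++ B) id

/-- The passage through several slabs of a resolved front. -/
inductive Chain : List (ZMod N) → (ℕ → ℕ) → List (LagSlab N) → List (ZMod N) → (ℕ → ℕ) → Prop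
  | nil (μ : List (ZMod N)) (σ : ℕ → ℕ) : Chain μ σ [] μ σ
  | cons {μ₁ μ₂ μ₃ : List (ZMod N)} {σ₁ σ₂ σ₃ : ℕ → ℕ} {e : LagSlab N} {es : List (LagSlab N)}
      (h : Step μ₁ σ₁ e μ₂ σ₂) (hs : Chain μ₂ σ₂ es μ₃ σ₃) : Chain μ₁ σ₁ (e :: es) μ₃ σ₃

theorem Chain.append {μ₁ μ₂ μ₃ : List (ZMod N)} {σ₁ σ₂ σ₃ : ℕ → ℕ} {D E : List (LagSlab N)}
    (h₁ : Chain μ₁ σ₁ D μ₂ σ₂) (h₂ : Chain μ₂ σ₂ E μ₃ σ₃) : Chain μ₁ σ₁ (D ++ E) μ₃ σ₃ := by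
  induction h₁ with
  | nil => exact h₂
  | cons h _ ih => exact .cons h (ih h₂)

theorem Chain.single {μ₁ μ₂ : List (ZMod N)} {σ₁ σ₂ : ℕ → ℕ} {e : LagSlab N}
    (h : Step μ₁ σ₁ e μ₂ σ₂) : Chain μ₁ σ₁ [e] μ₂ σ₂ := .cons h (.nil _ _)

/-- The passage through several crossings at which the strands are inverted one after the other. -/
inductive Braid : List (ZMod N) → (ℕ → ℕ) → List (LagSlab N) → List (ZMod N) → (ℕ → ℕ) → Prop
  | nil (μ : List (ZMod N)) (σ : ℕ → ℕ) : Braid μ σ [] μ σ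
  | cons (A : List (ZMod N)) (x y : ZMod N) (B : List (ZMod N)) {σ σ' : ℕ → ℕ}
      {μ' : List (ZMod N)} {es : List (LagSlab N)} (h : σ A.length < σ (A.length + 1))
      (hs : Braid (A ++ y :: x :: B) (σ ∘ swapAt A.length) es μ' σ') :
      Braid (A ++ x :: y :: B) σ (⟨A, .crossing x y, B⟩ :: es) μ' σ'

theorem Braid.append {μ₁ μ₂ μ₃ : List (ZMod N)} {σ₁ σ₂ σ₃ : ℕ → ℕ} {D E : List (LagSlab N)}
    (h₁ : Braid μ₁ σ₁ D μ₂ σ₂) (h₂ : Braid μ₂ σ₂ E μ₃ σ₃) : Braid μ₁ σ₁ (D ++ E) μ₃ σ₃ := by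
  induction h₁ with
  | nil => exact h₂
  | cons A x y B h _ ih => exact .cons A x y B h (ih h₂)

theorem Braid.chain {μ₁ μ₂ : List (ZMod N)} {σ₁ σ₂ : ℕ → ℕ} {D : List (LagSlab N)}
    (h : Braid μ₁ σ₁ D μ₂ σ₂) : Chain μ₁ σ₁ D μ₂ σ₂ := by
  induction h with
  | nil => exact .nil _ _
  | cons A x y B h _ ih => exact .cons (.crossing A x y B _ _ (.inr ⟨h, rfl⟩)) ih

theorem Braid.eq_crossing {μ₁ μ₂ : List (ZMod N)} {σ₁ σ₂ : ℕ → ℕ} {D : List (LagSlab N)}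
    (h : Braid μ₁ σ₁ D μ₂ σ₂) : ∀ e ∈ D, ∃ A x y B, e = ⟨A, .crossing x y, B⟩ := by
  induction h with
  | nil => simp
  | cons A x y B h _ ih => simpa using ih

/-- The moving strand has a smaller label than every strand it meets, and these are all distinct, so
each crossing inverts a pair that was not inverted before. -/
theorem braid_passDown (A : List (ZMod N)) (x : ZMod N) (Z B : List (ZMod N)) (σ : ℕ → ℕ)
    (h : ∀ q, A.length < q → q ≤ A.length + Z.length → σ A.length < σ q) :
    Braid (A ++ x :: (Z ++ B)) σ (passDown A x Z B) (A ++ Z ++ x :: B)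
      (σ ∘ cycleBlock A.length Z.length) := by
  induction Z generalizing A σ with
  | nil =>
    have : σ ∘ cycleBlock A.length ([] : List (ZMod N)).length = σ := by
      funext t; simp only [Function.comp, cycleBlock, List.length_nil]
      split_ifs <;> first | omega | (congr 1; omega)
    rw [this]; simpa [passDown] using Braid.nil _ _
  | cons z Z ih =>
    have e1 : σ ∘ cycleBlock A.length (z :: Z).length =
        (σ ∘ swapAt A.length) ∘ cycleBlock (A ++ [z]).length Z.length := by
      funext t; simp only [Function.comp, cycleBlock, swapAt, List.length_cons,
        List.length_append, List.length_nil]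
      congr 1
      split_ifs <;> omega
    have := ih (A ++ [z]) (σ ∘ swapAt A.length) (by
      intro q h1 h2
      simp only [List.length_append, List.length_cons, List.length_nil] at h1 h2
      have := h q (by omega) (by simp; omega)
      simp only [Function.comp, swapAt, List.length_append, List.length_cons, List.length_nil]
      split_ifs <;> omega)
    rw [e1]
    refine .cons A x z (Z ++ B) (h _ (by omega) (by simp)) ?_
    simpa using this

/-- Every two strands of a half twist cross exactly once, so no crossing undoes an inversion. The
induction writes the reversal of a block as the reversal of all but its top strand, followed by a
cyclic shift. -/
theorem braid_halfTwist (A X B : List (ZMod N)) (σ : ℕ → ℕ)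
    (h : ∀ i j, A.length ≤ i → i < j → j < A.length + X.length → σ i < σ j) :
    Braid (A ++ X ++ B) σ (halfTwist A X B) (A ++ X.reverse ++ B)
      (σ ∘ revBlock A.length X.length) := by
  induction X generalizing A σ with
  | nil =>
    have : σ ∘ revBlock A.length ([] : List (ZMod N)).length = σ := by
      funext t; simp only [Function.comp, revBlock, List.length_nil]
      split_ifs <;> omega
    rw [this]; simpa [halfTwist] using Braid.nil _ _
  | cons x X ih =>
    simp only [List.length_cons] at h
    have e1 : σ ∘ revBlock A.length (x :: X).length =
        (σ ∘ revBlock (A ++ [x]).length X.length) ∘ cycleBlock A.length X.reverse.length := by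
      funext t; simp only [Function.comp, cycleBlock, revBlock, List.length_cons,
        List.length_append, List.length_nil, List.length_reverse]
      congr 1
      split_ifs <;> omega
    have h1 := ih (A ++ [x]) σ (fun i j hi hij hj => h i j
      (by simp at hi; omega) hij (by simp at hj; omega))
    have h2 := braid_passDown A x X.reverse B (σ ∘ revBlock (A ++ [x]).length X.length) (by
      intro q hq1 hq2
      simp only [List.length_reverse] at hq2
      simp only [Function.comp, revBlock, List.length_append, List.length_cons, List.length_nil]
      rw [if_neg (by omega)]
      apply h
      all_goals first | omega | (split_ifs <;> omega))
    rw [e1]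
    have := h1.append (D := halfTwist (A ++ [x]) X B) (E := passDown A x X.reverse B)
      (μ₃ := A ++ X.reverse ++ x :: B)
      (σ₃ := (σ ∘ revBlock (A ++ [x]).length X.length) ∘ cycleBlock A.length X.reverse.length)
      (by simpa using h2)
    simpa [halfTwist] using this

/-- A crossing of the front also exchanges the two strands in the front, so the labels are reset to
`id` after it. Only crossings created by the resolution invert strands, and the rounded end or
vertex they were made for ends the inversion within the same front slab. -/
theorem chain_res_slab (e : FrontSlab N) : Chain e.source id e.res e.target id := by
  obtain ⟨A, pt, B⟩ := e
  cases pt with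
  | crossing x y =>
    simpa [FrontSlab.source, FrontSlab.target, FrontPoint.incoming, FrontPoint.outgoing,
      FrontSlab.res] using Chain.single (.crossing A x y B id id (.inl rfl))
  | leftCusp x =>
    simpa [FrontSlab.source, FrontSlab.target, FrontPoint.incoming, FrontPoint.outgoing,
      FrontSlab.res] using Chain.single (.cup A x B)
  | rightCusp x =>
    have := (Chain.single (.crossing A (x + 1) x B id (id ∘ swapAt A.length)
      (.inr ⟨by simp, rfl⟩))).append (Chain.single (.cap A x B))
    simpa [FrontSlab.source, FrontSlab.target, FrontPoint.incoming, FrontPoint.outgoing,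
      FrontSlab.res] using this
  | vertex X Y =>
    have h1 := (braid_halfTwist A X B id (fun i j _ h _ => h)).chain
    have h2 := Step.vertex A X.reverse Y B
    rw [List.length_reverse] at h2
    have := h1.append (Chain.single h2)
    simpa [FrontSlab.source, FrontSlab.target, FrontPoint.incoming, FrontPoint.outgoing,
      FrontSlab.res] using this

theorem chain_res {s t : List (ZMod N)} {es : List (FrontSlab N)} (h : IsFront s es t) :
    Chain s id (es.flatMap FrontSlab.res) t id := by
  induction es generalizing s with
  | nil => cases h; exact .nil _ _
  | cons e es ih =>
    rw [List.flatMap_cons, h.1]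
    exact (chain_res_slab e).append (ih h.2)

/-- Potentials and order labels on all slices of a Lagrangian projection. -/
structure Layout (D : List (LagSlab N)) : Type where
  pot : ℕ → List (ZMod N)
  ord : ℕ → ℕ → ℕ
  step : ∀ k e, D[k]? = some e → Step (pot k) (ord k) e (pot (k + 1)) (ord (k + 1))

/-- The restriction of a layout to an initial part. -/
def Layout.init {D E : List (LagSlab N)} (L : Layout (D ++ E)) : Layout D where
  pot := L.pot
  ord := L.ord
  step k e h := L.step k e (by
    have : k < D.length := (List.getElem?_eq_some_iff.1 h).1
    rw [List.getElem?_append_left this, h])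

theorem Chain.exists_layout {μ μ' : List (ZMod N)} {σ σ' : ℕ → ℕ} {D : List (LagSlab N)}
    (h : Chain μ σ D μ' σ') : ∃ L : Layout D, L.pot 0 = μ ∧ L.ord 0 = σ ∧
      L.pot D.length = μ' ∧ L.ord D.length = σ' := by
  induction h with
  | nil μ σ => exact ⟨⟨fun _ => μ, fun _ => σ, by simp⟩, rfl, rfl, rfl, rfl⟩
  | @cons μ₁ μ₂ μ₃ σ₁ σ₂ σ₃ e es h hs ih =>
    obtain ⟨L, h1, h2, h3, h4⟩ := ih
    refine ⟨⟨fun k => k.casesOn μ₁ L.pot, fun k => k.casesOn σ₁ L.ord, ?_⟩, rfl, rfl, h3, h4⟩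
    intro k e' he'
    cases k with
    | zero =>
      simp only [List.getElem?_cons_zero, Option.some.injEq] at he'
      subst he'
      change Step μ₁ σ₁ e (L.pot 0) (L.ord 0)
      rw [h1, h2]; exact h
    | succ k => exact L.step k e' (by simpa using he')

/-- One layout of the composite diagram whose potentials and labels at the junction are known; this
is the slice at which the two algebras are compared. -/
theorem exists_layout_append {μ₁ μ₂ μ₃ : List (ZMod N)} {σ₁ σ₂ σ₃ : ℕ → ℕ}
    {D E : List (LagSlab N)} (h₁ : Chain μ₁ σ₁ D μ₂ σ₂) (h₂ : Chain μ₂ σ₂ E μ₃ σ₃) :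
    ∃ L : Layout (D ++ E), L.pot 0 = μ₁ ∧ L.ord 0 = σ₁ ∧
      L.pot D.length = μ₂ ∧ L.ord D.length = σ₂ ∧
      L.pot (D.length + E.length) = μ₃ ∧ L.ord (D.length + E.length) = σ₃ := by
  induction h₁ with
  | nil μ σ =>
    obtain ⟨L, h1, h2, h3, h4⟩ := h₂.exists_layout
    exact ⟨L, h1, h2, h1, h2, by simpa using h3, by simpa using h4⟩
  | @cons μ₁ μ₂ μ₃ σ₁ σ₂ σ₃ e es h hs ih =>
    obtain ⟨L, h1, h2, h3, h4, h5, h6⟩ := ih h₂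
    refine ⟨⟨fun k => k.casesOn μ₁ L.pot, fun k => k.casesOn σ₁ L.ord, ?_⟩, rfl, rfl, h3, h4,
      by simpa [Nat.add_right_comm] using h5, by simpa [Nat.add_right_comm] using h6⟩
    intro k e' he'
    cases k with
    | zero =>
      simp only [List.cons_append, List.getElem?_cons_zero, Option.some.injEq] at he'
      subst he'
      change Step μ₁ σ₁ e (L.pot 0) (L.ord 0)
      rw [h1, h2]; exact h
    | succ k => exact L.step k e' (by simpa using he')

variable {D : List (LagSlab N)}

/-! ### Layouts at the different kinds of slabs -/

namespace Layout

theorem crossing (L : Layout D) {k : ℕ} {A B : List (ZMod N)} {x y : ZMod N}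
    (hk : D[k]? = some ⟨A, .crossing x y, B⟩) :
    L.pot k = A ++ x :: y :: B ∧ L.pot (k + 1) = A ++ y :: x :: B ∧
      (L.ord (k + 1) = id ∨ (L.ord k A.length < L.ord k (A.length + 1) ∧
        L.ord (k + 1) = L.ord k ∘ swapAt A.length)) := by
  have h := L.step k _ hk
  generalize L.pot k = μ, L.ord k = σ, L.pot (k + 1) = μ', L.ord (k + 1) = σ' at h ⊢
  cases h with
  | crossing _ _ _ _ _ _ h => exact ⟨rfl, rfl, h⟩

theorem cup (L : Layout D) {k : ℕ} {A B : List (ZMod N)} {x : ZMod N}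
    (hk : D[k]? = some ⟨A, .cup x, B⟩) :
    L.pot k = A ++ B ∧ L.ord k = id ∧ L.pot (k + 1) = A ++ (x + 1) :: x :: B ∧
      L.ord (k + 1) = id := by
  have h := L.step k _ hk
  generalize L.pot k = μ, L.ord k = σ, L.pot (k + 1) = μ', L.ord (k + 1) = σ' at h ⊢
  cases h with
  | cup => exact ⟨rfl, rfl, rfl, rfl⟩

theorem cap (L : Layout D) {k : ℕ} {A B : List (ZMod N)} {x : ZMod N}
    (hk : D[k]? = some ⟨A, .cap x, B⟩) :
    L.pot k = A ++ x :: (x + 1) :: B ∧ L.ord k = swapAt A.length ∧ L.pot (k + 1) = A ++ B ∧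
      L.ord (k + 1) = id := by
  have h := L.step k _ hk
  generalize L.pot k = μ, L.ord k = σ, L.pot (k + 1) = μ', L.ord (k + 1) = σ' at h ⊢
  cases h with
  | cap => exact ⟨rfl, rfl, rfl, rfl⟩

theorem vertex (L : Layout D) {k : ℕ} {A X Y B : List (ZMod N)}
    (hk : D[k]? = some ⟨A, .vertex X Y, B⟩) :
    L.pot k = A ++ X ++ B ∧ L.ord k = revBlock A.length X.length ∧
      L.pot (k + 1) = A ++ Y ++ B ∧ L.ord (k + 1) = id := by
  have h := L.step k _ hk
  generalize L.pot k = μ, L.ord k = σ, L.pot (k + 1) = μ', L.ord (k + 1) = σ' at h ⊢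
  cases h with
  | vertex => exact ⟨rfl, rfl, rfl, rfl⟩

end Layout

/-! ### Arcs, gates and rotations of the boundary -/

theorem lt_length_of_getElem? {α : Type*} {l : List α} {k : ℕ} {e : α} (h : l[k]? = some e) :
    k < l.length := (List.getElem?_eq_some_iff.1 h).1

theorem slab_inj {k : ℕ} {e f : LagSlab N} (he : D[k]? = some e) (hf : D[k]? = some f) :
    e = f := by rw [he] at hf; exact Option.some.inj hf

theorem isRotated_cons_iff {α : Type*} {l r : List α} {a : α} :
    l.IsRotated (a :: r) ↔ ∃ l₁ l₂, l = l₁ ++ a :: l₂ ∧ r = l₂ ++ l₁ := by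
  constructor
  · intro h
    obtain ⟨n, hn, h⟩ := List.isRotated_iff_mod.1 h
    rw [List.rotate_eq_drop_append_take hn] at h
    rcases hd : l.drop n with _ | ⟨b, m⟩
    · rw [hd] at h
      have : l.take n = l := by
        rw [List.take_eq_self_iff]; exact List.drop_eq_nil_iff.1 hd
      rw [this] at h
      exact ⟨[], r, by simpa using h, by simp⟩
    · rw [hd, List.cons_append, List.cons.injEq] at h
      refine ⟨l.take n, m, ?_, h.2.symm⟩
      rw [← h.1, ← hd, List.take_append_drop]
  · rintro ⟨l₁, l₂, rfl, rfl⟩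
    simpa using List.isRotated_append (l := l₁) (l' := a :: l₂)

theorem upperArc_crossing {k l r : ℕ} {c : List (Corner D)} {A B : List (ZMod N)} {x y : ZMod N}
    (hk : D[k]? = some ⟨A, .crossing x y, B⟩) (h : UpperArc D k l r c) :
    (l = r ∧ c = [] ∧ (l < A.length ∨ A.length + 2 ≤ l ∧ l < A.length + 2 + B.length)) ∨
    (l = A.length ∧ r = A.length + 1 ∧ c = []) ∨ (l = A.length + 1 ∧ r = A.length ∧ c = []) ∨
    (l = A.length + 1 ∧ r = A.length + 1 ∧
      c = [⟨.crossing k A x y B hk, koszul (x - y - 1)⟩]) := by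
  rcases h with ⟨e, hk', _, _, h⟩ | ⟨A', x', y', B', hk'⟩ | ⟨A', x', y', B', hk'⟩ |
    ⟨A', x', y', B', hk'⟩
  · obtain rfl := slab_inj hk hk'
    cases h with
    | above _ hq => exact .inl ⟨rfl, rfl, .inl hq⟩
    | below m hm =>
      refine .inl ⟨rfl, rfl, .inr ?_⟩
      simp only [LagPoint.numIn] at *
      omega
  · obtain ⟨rfl, h2, rfl⟩ := LagSlab.mk.inj (slab_inj hk hk')
    exact .inr (.inl ⟨rfl, rfl, rfl⟩)
  · obtain ⟨rfl, h2, rfl⟩ := LagSlab.mk.inj (slab_inj hk hk')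
    exact .inr (.inr (.inl ⟨rfl, rfl, rfl⟩))
  · obtain ⟨rfl, h2, rfl⟩ := LagSlab.mk.inj (slab_inj hk hk')
    obtain ⟨rfl, rfl⟩ := LagPoint.crossing.inj h2
    exact .inr (.inr (.inr ⟨rfl, rfl, rfl⟩))

theorem lowerArc_crossing {k l r : ℕ} {c : List (Corner D)} {A B : List (ZMod N)} {x y : ZMod N}
    (hk : D[k]? = some ⟨A, .crossing x y, B⟩) (h : LowerArc D k l r c) :
    (l = r ∧ c = [] ∧ (l < A.length ∨ A.length + 2 ≤ l ∧ l < A.length + 2 + B.length)) ∨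
    (l = A.length ∧ r = A.length + 1 ∧ c = []) ∨ (l = A.length + 1 ∧ r = A.length ∧ c = []) ∨
    (l = A.length ∧ r = A.length ∧ c = [⟨.crossing k A x y B hk, 1⟩]) := by
  rcases h with ⟨e, hk', _, _, h⟩ | ⟨A', x', y', B', hk'⟩ | ⟨A', x', y', B', hk'⟩ |
    ⟨A', x', y', B', hk'⟩
  · obtain rfl := slab_inj hk hk'
    cases h with
    | above _ hq => exact .inl ⟨rfl, rfl, .inl hq⟩
    | below m hm =>
      refine .inl ⟨rfl, rfl, .inr ?_⟩
      simp only [LagPoint.numIn] at *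
      omega
  · obtain ⟨rfl, h2, rfl⟩ := LagSlab.mk.inj (slab_inj hk hk')
    exact .inr (.inl ⟨rfl, rfl, rfl⟩)
  · obtain ⟨rfl, h2, rfl⟩ := LagSlab.mk.inj (slab_inj hk hk')
    exact .inr (.inr (.inl ⟨rfl, rfl, rfl⟩))
  · obtain ⟨rfl, h2, rfl⟩ := LagSlab.mk.inj (slab_inj hk hk')
    obtain ⟨rfl, rfl⟩ := LagPoint.crossing.inj h2
    exact .inr (.inr (.inr ⟨rfl, rfl, rfl⟩))

theorem upperArc_pass {k l r : ℕ} {c : List (Corner D)} {e : LagSlab N} (hk : D[k]? = some e)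
    (he : ∀ x y, e.point ≠ .crossing x y) (h : UpperArc D k l r c) : c = [] ∧ Passes e l r := by
  rcases h with ⟨e', hk', _, _, h⟩ | ⟨A', x', y', B', hk'⟩ | ⟨A', x', y', B', hk'⟩ |
    ⟨A', x', y', B', hk'⟩
  · obtain rfl := slab_inj hk hk'; exact ⟨rfl, h⟩
  · obtain rfl := slab_inj hk hk'; exact absurd rfl (he _ _)
  · obtain rfl := slab_inj hk hk'; exact absurd rfl (he _ _)
  · obtain rfl := slab_inj hk hk'; exact absurd rfl (he _ _)

theorem lowerArc_pass {k l r : ℕ} {c : List (Corner D)} {e : LagSlab N} (hk : D[k]? = some e)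
    (he : ∀ x y, e.point ≠ .crossing x y) (h : LowerArc D k l r c) : c = [] ∧ Passes e l r := by
  rcases h with ⟨e', hk', _, _, h⟩ | ⟨A', x', y', B', hk'⟩ | ⟨A', x', y', B', hk'⟩ |
    ⟨A', x', y', B', hk'⟩
  · obtain rfl := slab_inj hk hk'; exact ⟨rfl, h⟩
  · obtain rfl := slab_inj hk hk'; exact absurd rfl (he _ _)
  · obtain rfl := slab_inj hk hk'; exact absurd rfl (he _ _)
  · obtain rfl := slab_inj hk hk'; exact absurd rfl (he _ _)

theorem UpperArc.exists_slab {k l r : ℕ} {c : List (Corner D)} (h : UpperArc D k l r c) :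
    ∃ e, D[k]? = some e := by
  cases h <;> exact ⟨_, by assumption⟩

theorem BasePiece.exists_slab {k : ℕ} {bd : List (Gate × List (Corner D))}
    (h : BasePiece D k bd) : ∃ e, D[k]? = some e := by
  cases h with
  | strip _ _ _ _ _ _ ht => exact ht.exists_slab
  | _ => exact ⟨_, by assumption⟩

theorem Sweep.top_lt_bottom {p a b c x j : ℕ} {w : Wall} {gs : List Gate}
    (h : Sweep p a b c w x j gs) : ∀ g ∈ gs, g.top < g.bottom := by
  induction h with
  | leftStop x y hx hy hya hyx => simpa using hyx
  | leftCross x s j gs hx hpx hs h ih =>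
    simp only [List.mem_cons, forall_eq_or_imp]; exact ⟨by omega, ih⟩
  | rightStop x y hy hyb hxy => simpa using hxy
  | rightCross x m j gs hx hm h ih =>
    simp only [List.mem_cons, forall_eq_or_imp]; exact ⟨by omega, ih⟩

theorem BasePiece.top_lt_bottom {k : ℕ} {bd : List (Gate × List (Corner D))}
    (h : BasePiece D k bd) : ∀ gc ∈ bd, gc.1.top < gc.1.bottom := by
  cases h with
  | strip tl tr bl br ct cb ht hb hl hr => simp [hl, hr]
  | cupInner => simp
  | cupOuter A x B hk t m ht hm => simp; omega
  | capInner => simp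
  | capOuter A x B hk t m ht hm => simp; omega
  | fan A X Y B hk h j g gs hs =>
    have := hs.top_lt_bottom
    simp only [List.mem_cons, List.mem_map, List.mem_reverse] at this ⊢
    rintro gc (rfl | ⟨g', hg', rfl⟩)
    · exact this _ (.inl rfl)
    · exact this _ (.inr hg')

/-! ### Energy

The energy of a half is a combinatorial substitute for its area together with the heights of its
corners. -/

namespace Layout

/-- The substitute for the height difference of two strands on a slice. -/
def energy (L : Layout D) (s t b : ℕ) : ℤ :=
  if L.ord s t < L.ord s b then 4 ^ s else s - (D.length + 1)

/-- The energy of the part of a polygon to the left or to the right of a gate. -/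
def halfEnergy (L : Layout D) : Wall → ℕ → ℕ → ℕ → ℤ
  | .left, s, t, b => L.energy s t b
  | .right, s, t, b => - L.energy s t b

/-- The energy of the part of a polygon behind a gate of a piece over slab `k`. -/
def gateEnergy (L : Layout D) (k : ℕ) (g : Gate) : ℤ :=
  L.halfEnergy g.wall (g.slice k) g.top g.bottom

theorem energy_le (L : Layout D) {s : ℕ} (t b : ℕ) (hs : s ≤ D.length) :
    L.energy s t b ≤ 4 ^ s := by
  have : (0 : ℤ) < 4 ^ s := by positivity
  unfold energy
  split_ifs <;> omega

theorem energy_id (L : Layout D) {s t b : ℕ} (h : L.ord s = id) (htb : t < b) :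
    L.energy s t b = 4 ^ s := by
  simp [energy, h, htb]

/-- A boundary arc that goes straight keeps its label. At a crossing that inverts strands, a corner
on the upper arc lowers the label and a corner on the lower arc raises it, so a pair in the right
order stays in the right order. -/
theorem ord_of_strip (L : Layout D) {k tl tr bl br : ℕ} {ct cb : List (Corner D)}
    (ht : UpperArc D k tl tr ct) (hb : LowerArc D k bl br cb) (hl : tl < bl) (hr : tr < br)
    (h : L.ord k tl < L.ord k bl) : L.ord (k + 1) tr < L.ord (k + 1) br := by
  obtain ⟨⟨A, pt, B⟩, hk⟩ := ht.exists_slab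
  cases pt with
  | cup x => simpa [(L.cup hk).2.2.2] using hr
  | cap x => simpa [(L.cap hk).2.2.2] using hr
  | vertex X Y => simpa [(L.vertex hk).2.2.2] using hr
  | crossing x y =>
    obtain h' | ⟨h1, h2⟩ := (L.crossing hk).2.2
    · simpa [h'] using hr
    · have ht := upperArc_crossing hk ht
      have hb := lowerArc_crossing hk hb
      simp only [h2, Function.comp, swapAt]
      rcases ht with ⟨rfl, -, h3⟩ | ⟨rfl, rfl, -⟩ | ⟨rfl, rfl, -⟩ | ⟨rfl, rfl, -⟩ <;>
      rcases hb with ⟨rfl, -, h4⟩ | ⟨rfl, rfl, -⟩ | ⟨rfl, rfl, -⟩ | ⟨rfl, rfl, -⟩ <;>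
      split_ifs <;> omega

/-- Left and right gates alternate along a sweep. No strands are inverted to the right of the
vertex, so a right gate costs the full `4 ^ (k + 1)`, which outweighs the at most `4 ^ k` gained at
each of the left gates beside it. -/
theorem sweep_energy (L : Layout D) {k : ℕ} {A X Y B : List (ZMod N)}
    (hk : D[k]? = some ⟨A, .vertex X Y, B⟩) {w : Wall} {x j : ℕ} {gs : List Gate}
    (h : Sweep A.length X.length Y.length B.length w x j gs) :
    (gs.map (L.gateEnergy k)).sum ≤ match w with | .left => 4 ^ k | .right => -3 * 4 ^ k := by
  have hid := (L.vertex hk).2.2.2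
  have hlen := lt_length_of_getElem? hk
  have e4 : (4 : ℤ) ^ (k + 1) = 4 * 4 ^ k := by ring
  have hpos : (0 : ℤ) < 4 ^ k := by positivity
  induction h with
  | leftStop x y hx hy hya hyx =>
    simpa [gateEnergy, halfEnergy, Gate.slice] using L.energy_le y x hlen.le
  | leftCross x s j gs hx hpx hs h ih =>
    have := L.energy_le s x hlen.le
    simp only [List.map_cons, List.sum_cons, gateEnergy, halfEnergy, Gate.slice] at ih ⊢
    linarith
  | rightStop x y hy hyb hxy =>
    have := L.energy_id hid hxy
    simp only [List.map_cons, List.sum_cons, gateEnergy, halfEnergy, Gate.slice, List.map_nil,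
      List.sum_nil]
    linarith
  | rightCross x m j gs hx hm h ih =>
    have := L.energy_id hid (t := x) (b := A.length + Y.length + m) (by omega)
    simp only [List.map_cons, List.sum_cons, gateEnergy, halfEnergy, Gate.slice] at ih ⊢
    linarith

/-- A piece itself has energy at least one. The base `4` is chosen because some pieces have two left
gates against one right gate. Between inverted strands the energy grows by one per slice, which pays
for a strip there, and the shift by `D.length + 1` keeps it negative on all slices. -/
theorem basePiece_energy (L : Layout D) {k : ℕ} {bd : List (Gate × List (Corner D))}
    (h : BasePiece D k bd) : (bd.map fun gc => L.gateEnergy k gc.1).sum ≤ -1 := by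
  have hlen : k < D.length := lt_length_of_getElem? h.exists_slab.choose_spec
  have e4 : (4 : ℤ) ^ (k + 1) = 4 * 4 ^ k := by ring
  have hpos : (0 : ℤ) < 4 ^ k := by positivity
  cases h with
  | strip tl tr bl br ct cb ht hb hl hr =>
    have := L.ord_of_strip ht hb hl hr
    simp only [List.map_cons, List.map_nil, List.sum_cons, List.sum_nil, gateEnergy, halfEnergy,
      Gate.slice, energy]
    split_ifs with h1 h2 h2
    · omega
    · exact absurd (this h1) h2
    · omega
    · push_cast; omega
  | cupInner A x B hk =>
    have := L.energy_id (L.cup hk).2.2.2 (t := A.length) (b := A.length + 1) (by omega)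
    simp only [List.map_cons, List.map_nil, List.sum_cons, List.sum_nil, gateEnergy, halfEnergy,
      Gate.slice]
    linarith
  | cupOuter A x B hk t m ht hm =>
    have h1 := L.energy_id (L.cup hk).2.2.2 (t := A.length + 1) (b := A.length + 2 + m) (by omega)
    have h2 := L.energy_id (L.cup hk).2.2.2 (t := t) (b := A.length) (by omega)
    have h3 := L.energy_le t (A.length + m) hlen.le
    simp only [List.map_cons, List.map_nil, List.sum_cons, List.sum_nil, gateEnergy, halfEnergy,
      Gate.slice]
    linarith
  | capInner A x B hk =>
    simp only [List.map_cons, List.map_nil, List.sum_cons, List.sum_nil, gateEnergy, halfEnergy,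
      Gate.slice, energy, (L.cap hk).2.1, swapAt]
    simp
    omega
  | capOuter A x B hk t m ht hm =>
    have h1 := L.energy_id (L.cap hk).2.2.2 (t := t) (b := A.length + m) (by omega)
    have h2 := L.energy_le t A.length hlen.le
    have h3 := L.energy_le (A.length + 1) (A.length + 2 + m) hlen.le
    simp only [List.map_cons, List.map_nil, List.sum_cons, List.sum_nil, gateEnergy, halfEnergy,
      Gate.slice]
    linarith
  | fan A X Y B hk h j g gs hs =>
    have e1 : ((((g, [⟨.vertex k A X Y B hk h j, 1⟩]) :: gs.reverse.map fun g' => (g', []) :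
        List (Gate × List (Corner D)))).map fun gc => L.gateEnergy k gc.1).sum =
        ((g :: gs).map (L.gateEnergy k)).sum := by
      simp [List.map_reverse, List.sum_reverse, Function.comp_def]
    rw [e1]
    have hh := h.2
    unfold halfEdgeWall halfEdgeStrand at hs
    split_ifs at hs with hb
    · have := L.sweep_energy hk hs
      simp only at this
      linarith
    · generalize hgs : g :: gs = gs' at hs ⊢
      generalize hx : A.length + (Y.length + X.length - 1 - (h : ℕ)) = x at hs
      generalize (j : ℕ) = j' at hs
      cases hs with
      | leftStop _ y _ hy hya hyx =>
        simp only [List.map_cons, List.map_nil, List.sum_cons, List.sum_nil, gateEnergy,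
          halfEnergy, Gate.slice, energy, (L.vertex hk).2.1, revBlock]
        -- The half twist has inverted all pairs of left edges, so this single gate contributes the
        -- negative value `k - (D.length + 1)`.
        rw [if_neg]
        · omega
        · rw [if_pos (by omega), if_pos (by omega)]; omega
      | leftCross _ s j gs hx hpx hs h =>
        have h1 := L.sweep_energy hk h
        have h2 := L.energy_le s x hlen.le
        simp only [List.map_cons, List.sum_cons, gateEnergy, halfEnergy, Gate.slice] at h1 ⊢
        linarith

/-- The right side is the energy of a half whose root is this piece, so that energy exceeds the
total energy behind the remaining gates. This drives the inductions over halves. -/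
theorem piece_energy (L : Layout D) {k : ℕ} {gc : Gate × List (Corner D)}
    {rest : List (Gate × List (Corner D))} (h : Piece D k (gc :: rest)) :
    (rest.map fun gc => L.gateEnergy k gc.1).sum + 1 ≤ - L.gateEnergy k gc.1 := by
  obtain ⟨bd, h1, h2⟩ := h
  have := L.basePiece_energy h1
  rw [(h2.perm.map _).sum_eq, List.map_cons, List.sum_cons] at this
  linarith

theorem one_le_halfEnergy (L : Layout D) {w : Wall} {s t b : ℕ} (x : Half D w s t b) :
    1 ≤ L.halfEnergy w s t b := by
  have key : ∀ {k : ℕ} {gc : Gate × List (Corner D)} {rest : List (Gate × List (Corner D))},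
      Piece D k (gc :: rest) → (∀ i : Fin rest.length, 1 ≤ L.gateEnergy k (rest.get i).1) →
      1 ≤ - L.gateEnergy k gc.1 := by
    intro k gc rest h ih
    have h1 := L.piece_energy h
    have : 0 ≤ (rest.map fun gc => L.gateEnergy k gc.1).sum := by
      apply List.sum_nonneg
      simp only [List.mem_map]
      rintro _ ⟨gc', hgc, rfl⟩
      obtain ⟨i, rfl⟩ := List.get_of_mem hgc
      linarith [ih i]
    linarith
  induction x with
  | leftOf k t b c rest h child ih =>
    simpa [gateEnergy, halfEnergy, Gate.slice] using key h ih
  | rightOf k t b c rest h child ih => exact key h ih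

/-- A left half has a gate between strands that are not inverted. -/
theorem ord_lt_of_left (L : Layout D) {s t b : ℕ} (x : Half D .left s t b)
    (hs : s ≤ D.length) : L.ord s t < L.ord s b := by
  have := L.one_le_halfEnergy x
  by_contra h
  simp only [halfEnergy, energy, if_neg h] at this
  omega

/-- A right half has a gate between inverted strands. -/
theorem not_ord_lt_of_right (L : Layout D) {s t b : ℕ} (x : Half D .right s t b) :
    ¬ L.ord s t < L.ord s b := by
  have := L.one_le_halfEnergy x
  intro h
  have hpos : (0 : ℤ) < 4 ^ s := by positivity
  simp only [halfEnergy, energy, if_pos h] at this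
  omega

end Layout

theorem Half.top_lt_bottom {w : Wall} {s t b : ℕ} (x : Half D w s t b) : t < b := by
  cases x with
  | leftOf k t b c rest h child =>
    obtain ⟨bd, h1, h2⟩ := h
    exact h1.top_lt_bottom (⟨.right, t, b⟩, c) (h2.mem_iff.2 (by simp))
  | rightOf k t b c rest h child =>
    obtain ⟨bd, h1, h2⟩ := h
    exact h1.top_lt_bottom (⟨.left, t, b⟩, c) (h2.mem_iff.2 (by simp))

/-! ### Halves as trees -/

/-- The parts of a polygon behind the gates `rest` of a piece over slab `k`. -/
abbrev Behind (D : List (LagSlab N)) (k : ℕ) (rest : List (Gate × List (Corner D))) : Type :=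
  ∀ i : Fin rest.length, Half D (rest.get i).1.wall ((rest.get i).1.slice k)
    (rest.get i).1.top (rest.get i).1.bottom

/-- The pieces over slab `k` with a given gate, up to the choice of the boundary reading. -/
abbrev PieceAt (D : List (LagSlab N)) (k : ℕ) (g : Gate) : Type :=
  {κ : List (Corner D) × List (Gate × List (Corner D)) // Piece D k ((g, κ.1) :: κ.2)}

/-- Left halves are trees with a root piece. -/
def leftEquiv (D : List (LagSlab N)) (k t b : ℕ) :
    Half D .left (k + 1) t b ≃ Σ κ : PieceAt D k ⟨.right, t, b⟩, Behind D k κ.1.2 where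
  toFun | .leftOf _ _ _ c rest h child => ⟨⟨(c, rest), h⟩, child⟩
  invFun x := .leftOf k t b x.1.1.1 x.1.1.2 x.1.2 x.2
  left_inv | .leftOf _ _ _ _ _ _ _ => rfl
  right_inv _ := rfl

/-- Right halves are trees with a root piece. -/
def rightEquiv (D : List (LagSlab N)) (k t b : ℕ) :
    Half D .right k t b ≃ Σ κ : PieceAt D k ⟨.left, t, b⟩, Behind D k κ.1.2 where
  toFun | .rightOf _ _ _ c rest h child => ⟨⟨(c, rest), h⟩, child⟩
  invFun x := .rightOf k t b x.1.1.1 x.1.1.2 x.1.2 x.2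
  left_inv | .rightOf _ _ _ _ _ _ _ => rfl
  right_inv _ := rfl

instance (t b : ℕ) : IsEmpty (Half D .left 0 t b) := ⟨fun x => by cases x⟩

/-! ### Finiteness -/

theorem finite_gates (M : ℕ) : {g : Gate | g.top < M ∧ g.bottom < M}.Finite := by
  refine (Set.finite_range fun x : Bool × Fin M × Fin M =>
    (⟨bif x.1 then .left else .right, x.2.1, x.2.2⟩ : Gate)).subset ?_
  rintro ⟨w, t, b⟩ ⟨ht, hb⟩
  cases w
  · exact ⟨(true, ⟨t, ht⟩, ⟨b, hb⟩), rfl⟩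
  · exact ⟨(false, ⟨t, ht⟩, ⟨b, hb⟩), rfl⟩

theorem finite_lists {α : Type*} {s : Set α} (hs : s.Finite) (n : ℕ) :
    {l : List α | l.length ≤ n ∧ ∀ x ∈ l, x ∈ s}.Finite := by
  have := hs.to_subtype
  refine ((List.finite_length_le s n).image (List.map Subtype.val)).subset ?_
  rintro l ⟨h1, h2⟩
  lift l to List s using h2
  exact ⟨l, by simpa using h1, rfl⟩

theorem Passes.lt {e : LagSlab N} {l r : ℕ} (h : Passes e l r) :
    l < e.above.length + e.point.numIn + e.point.numOut + e.below.length ∧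
    r < e.above.length + e.point.numIn + e.point.numOut + e.below.length := by
  cases h <;> omega

theorem Sweep.bounds {p a b c x j : ℕ} {w : Wall} {gs : List Gate}
    (h : Sweep p a b c w x j gs) : j ≤ (p + a + b + c) * gs.length ∧
      ∀ g ∈ gs, g.top < p + a + b + c ∧ g.bottom < p + a + b + c := by
  induction h with
  | leftStop x y hx hy hya hyx => simp; omega
  | leftCross x s j gs hx hpx hs h ih =>
    simp only [List.length_cons, mul_add, mul_one, List.mem_cons, forall_eq_or_imp]
    exact ⟨by omega, ⟨by omega, by omega⟩, ih.2⟩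
  | rightStop x y hy hyb hxy => simp; omega
  | rightCross x m j gs hx hm h ih =>
    simp only [List.length_cons, mul_add, mul_one, List.mem_cons, forall_eq_or_imp]
    exact ⟨by omega, ⟨by omega, by omega⟩, ih.2⟩

/-- Without the bound on the number of gates this can fail: a fan may wind around its vertex
arbitrarily often. Each gate of a sweep accounts for a bounded number of sectors, so a bound on the
gates also bounds the index `j` of the corner. -/
theorem finite_basePieces (k n : ℕ) :
    {bd : List (Gate × List (Corner D)) | BasePiece D k bd ∧ bd.length ≤ n}.Finite := by
  rcases hk : D[k]? with _ | ⟨A, pt, B⟩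
  · convert Set.finite_empty
    refine Set.eq_empty_of_forall_notMem fun bd hbd => ?_
    obtain ⟨e, he⟩ := hbd.1.exists_slab
    rw [hk] at he; cases he
  set M := A.length + pt.numIn + pt.numOut + B.length with hM
  suffices ∃ C : Set (List (Corner D)), C.Finite ∧ ∀ bd, BasePiece D k bd → bd.length ≤ n →
      ∀ gc ∈ bd, (gc.1.top < M ∧ gc.1.bottom < M) ∧ gc.2 ∈ C by
    obtain ⟨C, hC, h⟩ := this
    refine (finite_lists ((finite_gates M).prod hC) n).subset ?_
    rintro bd ⟨h1, h2⟩
    exact ⟨h2, h bd h1 h2⟩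
  cases pt with
  | crossing x y =>
    refine ⟨{[], [⟨.crossing k A x y B hk, koszul (x - y - 1)⟩], [⟨.crossing k A x y B hk, 1⟩]},
      Set.toFinite _, fun bd hbd hn => ?_⟩
    cases hbd with
    | strip tl tr bl br ct cb ht hb hl hr =>
      simp only [LagPoint.numIn, LagPoint.numOut] at hM
      have ht := upperArc_crossing hk ht
      have hb := lowerArc_crossing hk hb
      simp only [List.mem_cons, List.not_mem_nil, or_false, forall_eq_or_imp, forall_eq,
        Set.mem_insert_iff, Set.mem_singleton_iff]
      refine ⟨⟨⟨by omega, by omega⟩, ?_⟩, ⟨⟨by omega, by omega⟩, ?_⟩⟩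
      · rcases hb with ⟨-, h, -⟩ | ⟨-, -, h⟩ | ⟨-, -, h⟩ | ⟨-, -, h⟩ <;> simp [h]
      · rcases ht with ⟨-, h, -⟩ | ⟨-, -, h⟩ | ⟨-, -, h⟩ | ⟨-, -, h⟩ <;> simp [h]
    | cupInner _ _ _ hk' => cases slab_inj hk hk'
    | cupOuter _ _ _ hk' => cases slab_inj hk hk'
    | capInner _ _ _ hk' => cases slab_inj hk hk'
    | capOuter _ _ _ hk' => cases slab_inj hk hk'
    | fan _ _ _ _ hk' => cases slab_inj hk hk'
  | cup x =>
    refine ⟨{[]}, Set.toFinite _, fun bd hbd hn => ?_⟩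
    simp only [LagPoint.numIn, LagPoint.numOut] at hM
    cases hbd with
    | strip tl tr bl br ct cb ht hb hl hr =>
      obtain ⟨rfl, ht'⟩ := upperArc_pass hk (by simp) ht
      obtain ⟨rfl, hb'⟩ := lowerArc_pass hk (by simp) hb
      have ht := ht'.lt
      have hb := hb'.lt
      simp only [LagPoint.numIn, LagPoint.numOut] at ht hb
      simp; omega
    | cupInner _ _ _ hk' => cases slab_inj hk hk'; simp; omega
    | cupOuter _ _ _ hk' => cases slab_inj hk hk'; simp; omega
    | capInner _ _ _ hk' => cases slab_inj hk hk'
    | capOuter _ _ _ hk' => cases slab_inj hk hk'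
    | fan _ _ _ _ hk' => cases slab_inj hk hk'
  | cap x =>
    refine ⟨{[]}, Set.toFinite _, fun bd hbd hn => ?_⟩
    simp only [LagPoint.numIn, LagPoint.numOut] at hM
    cases hbd with
    | strip tl tr bl br ct cb ht hb hl hr =>
      obtain ⟨rfl, ht'⟩ := upperArc_pass hk (by simp) ht
      obtain ⟨rfl, hb'⟩ := lowerArc_pass hk (by simp) hb
      have ht := ht'.lt
      have hb := hb'.lt
      simp only [LagPoint.numIn, LagPoint.numOut] at ht hb
      simp; omega
    | cupInner _ _ _ hk' => cases slab_inj hk hk'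
    | cupOuter _ _ _ hk' => cases slab_inj hk hk'
    | capInner _ _ _ hk' => cases slab_inj hk hk'; simp; omega
    | capOuter _ _ _ hk' => cases slab_inj hk hk'; simp; omega
    | fan _ _ _ _ hk' => cases slab_inj hk hk'
  | vertex X Y =>
    simp only [LagPoint.numIn, LagPoint.numOut] at hM
    refine ⟨insert [] ((fun x : Fin (Y.length + X.length) × ℕ+ =>
      [(⟨.vertex k A X Y B hk x.1 x.2, 1⟩ : Corner D)]) '' {x | (x.2 : ℕ) ≤ M * n}),
      (Set.Finite.image _ ?_).insert _, fun bd hbd hn => ?_⟩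
    · have : {x : Fin (Y.length + X.length) × ℕ+ | (x.2 : ℕ) ≤ M * n} ⊆
          Set.univ ×ˢ (PNat.val ⁻¹' Set.Iic (M * n)) := fun x hx => ⟨trivial, hx⟩
      exact (Set.finite_univ.prod ((Set.finite_Iic _).preimage
        PNat.coe_injective.injOn)).subset this
    cases hbd with
    | strip tl tr bl br ct cb ht hb hl hr =>
      obtain ⟨rfl, ht'⟩ := upperArc_pass hk (by simp) ht
      obtain ⟨rfl, hb'⟩ := lowerArc_pass hk (by simp) hb
      have ht := ht'.lt
      have hb := hb'.lt
      simp only [LagPoint.numIn, LagPoint.numOut] at ht hb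
      simp; omega
    | cupInner _ _ _ hk' => cases slab_inj hk hk'
    | cupOuter _ _ _ hk' => cases slab_inj hk hk'
    | capInner _ _ _ hk' => cases slab_inj hk hk'
    | capOuter _ _ _ hk' => cases slab_inj hk hk'
    | fan A' X' Y' B' hk' h j g gs hs =>
      cases slab_inj hk hk'
      obtain ⟨h1, h2⟩ := hs.bounds
      rw [← hM] at h1 h2
      simp only [List.mem_cons, forall_eq_or_imp] at h2
      simp only [List.length_cons, List.length_map, List.length_reverse] at hn h1
      simp only [List.mem_cons, List.mem_map, List.mem_reverse, forall_eq_or_imp,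
        forall_exists_index, and_imp]
      refine ⟨⟨h2.1, .inr ⟨(h, j), ?_, rfl⟩⟩, ?_⟩
      · exact h1.trans (Nat.mul_le_mul_left _ hn)
      · rintro _ g' hg' rfl
        exact ⟨h2.2 _ hg', .inl rfl⟩

theorem finite_pieceAt (k : ℕ) (g : Gate) (n : ℕ) :
    Finite {κ : PieceAt D k g // κ.1.2.length ≤ n} := by
  have h1 := finite_basePieces (D := D) k (n + 1)
  have : {bd : List (Gate × List (Corner D)) | Piece D k bd ∧ bd.length ≤ n + 1}.Finite := by
    refine (h1.biUnion fun bd _ => (Set.finite_range fun i : Fin (bd.length + 1) =>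
      bd.rotate i)).subset ?_
    rintro bd ⟨⟨bd₀, h2, h3⟩, h4⟩
    have h5 := h3.perm.length_eq
    obtain ⟨i, hi, h6⟩ := List.isRotated_iff_mod.1 h3
    simp only [Set.mem_iUnion]
    exact ⟨bd₀, ⟨h2, by omega⟩, ⟨i, by omega⟩, h6⟩
  have : Finite {bd : List (Gate × List (Corner D)) // Piece D k bd ∧ bd.length ≤ n + 1} :=
    this.to_subtype
  refine Finite.of_injective (β := {bd : List (Gate × List (Corner D)) // Piece D k bd ∧
    bd.length ≤ n + 1}) (fun κ => ⟨(g, κ.1.1.1) :: κ.1.1.2, κ.1.2, by simpa using κ.2⟩) ?_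
  rintro ⟨⟨⟨c, r⟩, _⟩, _⟩ ⟨⟨⟨c', r'⟩, _⟩, _⟩ h
  simp only [Subtype.mk.injEq, List.cons.injEq, Prod.mk.injEq, true_and] at h
  simp [h]

/-- The parts behind the remaining gates each have energy at least one, and their sum is less than
the energy of the whole. So there are at most `n` of them, each with energy below `n`; only finitely
many root pieces qualify, and the induction hypothesis handles the rest. -/
theorem Layout.finite_trees (L : Layout D) (k : ℕ) (g : Gate) (n : ℕ)
    (hn : - L.gateEnergy k g < (n + 1 : ℕ))
    (ih : ∀ w s t b, L.halfEnergy w s t b < n → Finite (Half D w s t b)) :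
    Finite (Σ κ : PieceAt D k g, Behind D k κ.1.2) := by
  have bound : ∀ (κ : PieceAt D k g) (_ : Behind D k κ.1.2), κ.1.2.length ≤ n ∧
      ∀ gc ∈ κ.1.2, L.gateEnergy k gc.1 < n := by
    intro κ ch
    have h1 := L.piece_energy κ.2
    have h2 : ∀ x ∈ κ.1.2.map fun gc => L.gateEnergy k gc.1, 1 ≤ x := by
      simp only [List.mem_map]
      rintro _ ⟨gc', hgc, rfl⟩
      obtain ⟨i, rfl⟩ := List.get_of_mem hgc
      exact L.one_le_halfEnergy (ch i)
    have h3 := List.card_nsmul_le_sum _ 1 h2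
    simp only [List.length_map, nsmul_eq_mul, mul_one] at h3
    refine ⟨by simp only at h1; omega, fun gc hgc => ?_⟩
    have h4 := List.single_le_sum (fun x hx => zero_le_one.trans (h2 x hx)) _
      (List.mem_map_of_mem (f := fun gc => L.gateEnergy k gc.1) hgc)
    simp only at h1 h4
    omega
  have := finite_pieceAt (D := D) k g n
  have : ∀ κ : {κ : PieceAt D k g // κ.1.2.length ≤ n}, Finite (Behind D k κ.1.1.2) := by
    intro κ
    by_cases h : ∀ gc ∈ κ.1.1.2, L.gateEnergy k gc.1 < n
    · have := fun i : Fin κ.1.1.2.length => ih _ _ _ _ (h _ (List.get_mem _ i))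
      exact Pi.finite
    · have : IsEmpty (Behind D k κ.1.1.2) := ⟨fun ch => h (bound κ.1 ch).2⟩
      infer_instance
  refine Finite.of_injective (β := Σ κ : {κ : PieceAt D k g // κ.1.2.length ≤ n},
    Behind D k κ.1.1.2) (fun x => ⟨⟨x.1, (bound x.1 x.2).1⟩, x.2⟩) ?_
  rintro ⟨κ, x⟩ ⟨κ', x'⟩ h
  simp only [Sigma.mk.injEq, Subtype.mk.injEq] at h
  obtain ⟨rfl, h⟩ := h
  simpa using h

theorem Layout.finite_half (L : Layout D) (w : Wall) (s t b : ℕ) : Finite (Half D w s t b) := by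
  suffices ∀ n : ℕ, ∀ w s t b, L.halfEnergy w s t b < n → Finite (Half D w s t b) from
    this ((L.halfEnergy w s t b).toNat + 1) w s t b (by push_cast; omega)
  intro n
  induction n with
  | zero =>
    intro w s t b h
    have : IsEmpty (Half D w s t b) := ⟨fun x => by
      have := L.one_le_halfEnergy x
      push_cast at h; omega⟩
    infer_instance
  | succ n ih =>
    intro w s t b h
    cases w with
    | left =>
      cases s with
      | zero => infer_instance
      | succ k =>
        have := L.finite_trees k ⟨.right, t, b⟩ n
          (by simpa [gateEnergy, halfEnergy, Gate.slice] using h) ih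
        exact Finite.of_equiv _ (leftEquiv D k t b).symm
    | right =>
      have := L.finite_trees s ⟨.left, t, b⟩ n
        (by simpa [gateEnergy, halfEnergy, Gate.slice] using h) ih
      exact Finite.of_equiv _ (rightEquiv D s t b).symm

theorem Layout.finitelyManyPolygons (L : Layout D) : FinitelyManyPolygons D := by
  intro k A x y B _
  have := L.finite_half
  exact Set.toFinite _

/-! ### Signs -/

/-- As `N` is even, the parity of an integer survives reduction modulo `N`; for `N = 0` the function
`ZMod.val` is the absolute value, which also keeps the parity. -/
theorem koszul_intCast (hN : Even N) (n : ℤ) : koszul (n : ZMod N) = (n.negOnePow : ℤ) := by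
  have h : Even (n : ZMod N).val ↔ Even n := by
    rcases Nat.eq_zero_or_pos N with rfl | hpos
    · exact Int.natAbs_even
    · have : NeZero N := ⟨hpos.ne'⟩
      have h1 := ZMod.val_intCast (n := N) n
      obtain ⟨M, rfl⟩ := hN
      rw [← Int.even_coe_nat, h1]
      conv_rhs => rw [← Int.mul_ediv_add_emod n ((M + M : ℕ) : ℤ)]
      rw [Int.even_add, Int.even_mul]
      have : Even (((M + M : ℕ) : ℤ)) := ⟨M, by push_cast; rfl⟩
      tauto
  rcases Int.even_or_odd n with hn | hn
  · rw [koszul, (h.2 hn).neg_one_pow, Int.negOnePow_even n hn]; rfl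
  · rw [koszul, (Nat.not_even_iff_odd.1 fun h' => (Int.not_even_iff_odd.2 hn) (h.1 h')).neg_one_pow,
      Int.negOnePow_odd n hn]; rfl

theorem koszul_add (hN : Even N) (a b : ZMod N) : koszul (a + b) = koszul a * koszul b := by
  obtain ⟨a, rfl⟩ := ZMod.intCast_surjective a
  obtain ⟨b, rfl⟩ := ZMod.intCast_surjective b
  rw [← Int.cast_add, koszul_intCast hN, koszul_intCast hN, koszul_intCast hN,
    Int.negOnePow_add]
  rfl

theorem koszul_zero : koszul (0 : ZMod N) = 1 := by simp [koszul]

theorem koszul_one (hN : Even N) : koszul (1 : ZMod N) = -1 := by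
  have := koszul_intCast hN 1
  simpa using this

theorem koszul_mul_self (g : ZMod N) : koszul g * koszul g = 1 := by
  rw [koszul, ← pow_add, ← two_mul, pow_mul]; simp

theorem koszul_neg (hN : Even N) (a : ZMod N) : koszul (-a) = koszul a := by
  have h1 : koszul a * koszul (-a) = 1 := by rw [← koszul_add hN, add_neg_cancel, koszul_zero]
  linear_combination koszul a * h1 - koszul (-a) * koszul_mul_self a

theorem koszul_sub (hN : Even N) (a b : ZMod N) : koszul (a - b) = koszul a * koszul b := by
  rw [sub_eq_add_neg, koszul_add hN, koszul_neg hN]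

theorem koszul_natCast (hN : Even N) (n : ℕ) : koszul (n : ZMod N) = (-1) ^ n := by
  induction n with
  | zero => simp [koszul_zero]
  | succ n ih => rw [Nat.cast_succ, koszul_add hN, ih, koszul_one hN, pow_succ]

/-! ### The degree of the word of a half -/

/-- Every full turn meets the vertical line twice; beyond full turns only the sides of the first and
last half-edge matter. The indicators of `b ≤ h` and `b ≤ κ` record whether these lie on the left.
-/
theorem exists_spiralCrossings (a b h j : ℕ) (hh : h < b + a) : ∃ κ W, κ < b + a ∧
    h + j = κ + W * (b + a) ∧ spiralCrossings a b h j + (if b ≤ h then 1 else 0) =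
      2 * W + if b ≤ κ then 1 else 0 := by
  induction j with
  | zero => exact ⟨h, 0, hh, by simp, by simp [spiralCrossings]⟩
  | succ j ih =>
    obtain ⟨κ, W, h1, h2, h3⟩ := ih
    have e : spiralCrossings a b h (j + 1) = spiralCrossings a b h j +
        ((if h + j + 1 ≡ 0 [MOD b + a] then 1 else 0) +
          if h + j + 1 ≡ b [MOD b + a] then 1 else 0) := by
      have : Finset.Ioc h (h + (j + 1)) = insert (h + j + 1) (Finset.Ioc h (h + j)) := by
        ext m; simp; omega
      unfold spiralCrossings
      rw [this, Finset.filter_insert, Finset.filter_insert]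
      split_ifs <;> simp <;> ring
    have hm : ∀ v, h + j + 1 ≡ v [MOD b + a] ↔ κ + 1 ≡ v [MOD b + a] := by
      intro v
      have : h + j + 1 ≡ κ + 1 [MOD b + a] := by
        rw [h2, add_right_comm]
        simp [Nat.ModEq]
      exact ⟨fun h => this.symm.trans h, fun h => this.trans h⟩
    rw [e]
    simp only [hm]
    rcases Nat.lt_or_ge (κ + 1) (b + a) with hk | hk
    · refine ⟨κ + 1, W, hk, by omega, ?_⟩
      have e0 : ¬ κ + 1 ≡ 0 [MOD b + a] := by
        rw [Nat.ModEq, Nat.mod_eq_of_lt hk]; simp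
      rw [if_neg e0]
      have e1 : κ + 1 ≡ b [MOD b + a] ↔ κ + 1 = b := by
        rw [Nat.ModEq, Nat.mod_eq_of_lt hk]
        rcases Nat.eq_zero_or_pos a with rfl | ha
        · simp; omega
        · rw [Nat.mod_eq_of_lt (by omega)]
      simp only [e1]
      split_ifs at h3 ⊢ <;> omega
    · have hk : κ + 1 = b + a := by omega
      refine ⟨0, W + 1, by omega, by rw [add_mul]; omega, ?_⟩
      rw [hk]
      have e0 : b + a ≡ 0 [MOD b + a] := by simp [Nat.ModEq]
      rw [if_pos e0]
      -- If all edges lie on one side, the single sector from the last half-edge to the first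
      -- contains both halves of the vertical line.
      have e1 : b + a ≡ b [MOD b + a] ↔ b = 0 ∨ a = 0 := by
        rw [Nat.ModEq, Nat.mod_self]
        constructor
        · intro h
          by_contra hh
          rw [Nat.mod_eq_of_lt (by omega)] at h
          omega
        · rintro (rfl | rfl) <;> simp
      simp only [e1]
      split_ifs at h3 ⊢ <;> omega

/-- One more than the number of the last half-edge before the start of a sweep. -/
def sweepStart (p a b : ℕ) : Wall → ℕ → ℕ
  | .left, x => b + (p + a - min x (p + a))
  | .right, x => max (x + 1) p - p

/-- The number of a wall. -/
def wallIndex : Wall → ℕ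
  | .left => 1
  | .right => 0

/-- The sum of the degrees of some corners. -/
def cornerDeg (c : List (Corner D)) : ZMod N := (c.map fun c => c.gen.degree).sum

@[simp] theorem cornerDeg_nil : cornerDeg ([] : List (Corner D)) = 0 := rfl

theorem cornerDeg_append (c c' : List (Corner D)) :
    cornerDeg (c ++ c') = cornerDeg c + cornerDeg c' := by simp [cornerDeg]

namespace Layout

/-- The potential of a strand on a slice. -/
def potAt (L : Layout D) (s t : ℕ) : ZMod N := (L.pot s).getD t 0

/-- The degree of the word of a half. -/
def halfDeg (L : Layout D) : Wall → ℕ → ℕ → ℕ → ZMod N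
  | .left, s, t, b => L.potAt s t - L.potAt s b - 1
  | .right, s, t, b => L.potAt s b - L.potAt s t - 1

/-- The degree of the word of the part of a polygon behind a gate. -/
def gateDeg (L : Layout D) (k : ℕ) (g : Gate) : ZMod N :=
  L.halfDeg g.wall (g.slice k) g.top g.bottom

theorem potAt_pass (L : Layout D) {k l r : ℕ} {e : LagSlab N} (hk : D[k]? = some e)
    (h : Passes e l r) : L.potAt k l = L.potAt (k + 1) r := by
  obtain ⟨A, pt, B⟩ := e
  simp only [potAt, List.getD_eq_getElem?_getD]
  cases pt with
  | crossing x y =>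
    rw [(L.crossing hk).1, (L.crossing hk).2.1]
    cases h with
    | above q hq => simp only at hq; simp [List.getElem?_append, hq]
    | below m hm =>
      simp only [LagPoint.numIn, LagPoint.numOut]
      rw [List.getElem?_append_right (by omega), List.getElem?_append_right (by omega)]
      rw [show A.length + 2 + m - A.length = m + 2 by omega]; simp
  | cup x =>
    rw [(L.cup hk).1, (L.cup hk).2.2.1]
    cases h with
    | above q hq => simp only at hq; simp [List.getElem?_append, hq]
    | below m hm =>
      simp only [LagPoint.numIn, LagPoint.numOut]
      rw [List.getElem?_append_right (by omega), List.getElem?_append_right (by omega)]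
      rw [show A.length + 2 + m - A.length = m + 2 by omega]; simp
  | cap x =>
    rw [(L.cap hk).1, (L.cap hk).2.2.1]
    cases h with
    | above q hq => simp only at hq; simp [List.getElem?_append, hq]
    | below m hm =>
      simp only [LagPoint.numIn, LagPoint.numOut]
      rw [List.getElem?_append_right (by omega), List.getElem?_append_right (by omega)]
      rw [show A.length + 2 + m - A.length = m + 2 by omega]; simp
  | vertex X Y =>
    rw [(L.vertex hk).1, (L.vertex hk).2.2.1]
    cases h with
    | above q hq => simp only at hq; simp [List.getElem?_append, hq]
    | below m hm =>
      simp only [LagPoint.numIn, LagPoint.numOut]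
      rw [List.getElem?_append_right (by simp), List.getElem?_append_right (by simp)]
      simp

theorem potAt_crossing (L : Layout D) {k : ℕ} {A B : List (ZMod N)} {x y : ZMod N}
    (hk : D[k]? = some ⟨A, .crossing x y, B⟩) : L.potAt k A.length = x ∧
      L.potAt k (A.length + 1) = y ∧ L.potAt (k + 1) A.length = y ∧
      L.potAt (k + 1) (A.length + 1) = x := by
  simp [potAt, L.crossing hk, List.getD_eq_getElem?_getD]

theorem potAt_cup (L : Layout D) {k : ℕ} {A B : List (ZMod N)} {x : ZMod N}
    (hk : D[k]? = some ⟨A, .cup x, B⟩) : L.potAt (k + 1) A.length = x + 1 ∧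
      L.potAt (k + 1) (A.length + 1) = x := by
  simp [potAt, L.cup hk, List.getD_eq_getElem?_getD]

theorem potAt_cap (L : Layout D) {k : ℕ} {A B : List (ZMod N)} {x : ZMod N}
    (hk : D[k]? = some ⟨A, .cap x, B⟩) : L.potAt k A.length = x ∧
      L.potAt k (A.length + 1) = x + 1 := by
  simp [potAt, L.cap hk, List.getD_eq_getElem?_getD]

/-- The potential of a strand on the left or right side of a slab. -/
def sidePot (L : Layout D) (k : ℕ) : Wall → ℕ → ZMod N
  | .left => L.potAt k
  | .right => L.potAt (k + 1)

theorem sidePot_halfEdge (L : Layout D) {k : ℕ} {A X Y B : List (ZMod N)}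
    (hk : D[k]? = some ⟨A, .vertex X Y, B⟩) (h : Fin (Y.length + X.length)) :
    L.sidePot k (halfEdgeWall Y.length h) (halfEdgeStrand A.length X.length Y.length h) =
      halfEdgePotential X Y h := by
  have hh := h.2
  simp only [halfEdgeWall, halfEdgeStrand, halfEdgePotential, List.get_eq_getElem, Fin.val_cast]
  split_ifs with hb
  · simp [sidePot, potAt, L.vertex hk, List.getD_eq_getElem?_getD, List.getElem?_append, hb]
  · have : Y.length + X.length - 1 - (h : ℕ) < X.length := by omega
    simp only [sidePot, potAt, (L.vertex hk).1, List.append_assoc, List.getD_eq_getElem?_getD,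
      List.getElem_append, hb]
    rw [List.getElem?_append_right (by omega), List.getElem?_append_left (by omega)]
    simp only [add_tsub_cancel_left, List.getElem_reverse, dite_false]
    rw [List.getElem?_eq_getElem (by omega), Option.getD_some]
    congr 1; omega

theorem upperArc_deg (L : Layout D) {k l r : ℕ} {c : List (Corner D)} (h : UpperArc D k l r c) :
    cornerDeg c = L.potAt (k + 1) r - L.potAt k l := by
  rcases h with ⟨e, hk, _, _, h⟩ | ⟨A, x, y, B, hk⟩ | ⟨A, x, y, B, hk⟩ | ⟨A, x, y, B, hk⟩
  · simp [L.potAt_pass hk h]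
  · simp [L.potAt_crossing hk]
  · simp [L.potAt_crossing hk]
  · simp [L.potAt_crossing hk, cornerDeg, Gen.degree]

theorem lowerArc_deg (L : Layout D) {k l r : ℕ} {c : List (Corner D)} (h : LowerArc D k l r c) :
    cornerDeg c = L.potAt k l - L.potAt (k + 1) r := by
  rcases h with ⟨e, hk, _, _, h⟩ | ⟨A, x, y, B, hk⟩ | ⟨A, x, y, B, hk⟩ | ⟨A, x, y, B, hk⟩
  · simp [L.potAt_pass hk h]
  · simp [L.potAt_crossing hk]
  · simp [L.potAt_crossing hk]
  · simp [L.potAt_crossing hk, cornerDeg, Gen.degree]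

/-- Each gate contributes the difference of the potentials of its two bounding strands minus one.
Consecutive gates share a strand above or below the vertex, so the sum telescopes, and the winding
and the sides of both ends determine the number of gates. -/
theorem sweep_deg (L : Layout D) {k : ℕ} {A X Y B : List (ZMod N)}
    (hk : D[k]? = some ⟨A, .vertex X Y, B⟩) {w : Wall} {x j : ℕ} {gs : List Gate}
    (h : Sweep A.length X.length Y.length B.length w x j gs) : ∃ κ W,
      κ < Y.length + X.length ∧
      sweepStart A.length X.length Y.length w x + j = κ + 1 + W * (Y.length + X.length) ∧
      gs.length + wallIndex w =
        2 * W + (if Y.length ≤ κ then 1 else 0) + 1 ∧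
      (gs.map (L.gateDeg k)).sum = L.sidePot k (halfEdgeWall Y.length κ)
        (halfEdgeStrand A.length X.length Y.length κ) - L.sidePot k w x - gs.length := by
  induction h with
  | leftStop x y hx hy hya hyx =>
    have e : ¬ Y.length + (A.length + X.length - 1 - y) < Y.length := by omega
    have e' : A.length + (Y.length + X.length - 1 - (Y.length + (A.length + X.length - 1 - y)))
      = y := by omega
    refine ⟨Y.length + (A.length + X.length - 1 - y), 0, by omega, ?_, ?_, ?_⟩
    · simp only [sweepStart]; omega
    · simp [wallIndex]
    · simp [gateDeg, halfDeg, Gate.slice, halfEdgeWall, halfEdgeStrand, sidePot, e']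
  | leftCross x s j gs hx hpx hs h ih =>
    obtain ⟨κ, W, h1, h2, h3, h4⟩ := ih
    refine ⟨κ, W + 1, h1, ?_, ?_, ?_⟩
    · simp only [sweepStart] at h2 ⊢
      rw [add_mul]; omega
    · simp only [List.length_cons, wallIndex] at h3 ⊢; omega
    · rw [List.map_cons, List.sum_cons, h4]
      have := L.potAt_pass hk (.above s hs)
      simp only [gateDeg, halfDeg, Gate.slice, sidePot, this, List.length_cons]
      push_cast; ring
  | rightStop x y hy hyb hxy =>
    have e : y - A.length < Y.length := by omega
    have e' : A.length + (y - A.length) = y := by omega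
    refine ⟨y - A.length, 0, by omega, ?_, ?_, ?_⟩
    · simp only [sweepStart]; omega
    · simp [e, wallIndex]
    · simp [gateDeg, halfDeg, Gate.slice, halfEdgeWall, halfEdgeStrand, sidePot, e, e']
  | rightCross x m j gs hx hm h ih =>
    obtain ⟨κ, W, h1, h2, h3, h4⟩ := ih
    refine ⟨κ, W, h1, ?_, ?_, ?_⟩
    · simp only [sweepStart] at h2 ⊢
      omega
    · simp only [List.length_cons, wallIndex] at h3 ⊢; omega
    · rw [List.map_cons, List.sum_cons, h4]
      have := L.potAt_pass hk (.below m hm)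
      simp only [LagPoint.numIn, LagPoint.numOut] at this
      simp only [gateDeg, halfDeg, Gate.slice, sidePot, this, List.length_cons]
      push_cast; ring

/-- The degrees assigned to the two sides of a gate add up to `-2`. This makes the total `-2` for
each piece exactly the balance that is preserved when pieces are glued along gates. -/
theorem basePiece_deg (L : Layout D) {k : ℕ} {bd : List (Gate × List (Corner D))}
    (h : BasePiece D k bd) :
    (bd.map fun gc => L.gateDeg k gc.1 + cornerDeg gc.2).sum = -2 := by
  cases h with
  | strip tl tr bl br ct cb ht hb hl hr =>
    simp only [List.map_cons, List.map_nil, List.sum_cons, List.sum_nil, gateDeg, halfDeg,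
      Gate.slice, L.upperArc_deg ht, L.lowerArc_deg hb]
    ring
  | cupInner A x B hk =>
    simp only [List.map_cons, List.map_nil, List.sum_cons, List.sum_nil, gateDeg, halfDeg,
      Gate.slice, L.potAt_cup hk, cornerDeg_nil]
    ring
  | cupOuter A x B hk t m ht hm =>
    have h1 := L.potAt_pass hk (.above t ht)
    have h2 := L.potAt_pass hk (.below m hm)
    simp only [LagPoint.numIn, LagPoint.numOut, add_zero] at h2
    simp only [List.map_cons, List.map_nil, List.sum_cons, List.sum_nil, gateDeg, halfDeg,
      Gate.slice, L.potAt_cup hk, cornerDeg_nil, h1, h2]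
    ring
  | capInner A x B hk =>
    simp only [List.map_cons, List.map_nil, List.sum_cons, List.sum_nil, gateDeg, halfDeg,
      Gate.slice, L.potAt_cap hk, cornerDeg_nil]
    ring
  | capOuter A x B hk t m ht hm =>
    have h1 := L.potAt_pass hk (.above t ht)
    have h2 := L.potAt_pass hk (.below m hm)
    simp only [LagPoint.numIn, LagPoint.numOut, add_zero] at h2
    simp only [List.map_cons, List.map_nil, List.sum_cons, List.sum_nil, gateDeg, halfDeg,
      Gate.slice, L.potAt_cap hk, cornerDeg_nil, h1, h2]
    ring
  | fan A X Y B hk h j g gs hs =>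
    have e1 : ((((g, [⟨.vertex k A X Y B hk h j, 1⟩]) :: gs.reverse.map fun g' => (g', []) :
        List (Gate × List (Corner D)))).map fun gc => L.gateDeg k gc.1 + cornerDeg gc.2).sum =
        ((g :: gs).map (L.gateDeg k)).sum + (Gen.vertex k A X Y B hk h j).degree := by
      simp [List.map_reverse, List.sum_reverse, Function.comp_def, cornerDeg]
      ring
    have hh := h.2
    obtain ⟨κ, W, h1, h2, h3, h4⟩ := L.sweep_deg hk hs
    obtain ⟨κ', W', h1', h2', h3'⟩ := exists_spiralCrossings X.length Y.length h j hh
    have e2 : sweepStart A.length X.length Y.length (halfEdgeWall Y.length h)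
        (halfEdgeStrand A.length X.length Y.length h) = (h : ℕ) + 1 := by
      simp only [halfEdgeWall, halfEdgeStrand]
      split_ifs <;> simp only [sweepStart] <;> omega
    rw [e2] at h2
    have e3 : κ + W * (Y.length + X.length) = κ' + W' * (Y.length + X.length) := by omega
    have e4 : κ = κ' := by
      have := congrArg (· % (Y.length + X.length)) e3
      simpa [Nat.add_mul_mod_self_right, Nat.mod_eq_of_lt, h1, h1'] using this
    subst e4
    have e5 : W = W' := by
      have : W * (Y.length + X.length) = W' * (Y.length + X.length) := by omega
      exact Nat.eq_of_mul_eq_mul_right (by omega) this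
    subst e5
    -- Between two consecutive gates the sweep passes the vertical line once, so there is one gate
    -- more than there are spiral crossings.
    have e6 : (g :: gs).length = spiralCrossings X.length Y.length h j + 1 := by
      have : wallIndex (halfEdgeWall Y.length h) = if Y.length ≤ (h : ℕ) then 1 else 0 := by
        simp only [halfEdgeWall]
        split_ifs <;> first | rfl | omega
      rw [this] at h3
      omega
    have e7 : rotate h j = ⟨κ, h1⟩ := by
      apply Fin.ext
      simp only [rotate, h2']
      simp [Nat.add_mul_mod_self_right, Nat.mod_eq_of_lt, h1]
    rw [e1, h4, e6, Gen.degree, e7, L.sidePot_halfEdge hk h, L.sidePot_halfEdge hk ⟨κ, h1⟩]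
    push_cast
    ring

theorem piece_deg (L : Layout D) {k : ℕ} {g : Gate} {c : List (Corner D)}
    {rest : List (Gate × List (Corner D))} (h : Piece D k ((g, c) :: rest)) :
    cornerDeg c + (rest.map fun gc => L.gateDeg k gc.1 + cornerDeg gc.2).sum =
      - 2 - L.gateDeg k g := by
  obtain ⟨bd, h1, h2⟩ := h
  have := L.basePiece_deg h1
  rw [(h2.perm.map _).sum_eq, List.map_cons, List.sum_cons] at this
  linear_combination this

theorem half_deg (L : Layout D) {w : Wall} {s t b : ℕ} (x : Half D w s t b) :
    cornerDeg x.word = L.halfDeg w s t b := by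
  have key : ∀ {k : ℕ} {g : Gate} {c : List (Corner D)} {rest : List (Gate × List (Corner D))}
      (_ : Piece D k ((g, c) :: rest)) (child : Behind D k rest)
      (_ : ∀ i, cornerDeg (child i).word = L.gateDeg k (rest.get i).1),
      cornerDeg (c ++ (List.ofFn fun i => (child i).word ++ (rest.get i).2).flatten) =
        -2 - L.gateDeg k g := by
    intro k g c rest h child ih
    rw [← L.piece_deg h, cornerDeg_append]
    congr 1
    simp only [cornerDeg, List.map_flatten, List.sum_flatten, List.map_ofFn, Function.comp_def,
      List.map_append, List.sum_append] at ih ⊢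
    simp only [ih]
    rw [← List.ofFn_getElem_eq_map]
    simp
  induction x with
  | leftOf k t b c rest h child ih =>
    rw [Half.word, key h child ih]
    simp only [gateDeg, halfDeg, Gate.slice]
    ring
  | rightOf k t b c rest h child ih =>
    rw [Half.word, key h child ih]
    simp only [gateDeg, halfDeg, Gate.slice]
    ring

/-- The strands at the positive corner have potentials `x` and `y`, so `half_deg` gives every word
the degree `x - y - 1`: the degree condition is automatic. -/
theorem moduli_eq_univ (L : Layout D) {k : ℕ} {A B : List (ZMod N)} {x y : ZMod N}
    (hk : D[k]? = some ⟨A, .crossing x y, B⟩) : moduli D k A.length (x - y) = Set.univ := by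
  refine Set.eq_univ_of_forall fun f => ?_
  change x - y - cornerDeg f.word = 1
  rcases f with f | f
  · change x - y - cornerDeg f.word = 1
    rw [L.half_deg, halfDeg, (L.potAt_crossing hk).1, (L.potAt_crossing hk).2.1]
    ring
  · change x - y - cornerDeg f.word = 1
    rw [L.half_deg, halfDeg, (L.potAt_crossing hk).2.2.1, (L.potAt_crossing hk).2.2.2]
    ring

end Layout

/-! ### Weighted sums over halves -/

/-- The value of a signed word under an assignment of integers to the generators. -/
def wt (φ : Gen D → ℤ) (c : List (Corner D)) : ℤ := (c.map fun c => c.sign * φ c.gen).prod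

@[simp] theorem wt_nil (φ : Gen D → ℤ) : wt φ [] = 1 := rfl

@[simp] theorem wt_singleton (φ : Gen D → ℤ) (g : Gen D) (s : ℤ) :
    wt φ [⟨g, s⟩] = s * φ g := by simp [wt]

theorem wt_append (φ : Gen D → ℤ) (c c' : List (Corner D)) :
    wt φ (c ++ c') = wt φ c * wt φ c' := by simp [wt]

/-- The sum of the values of the words of all halves at a gate. -/
noncomputable def halfSum (φ : Gen D → ℤ) (w : Wall) (s t b : ℕ) : ℤ :=
  ∑ᶠ x : Half D w s t b, wt φ x.word

/-- The sum over all parts of polygons behind a gate of a piece over slab `k`. -/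
noncomputable def gateSum (φ : Gen D → ℤ) (k : ℕ) (g : Gate) : ℤ :=
  halfSum φ g.wall (g.slice k) g.top g.bottom

/-- The contribution of the boundary of a piece beyond its first gate. -/
noncomputable def restSum (φ : Gen D → ℤ) (k : ℕ) (rest : List (Gate × List (Corner D))) : ℤ :=
  (rest.map fun gc => gateSum φ k gc.1 * wt φ gc.2).prod

@[simp] theorem restSum_nil (φ : Gen D → ℤ) (k : ℕ) : restSum φ k [] = 1 := rfl

@[simp] theorem restSum_cons (φ : Gen D → ℤ) (k : ℕ) (gc : Gate × List (Corner D))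
    (rest : List (Gate × List (Corner D))) :
    restSum φ k (gc :: rest) = gateSum φ k gc.1 * wt φ gc.2 * restSum φ k rest := by
  simp [restSum]

theorem halfSum_eq_zero (φ : Gen D → ℤ) {w : Wall} {s t b : ℕ} (h : Half D w s t b → False) :
    halfSum φ w s t b = 0 := by
  have : IsEmpty (Half D w s t b) := ⟨h⟩
  exact finsum_of_isEmpty _

theorem halfSum_of_le (φ : Gen D → ℤ) {w : Wall} {s t b : ℕ} (h : b ≤ t) :
    halfSum φ w s t b = 0 :=
  halfSum_eq_zero φ fun x => absurd x.top_lt_bottom (by omega)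

theorem Layout.halfSum_left_eq_zero (L : Layout D) (φ : Gen D → ℤ) {s t b : ℕ}
    (hs : s ≤ D.length) (h : ¬ L.ord s t < L.ord s b) : halfSum φ .left s t b = 0 :=
  halfSum_eq_zero φ fun x => h (L.ord_lt_of_left x hs)

theorem Layout.halfSum_right_eq_zero (L : Layout D) (φ : Gen D → ℤ) {s t b : ℕ}
    (h : L.ord s t < L.ord s b) : halfSum φ .right s t b = 0 :=
  halfSum_eq_zero φ fun x => L.not_ord_lt_of_right x h

theorem Layout.restSum_eq_zero (φ : Gen D → ℤ) {k : ℕ}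
    {rest : List (Gate × List (Corner D))} (h : IsEmpty (Behind D k rest)) :
    restSum φ k rest = 0 := by
  obtain ⟨i, hi⟩ := isEmpty_pi.1 h
  rw [restSum, List.prod_eq_zero_iff, List.mem_map]
  refine ⟨_, List.get_mem rest i, ?_⟩
  rw [gateSum, halfSum_eq_zero φ hi.false, zero_mul]

/-- Words of trees. -/
def treeWord {k : ℕ} {g : Gate} (x : Σ κ : PieceAt D k g, Behind D k κ.1.2) : List (Corner D) :=
  x.1.1.1 ++ (List.ofFn fun i => (x.2 i).word ++ (x.1.1.2.get i).2).flatten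

/-- Distributivity: the parts behind the gates of a root piece are chosen independently, and the
weight is multiplicative and commutative. -/
theorem Layout.sum_trees (L : Layout D) (φ : Gen D → ℤ) (k : ℕ) (g : Gate)
    (hfin : Finite (Σ κ : PieceAt D k g, Behind D k κ.1.2)) :
    ∑ᶠ x : Σ κ : PieceAt D k g, Behind D k κ.1.2, wt φ (treeWord x) =
      ∑ᶠ κ : PieceAt D k g, wt φ κ.1.1 * restSum φ k κ.1.2 := by
  classical
  have := L.finite_half
  -- Pieces with an unfillable gate carry no tree, and their term on the right vanishes as well.
  -- Restricting to the others makes the index set finite, which `PieceAt D k g` need not be.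
  let K := {κ : PieceAt D k g | Nonempty (Behind D k κ.1.2)}
  let e : (Σ κ : PieceAt D k g, Behind D k κ.1.2) ≃ Σ κ : K, Behind D k κ.1.1.2 :=
    { toFun := fun x => ⟨⟨x.1, ⟨x.2⟩⟩, x.2⟩
      invFun := fun x => ⟨x.1.1, x.2⟩
      left_inv := fun _ => rfl
      right_inv := fun _ => rfl }
  have hK : Finite K := Finite.of_injective
    (fun κ : K => (⟨κ.1, κ.2.some⟩ : Σ κ : PieceAt D k g, Behind D k κ.1.2))
    (fun a b h => by
      have := congrArg Sigma.fst h
      exact Subtype.ext this)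
  have hB : ∀ κ : K, Finite (Behind D k κ.1.1.2) := fun κ => Pi.finite
  cases nonempty_fintype K
  have := fun κ : K => Fintype.ofFinite (Behind D k κ.1.1.2)
  have h1 : ∑ᶠ κ : PieceAt D k g, wt φ κ.1.1 * restSum φ k κ.1.2 =
      ∑ κ : K, wt φ κ.1.1.1 * restSum φ k κ.1.1.2 := by
    rw [← finsum_eq_sum_of_fintype,
      finsum_set_coe_eq_finsum_mem (s := K) (f := fun κ => wt φ κ.1.1 * restSum φ k κ.1.2)]
    refine finsum_congr fun κ => ?_
    by_cases h : κ ∈ K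
    · simp [h]
    · have h' : IsEmpty (Behind D k κ.1.2) := not_nonempty_iff.1 h
      simp [h, Layout.restSum_eq_zero φ h']
  rw [h1, ← finsum_comp_equiv e.symm, finsum_eq_sum_of_fintype, Fintype.sum_sigma]
  refine Finset.sum_congr rfl fun κ _ => ?_
  obtain ⟨⟨⟨c, rest⟩, hp⟩, hκ⟩ := κ
  have e1 : ∀ x : Behind D k rest, wt φ (treeWord (e.symm ⟨⟨⟨⟨c, rest⟩, hp⟩, hκ⟩, x⟩)) =
      wt φ c * ∏ i, wt φ (x i).word * wt φ (rest.get i).2 := by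
    intro x
    change wt φ (c ++ (List.ofFn fun i => (x i).word ++ (rest.get i).2).flatten) = _
    rw [wt_append]
    congr 1
    rw [wt, List.map_flatten, List.prod_flatten, List.map_ofFn, List.map_ofFn, List.prod_ofFn]
    refine Finset.prod_congr rfl fun i _ => ?_
    exact wt_append φ _ _
  simp only [e1]
  rw [← Finset.mul_sum]
  congr 1
  have e2 : restSum φ k rest = ∏ i, gateSum φ k (rest.get i).1 * wt φ (rest.get i).2 := by
    rw [restSum, ← List.prod_ofFn, ← List.ofFn_getElem_eq_map]
    rfl
  have := fun i : Fin rest.length => Fintype.ofFinite (Half D (rest.get i).1.wall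
    ((rest.get i).1.slice k) (rest.get i).1.top (rest.get i).1.bottom)
  rw [e2]
  simp only [gateSum, halfSum, finsum_eq_sum_of_fintype, Finset.sum_mul]
  rw [Finset.prod_univ_sum, Fintype.piFinset_univ]
  convert rfl

theorem Layout.halfSum_left (L : Layout D) (φ : Gen D → ℤ) (k t b : ℕ) :
    halfSum φ .left (k + 1) t b =
      ∑ᶠ κ : PieceAt D k ⟨.right, t, b⟩, wt φ κ.1.1 * restSum φ k κ.1.2 := by
  have := L.finite_half .left (k + 1) t b
  rw [← L.sum_trees φ k ⟨.right, t, b⟩ (Finite.of_equiv _ (leftEquiv D k t b)), halfSum,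
    ← finsum_comp_equiv (leftEquiv D k t b)]
  refine finsum_congr fun x => ?_
  cases x
  rfl

theorem Layout.halfSum_right (L : Layout D) (φ : Gen D → ℤ) (k t b : ℕ) :
    halfSum φ .right k t b =
      ∑ᶠ κ : PieceAt D k ⟨.left, t, b⟩, wt φ κ.1.1 * restSum φ k κ.1.2 := by
  have := L.finite_half .right k t b
  rw [← L.sum_trees φ k ⟨.left, t, b⟩ (Finite.of_equiv _ (rightEquiv D k t b)), halfSum,
    ← finsum_comp_equiv (rightEquiv D k t b)]
  refine finsum_congr fun x => ?_
  cases x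
  rfl

/-- The list `F` only has to exhaust the pieces whose remaining gates all bound some half; this is
what allows finite recursion formulas at vertices. -/
theorem sum_pieces (φ : Gen D → ℤ) (k : ℕ) (g : Gate) {ι : Type*} [Fintype ι]
    (F : ι → List (Corner D) × List (Gate × List (Corner D))) (hF : Function.Injective F)
    (hp : ∀ i, Piece D k ((g, (F i).1) :: (F i).2))
    (hc : ∀ c rest, Piece D k ((g, c) :: rest) → Behind D k rest → ∃ i, F i = (c, rest)) :
    ∑ᶠ κ : PieceAt D k g, wt φ κ.1.1 * restSum φ k κ.1.2 =
      ∑ i, wt φ (F i).1 * restSum φ k (F i).2 := by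
  classical
  let G : ι → PieceAt D k g := fun i => ⟨F i, hp i⟩
  have hG : Function.Injective G := fun i j h => hF (congrArg Subtype.val h)
  rw [← finsum_eq_sum_of_fintype, ← finsum_mem_range (g := G)
    (f := fun κ : PieceAt D k g => wt φ κ.1.1 * restSum φ k κ.1.2) hG]
  refine finsum_congr fun κ => ?_
  by_cases h : κ ∈ Set.range G
  · simp [h]
  · have h' : IsEmpty (Behind D k κ.1.2) := ⟨fun x => by
      obtain ⟨i, hi⟩ := hc _ _ κ.2 x
      exact h ⟨i, Subtype.ext hi⟩⟩
    simp [h, Layout.restSum_eq_zero φ h']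

theorem Layout.halfSum_left_eq_sum (L : Layout D) (φ : Gen D → ℤ) (k t b : ℕ) {ι : Type*}
    [Fintype ι] (F : ι → List (Corner D) × List (Gate × List (Corner D)))
    (hF : Function.Injective F)
    (hp : ∀ i, Piece D k ((⟨.right, t, b⟩, (F i).1) :: (F i).2))
    (hc : ∀ c rest, Piece D k ((⟨.right, t, b⟩, c) :: rest) → Behind D k rest →
      ∃ i, F i = (c, rest)) :
    halfSum φ .left (k + 1) t b = ∑ i, wt φ (F i).1 * restSum φ k (F i).2 := by
  rw [L.halfSum_left, sum_pieces φ k _ F hF hp hc]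

theorem Layout.halfSum_right_eq_sum (L : Layout D) (φ : Gen D → ℤ) (k t b : ℕ) {ι : Type*}
    [Fintype ι] (F : ι → List (Corner D) × List (Gate × List (Corner D)))
    (hF : Function.Injective F)
    (hp : ∀ i, Piece D k ((⟨.left, t, b⟩, (F i).1) :: (F i).2))
    (hc : ∀ c rest, Piece D k ((⟨.left, t, b⟩, c) :: rest) → Behind D k rest →
      ∃ i, F i = (c, rest)) :
    halfSum φ .right k t b = ∑ i, wt φ (F i).1 * restSum φ k (F i).2 := by
  rw [L.halfSum_right, sum_pieces φ k _ F hF hp hc]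

/-! ### Recursion formulas: crossings, rounded ends -/

theorem isRotated_single_cons {α : Type*} {a g : α} {r : List α} :
    [a].IsRotated (g :: r) ↔ g = a ∧ r = [] := by
  rw [List.isRotated_singleton_iff', List.cons.injEq]
  tauto

theorem isRotated_pair_cons {α : Type*} {a b g : α} {r : List α} :
    [a, b].IsRotated (g :: r) ↔ (g = a ∧ r = [b]) ∨ (g = b ∧ r = [a]) := by
  rw [isRotated_cons_iff]
  constructor
  · rintro ⟨l₁, l₂, h, rfl⟩
    rcases l₁ with _ | ⟨_, _ | ⟨_, l⟩⟩
    · simp_all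
    · simp_all
    · have := congrArg List.length h
      simp at this
  · rintro (⟨rfl, rfl⟩ | ⟨rfl, rfl⟩)
    · exact ⟨[], [b], rfl, rfl⟩
    · exact ⟨[a], [], rfl, rfl⟩

theorem isRotated_triple_cons {α : Type*} {a b c g : α} {r : List α} :
    [a, b, c].IsRotated (g :: r) ↔
      (g = a ∧ r = [b, c]) ∨ (g = b ∧ r = [c, a]) ∨ (g = c ∧ r = [a, b]) := by
  rw [isRotated_cons_iff]
  constructor
  · rintro ⟨l₁, l₂, h, rfl⟩
    rcases l₁ with _ | ⟨_, _ | ⟨_, _ | ⟨_, l⟩⟩⟩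
    · simp_all
    · simp only [List.cons_append, List.nil_append, List.cons.injEq] at h
      obtain ⟨rfl, rfl, rfl⟩ := h
      simp
    · simp_all
    · have := congrArg List.length h
      simp at this
  · rintro (⟨rfl, rfl⟩ | ⟨rfl, rfl⟩ | ⟨rfl, rfl⟩)
    · exact ⟨[], [b, c], rfl, rfl⟩
    · exact ⟨[a], [c], rfl, rfl⟩
    · exact ⟨[a, b], [], rfl, rfl⟩

theorem piece_strip_right {k tl tr bl br : ℕ} {ct cb : List (Corner D)}
    (ht : UpperArc D k tl tr ct) (hb : LowerArc D k bl br cb) (hl : tl < bl) (hr : tr < br) :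
    Piece D k [(⟨.right, tr, br⟩, ct), (⟨.left, tl, bl⟩, cb)] :=
  ⟨_, .strip tl tr bl br ct cb ht hb hl hr, isRotated_pair_cons.2 (.inr ⟨rfl, rfl⟩)⟩

theorem piece_strip_left {k tl tr bl br : ℕ} {ct cb : List (Corner D)}
    (ht : UpperArc D k tl tr ct) (hb : LowerArc D k bl br cb) (hl : tl < bl) (hr : tr < br) :
    Piece D k [(⟨.left, tl, bl⟩, cb), (⟨.right, tr, br⟩, ct)] :=
  ⟨_, .strip tl tr bl br ct cb ht hb hl hr, List.IsRotated.refl _⟩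

theorem swapAt_swapAt (p t : ℕ) : swapAt p (swapAt p t) = t := by
  unfold swapAt; split_ifs <;> omega

/-! ### Counts of halves on the two sides of a crossing. -/

section Crossing

variable {k : ℕ} {A B : List (ZMod N)} {x y : ZMod N}

theorem upperArc_swapAt (hk : D[k]? = some ⟨A, .crossing x y, B⟩) {t : ℕ}
    (ht : t < A.length + 2 + B.length) : UpperArc D k (swapAt A.length t) t [] := by
  unfold swapAt
  split_ifs with h1 h2
  · subst h1; exact .under A x y B hk
  · subst h2; exact .over A x y B hk
  · rcases Nat.lt_or_ge t A.length with h | h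
    · exact .pass _ hk _ _ (.above t h)
    · obtain ⟨m, rfl⟩ := Nat.exists_eq_add_of_le (show A.length + 2 ≤ t by omega)
      exact .pass _ hk _ _ (.below m (by simp only; omega))

theorem lowerArc_swapAt (hk : D[k]? = some ⟨A, .crossing x y, B⟩) {t : ℕ}
    (ht : t < A.length + 2 + B.length) : LowerArc D k (swapAt A.length t) t [] := by
  unfold swapAt
  split_ifs with h1 h2
  · subst h1; exact .under A x y B hk
  · subst h2; exact .over A x y B hk
  · rcases Nat.lt_or_ge t A.length with h | h
    · exact .pass _ hk _ _ (.above t h)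
    · obtain ⟨m, rfl⟩ := Nat.exists_eq_add_of_le (show A.length + 2 ≤ t by omega)
      exact .pass _ hk _ _ (.below m (by simp only; omega))

theorem upperArc_cases (hk : D[k]? = some ⟨A, .crossing x y, B⟩) {l r : ℕ} {c : List (Corner D)}
    (h : UpperArc D k l r c) : (c = [] ∧ l = swapAt A.length r ∧ r = swapAt A.length l) ∨
      (l = A.length + 1 ∧ r = A.length + 1 ∧
        c = [⟨.crossing k A x y B hk, koszul (x - y - 1)⟩]) := by
  unfold swapAt
  rcases upperArc_crossing hk h with ⟨rfl, rfl, h⟩ | ⟨rfl, rfl, rfl⟩ | ⟨rfl, rfl, rfl⟩ | h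
  · refine .inl ⟨rfl, ?_, ?_⟩ <;> split_ifs <;> omega
  · refine .inl ⟨rfl, ?_, ?_⟩ <;> split_ifs <;> omega
  · refine .inl ⟨rfl, ?_, ?_⟩ <;> split_ifs <;> omega
  · exact .inr h

theorem lowerArc_cases (hk : D[k]? = some ⟨A, .crossing x y, B⟩) {l r : ℕ} {c : List (Corner D)}
    (h : LowerArc D k l r c) : (c = [] ∧ l = swapAt A.length r ∧ r = swapAt A.length l) ∨
      (l = A.length ∧ r = A.length ∧ c = [⟨.crossing k A x y B hk, 1⟩]) := by
  unfold swapAt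
  rcases lowerArc_crossing hk h with ⟨rfl, rfl, h⟩ | ⟨rfl, rfl, rfl⟩ | ⟨rfl, rfl, rfl⟩ | h
  · refine .inl ⟨rfl, ?_, ?_⟩ <;> split_ifs <;> omega
  · refine .inl ⟨rfl, ?_, ?_⟩ <;> split_ifs <;> omega
  · refine .inl ⟨rfl, ?_, ?_⟩ <;> split_ifs <;> omega
  · exact .inr h

theorem piece_crossing (hk : D[k]? = some ⟨A, .crossing x y, B⟩) {g : Gate} {c : List (Corner D)}
    {rest : List (Gate × List (Corner D))} (h : Piece D k ((g, c) :: rest)) :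
    ∃ tl tr bl br ct cb, UpperArc D k tl tr ct ∧ LowerArc D k bl br cb ∧ tl < bl ∧ tr < br ∧
      ((g = ⟨.left, tl, bl⟩ ∧ c = cb ∧ rest = [(⟨.right, tr, br⟩, ct)]) ∨
        (g = ⟨.right, tr, br⟩ ∧ c = ct ∧ rest = [(⟨.left, tl, bl⟩, cb)])) := by
  obtain ⟨bd, h1, h2⟩ := h
  cases h1 with
  | strip tl tr bl br ct cb ht hb hl hr =>
    refine ⟨tl, tr, bl, br, ct, cb, ht, hb, hl, hr, ?_⟩
    simpa only [isRotated_pair_cons, Prod.mk.injEq, and_assoc] using h2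
  | cupInner _ _ _ hk' => cases slab_inj hk hk'
  | cupOuter _ _ _ hk' => cases slab_inj hk hk'
  | capInner _ _ _ hk' => cases slab_inj hk hk'
  | capOuter _ _ _ hk' => cases slab_inj hk hk'
  | fan _ _ _ _ hk' => cases slab_inj hk hk'

theorem swapAt_lt {p t b : ℕ} (htb : t < b) (h : ¬ (t = p ∧ b = p + 1)) :
    swapAt p t < swapAt p b := by
  unfold swapAt; split_ifs <;> omega

/-- The strip next to the gate goes straight along both arcs or has one negative corner: at the
bottom quadrant if its upper arc ends at `A.length + 1`, at the top quadrant if its lower arc ends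
at `A.length`. As `t < b`, these two cases exclude each other. -/
theorem Layout.left_crossing (L : Layout D) (φ : Gen D → ℤ)
    (hk : D[k]? = some ⟨A, .crossing x y, B⟩) {t b : ℕ} (htb : t < b)
    (hb : b < A.length + 2 + B.length) (hne : ¬ (t = A.length ∧ b = A.length + 1)) :
    halfSum φ .left (k + 1) t b =
      halfSum φ .left k (swapAt A.length t) (swapAt A.length b) +
      (if t = A.length + 1 then koszul (x - y - 1) * φ (.crossing k A x y B hk) *
        halfSum φ .left k (A.length + 1) (swapAt A.length b) else 0) +
      (if b = A.length then φ (.crossing k A x y B hk) *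
        halfSum φ .left k (swapAt A.length t) A.length else 0) := by
  have hsw := swapAt_lt htb hne
  have harc := upperArc_swapAt hk (htb.trans hb)
  have harc' := lowerArc_swapAt hk hb
  by_cases ht1 : t = A.length + 1
  · have hb1 : b ≠ A.length := by omega
    rw [if_pos ht1, if_neg hb1]
    have hsb : swapAt A.length b = b := by unfold swapAt; split_ifs <;> omega
    rw [L.halfSum_left_eq_sum φ k t b (ι := Bool) (fun i => bif i
        then ([⟨.crossing k A x y B hk, koszul (x - y - 1)⟩],
          [(⟨.left, A.length + 1, swapAt A.length b⟩, [])])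
        else ([], [(⟨.left, swapAt A.length t, swapAt A.length b⟩, [])]))]
    · simp [gateSum, Gate.slice]; ring
    · intro i j h; cases i <;> cases j <;> simp_all
    · intro i
      cases i
      · exact piece_strip_right harc harc' hsw htb
      · subst ht1
        exact piece_strip_right (.corner A x y B hk) harc' (by omega) htb
    · intro c rest hp _
      obtain ⟨tl, tr, bl, br, ct, cb, h1, h2, h3, h4, (⟨h5, -, -⟩ | ⟨h5, rfl, rfl⟩)⟩ :=
        piece_crossing hk hp
      · cases h5
      obtain ⟨-, rfl, rfl⟩ := Gate.mk.inj h5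
      rcases lowerArc_cases hk h2 with ⟨rfl, rfl, -⟩ | ⟨rfl, rfl, rfl⟩
      · rcases upperArc_cases hk h1 with ⟨rfl, rfl, -⟩ | ⟨rfl, rfl, rfl⟩
        · exact ⟨false, rfl⟩
        · exact ⟨true, rfl⟩
      · omega
  · rw [if_neg ht1]
    by_cases hb1 : b = A.length
    · rw [if_pos hb1]
      rw [L.halfSum_left_eq_sum φ k t b (ι := Bool) (fun i => bif i
        then ([], [(⟨.left, swapAt A.length t, A.length⟩, [⟨.crossing k A x y B hk, 1⟩])])
        else ([], [(⟨.left, swapAt A.length t, swapAt A.length b⟩, [])]))]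
      · simp [gateSum, Gate.slice]; ring
      · intro i j h; cases i <;> cases j <;> simp_all
      · intro i
        cases i
        · exact piece_strip_right harc harc' hsw htb
        · subst hb1
          exact piece_strip_right harc (.corner A x y B hk)
            (by unfold swapAt; split_ifs <;> omega) htb
      · intro c rest hp _
        obtain ⟨tl, tr, bl, br, ct, cb, h1, h2, h3, h4, (⟨h5, -, -⟩ | ⟨h5, rfl, rfl⟩)⟩ :=
          piece_crossing hk hp
        · cases h5
        obtain ⟨-, rfl, rfl⟩ := Gate.mk.inj h5
        rcases upperArc_cases hk h1 with ⟨rfl, rfl, -⟩ | ⟨rfl, rfl, rfl⟩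
        · rcases lowerArc_cases hk h2 with ⟨rfl, rfl, -⟩ | ⟨rfl, rfl, rfl⟩
          · exact ⟨false, rfl⟩
          · exact ⟨true, rfl⟩
        · omega
    · rw [if_neg hb1]
      rw [L.halfSum_left_eq_sum φ k t b (ι := Unit) (fun _ =>
        ([], [(⟨.left, swapAt A.length t, swapAt A.length b⟩, [])]))]
      · simp [gateSum, Gate.slice]
      · intro i j h; rfl
      · intro i; exact piece_strip_right harc harc' hsw htb
      · intro c rest hp _
        obtain ⟨tl, tr, bl, br, ct, cb, h1, h2, h3, h4, (⟨h5, -, -⟩ | ⟨h5, rfl, rfl⟩)⟩ :=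
          piece_crossing hk hp
        · cases h5
        obtain ⟨-, rfl, rfl⟩ := Gate.mk.inj h5
        rcases upperArc_cases hk h1 with ⟨rfl, rfl, -⟩ | ⟨rfl, rfl, rfl⟩
        · rcases lowerArc_cases hk h2 with ⟨rfl, rfl, -⟩ | ⟨rfl, rfl, rfl⟩
          · exact ⟨(), rfl⟩
          · omega
        · omega

/-- An upper arc that ends at `A.length` comes from `A.length + 1`, and a lower arc that ends at
`A.length + 1` comes from `A.length`. They would bound a strip with its sides in the wrong order. -/
theorem Layout.left_crossing_self (L : Layout D) (φ : Gen D → ℤ)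
    (hk : D[k]? = some ⟨A, .crossing x y, B⟩) :
    halfSum φ .left (k + 1) A.length (A.length + 1) = 0 := by
  rw [L.halfSum_left_eq_sum φ k _ _ (ι := Empty) (fun i => i.elim) (fun i => i.elim)
    (fun i => i.elim)]
  · simp
  · intro c rest hp _
    obtain ⟨tl, tr, bl, br, ct, cb, h1, h2, h3, h4, (⟨h5, -, -⟩ | ⟨h5, rfl, rfl⟩)⟩ :=
      piece_crossing hk hp
    · cases h5
    obtain ⟨-, rfl, rfl⟩ := Gate.mk.inj h5
    have h1 := upperArc_crossing hk h1
    have h2 := lowerArc_crossing hk h2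
    omega

theorem Layout.right_crossing (L : Layout D) (φ : Gen D → ℤ)
    (hk : D[k]? = some ⟨A, .crossing x y, B⟩) {t b : ℕ} (htb : t < b)
    (hb : b < A.length + 2 + B.length) (hne : ¬ (t = A.length ∧ b = A.length + 1)) :
    halfSum φ .right k t b =
      halfSum φ .right (k + 1) (swapAt A.length t) (swapAt A.length b) +
      (if t = A.length + 1 then koszul (x - y - 1) * φ (.crossing k A x y B hk) *
        halfSum φ .right (k + 1) (A.length + 1) (swapAt A.length b) else 0) +
      (if b = A.length then φ (.crossing k A x y B hk) *
        halfSum φ .right (k + 1) (swapAt A.length t) A.length else 0) := by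
  have hsw := swapAt_lt htb hne
  have hlt : ∀ {t}, t < A.length + 2 + B.length → swapAt A.length t < A.length + 2 + B.length := by
    intro t ht; unfold swapAt; split_ifs <;> omega
  have harc := upperArc_swapAt hk (hlt (htb.trans hb))
  have harc' := lowerArc_swapAt hk (hlt hb)
  rw [swapAt_swapAt] at harc harc'
  by_cases ht1 : t = A.length + 1
  · have hb1 : b ≠ A.length := by omega
    rw [if_pos ht1, if_neg hb1]
    have hsb : swapAt A.length b = b := by unfold swapAt; split_ifs <;> omega
    rw [L.halfSum_right_eq_sum φ k t b (ι := Bool) (fun i => bif i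
        then ([], [(⟨.right, A.length + 1, swapAt A.length b⟩,
          [⟨.crossing k A x y B hk, koszul (x - y - 1)⟩])])
        else ([], [(⟨.right, swapAt A.length t, swapAt A.length b⟩, [])]))]
    · simp [gateSum, Gate.slice]; ring
    · intro i j h; cases i <;> cases j <;> simp_all
    · intro i
      cases i
      · exact piece_strip_left harc harc' htb hsw
      · subst ht1
        exact piece_strip_left (.corner A x y B hk) harc' htb (by omega)
    · intro c rest hp _
      obtain ⟨tl, tr, bl, br, ct, cb, h1, h2, h3, h4, (⟨h5, rfl, rfl⟩ | ⟨h5, -, -⟩)⟩ :=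
        piece_crossing hk hp
      swap
      · cases h5
      obtain ⟨-, rfl, rfl⟩ := Gate.mk.inj h5
      rcases lowerArc_cases hk h2 with ⟨rfl, -, rfl⟩ | ⟨rfl, rfl, rfl⟩
      · rcases upperArc_cases hk h1 with ⟨rfl, -, rfl⟩ | ⟨rfl, rfl, rfl⟩
        · exact ⟨false, rfl⟩
        · exact ⟨true, rfl⟩
      · omega
  · rw [if_neg ht1]
    by_cases hb1 : b = A.length
    · rw [if_pos hb1]
      rw [L.halfSum_right_eq_sum φ k t b (ι := Bool) (fun i => bif i
        then ([⟨.crossing k A x y B hk, 1⟩], [(⟨.right, swapAt A.length t, A.length⟩, [])])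
        else ([], [(⟨.right, swapAt A.length t, swapAt A.length b⟩, [])]))]
      · simp [gateSum, Gate.slice]; ring
      · intro i j h; cases i <;> cases j <;> simp_all
      · intro i
        cases i
        · exact piece_strip_left harc harc' htb hsw
        · subst hb1
          exact piece_strip_left harc (.corner A x y B hk) htb
            (by unfold swapAt; split_ifs <;> omega)
      · intro c rest hp _
        obtain ⟨tl, tr, bl, br, ct, cb, h1, h2, h3, h4, (⟨h5, rfl, rfl⟩ | ⟨h5, -, -⟩)⟩ :=
          piece_crossing hk hp
        swap
        · cases h5
        obtain ⟨-, rfl, rfl⟩ := Gate.mk.inj h5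
        rcases upperArc_cases hk h1 with ⟨rfl, -, rfl⟩ | ⟨rfl, rfl, rfl⟩
        · rcases lowerArc_cases hk h2 with ⟨rfl, -, rfl⟩ | ⟨rfl, rfl, rfl⟩
          · exact ⟨false, rfl⟩
          · exact ⟨true, rfl⟩
        · omega
    · rw [if_neg hb1]
      rw [L.halfSum_right_eq_sum φ k t b (ι := Unit) (fun _ =>
        ([], [(⟨.right, swapAt A.length t, swapAt A.length b⟩, [])]))]
      · simp [gateSum, Gate.slice]
      · intro i j h; rfl
      · intro i; exact piece_strip_left harc harc' htb hsw
      · intro c rest hp _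
        obtain ⟨tl, tr, bl, br, ct, cb, h1, h2, h3, h4, (⟨h5, rfl, rfl⟩ | ⟨h5, -, -⟩)⟩ :=
          piece_crossing hk hp
        swap
        · cases h5
        obtain ⟨-, rfl, rfl⟩ := Gate.mk.inj h5
        rcases upperArc_cases hk h1 with ⟨rfl, -, rfl⟩ | ⟨rfl, rfl, rfl⟩
        · rcases lowerArc_cases hk h2 with ⟨rfl, -, rfl⟩ | ⟨rfl, rfl, rfl⟩
          · exact ⟨(), rfl⟩
          · omega
        · omega

theorem Layout.right_crossing_self (L : Layout D) (φ : Gen D → ℤ)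
    (hk : D[k]? = some ⟨A, .crossing x y, B⟩) :
    halfSum φ .right k A.length (A.length + 1) = 0 := by
  rw [L.halfSum_right_eq_sum φ k _ _ (ι := Empty) (fun i => i.elim) (fun i => i.elim)
    (fun i => i.elim)]
  · simp
  · intro c rest hp _
    obtain ⟨tl, tr, bl, br, ct, cb, h1, h2, h3, h4, (⟨h5, rfl, rfl⟩ | ⟨h5, -, -⟩)⟩ :=
      piece_crossing hk hp
    swap
    · cases h5
    obtain ⟨-, rfl, rfl⟩ := Gate.mk.inj h5
    have h1 := upperArc_crossing hk h1
    have h2 := lowerArc_crossing hk h2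
    omega

end Crossing

/-- If no strands are inverted on the right side of the slab, no right half starts there. The gates
behind which something can lie are therefore on the left, which removes all but finitely many shapes
at cusps and vertices. -/
theorem Layout.wall_eq_left (L : Layout D) {k : ℕ} (h : L.ord (k + 1) = id)
    {rest : List (Gate × List (Corner D))} (x : Behind D k rest) :
    ∀ gc ∈ rest, gc.1.wall = .left := by
  intro gc hgc
  obtain ⟨i, rfl⟩ := List.get_of_mem hgc
  have hx := x i
  generalize rest.get i = gc at hx ⊢
  obtain ⟨⟨w, t, b⟩, c⟩ := gc
  cases w with
  | left => rfl
  | right =>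
    have h1 := L.not_ord_lt_of_right hx
    have h2 := hx.top_lt_bottom
    simp only [Gate.slice, h] at h1 h2
    exact absurd h2 h1

theorem Passes.left_right_lt {e : LagSlab N} {l r l' r' : ℕ} (h : Passes e l r)
    (h' : Passes e l' r') (hr : r < r') : l < l' := by
  cases h <;> cases h' <;> omega

theorem Passes.left_unique {e : LagSlab N} {l r l' : ℕ} (h : Passes e l r)
    (h' : Passes e l' r) : l = l' := by
  cases h with
  | above q hq => cases h' with
    | above => rfl
    | below => omega
  | below m hm =>
    generalize hr : e.above.length + e.point.numOut + m = r at h'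
    cases h' <;> omega

/-! ### Counts of left halves after a rounded left end. -/

section Cup

variable {k : ℕ} {A B : List (ZMod N)} {x : ZMod N}

theorem Layout.piece_cup (L : Layout D) (hk : D[k]? = some ⟨A, .cup x, B⟩) {t b : ℕ}
    {c : List (Corner D)} {rest : List (Gate × List (Corner D))}
    (h : Piece D k ((⟨.right, t, b⟩, c) :: rest)) (hx : Behind D k rest) :
    (c = [] ∧ ∃ l l', Passes ⟨A, .cup x, B⟩ l t ∧ Passes ⟨A, .cup x, B⟩ l' b ∧
      rest = [(⟨.left, l, l'⟩, [])]) ∨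
    (t = A.length ∧ b = A.length + 1 ∧ c = [] ∧ rest = []) := by
  have hw := L.wall_eq_left (L.cup hk).2.2.2 hx
  obtain ⟨bd, h1, h2⟩ := h
  cases h1 with
  | strip tl tr bl br ct cb ht hb hl hr =>
    simp only [isRotated_pair_cons, Prod.mk.injEq, Gate.mk.injEq, reduceCtorEq, false_and,
      false_or, true_and, and_assoc] at h2
    obtain ⟨rfl, rfl, rfl, rfl⟩ := h2
    obtain ⟨rfl, ht'⟩ := upperArc_pass hk (by simp) ht
    obtain ⟨rfl, hb'⟩ := lowerArc_pass hk (by simp) hb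
    exact .inl ⟨rfl, tl, bl, ht', hb', rfl⟩
  | cupInner _ _ _ hk' =>
    cases slab_inj hk hk'
    simp only [isRotated_single_cons, Prod.mk.injEq, Gate.mk.injEq, true_and] at h2
    exact .inr ⟨h2.1.1.1, h2.1.1.2, h2.1.2, h2.2⟩
  | cupOuter A x B hk t m ht hm =>
    rw [isRotated_triple_cons] at h2
    rcases h2 with ⟨h2, -⟩ | ⟨-, rfl⟩ | ⟨-, rfl⟩
    · simp at h2
    · simp at hw
    · simp at hw
  | capInner _ _ _ hk' => cases slab_inj hk hk'
  | capOuter _ _ _ hk' => cases slab_inj hk hk'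
  | fan _ _ _ _ hk' => cases slab_inj hk hk'

theorem Layout.left_cup_pass (L : Layout D) (φ : Gen D → ℤ)
    (hk : D[k]? = some ⟨A, .cup x, B⟩) {l r l' r' : ℕ} (h : Passes ⟨A, .cup x, B⟩ l r)
    (h' : Passes ⟨A, .cup x, B⟩ l' r') (hr : r < r') :
    halfSum φ .left (k + 1) r r' = halfSum φ .left k l l' := by
  rw [L.halfSum_left_eq_sum φ k r r' (ι := Unit) (fun _ => ([], [(⟨.left, l, l'⟩, [])]))]
  · simp [gateSum, Gate.slice]
  · intro i j h; rfl
  · intro i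
    exact piece_strip_right (.pass _ hk _ _ h) (.pass _ hk _ _ h') (h.left_right_lt h' hr) hr
  · intro c rest hp hx
    rcases L.piece_cup hk hp hx with ⟨rfl, m, m', hm, hm', rfl⟩ | ⟨rfl, rfl, rfl, rfl⟩
    · obtain rfl := h.left_unique hm
      obtain rfl := h'.left_unique hm'
      exact ⟨(), rfl⟩
    · generalize hA : A.length = p at *
      cases h <;> simp only [LagPoint.numIn, LagPoint.numOut] at * <;> omega

theorem Layout.left_cup_self (L : Layout D) (φ : Gen D → ℤ)
    (hk : D[k]? = some ⟨A, .cup x, B⟩) :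
    halfSum φ .left (k + 1) A.length (A.length + 1) = 1 := by
  rw [L.halfSum_left_eq_sum φ k _ _ (ι := Unit) (fun _ => ([], []))]
  · simp
  · intro i j h; rfl
  · intro i
    exact ⟨_, .cupInner A x B hk, List.IsRotated.refl _⟩
  · intro c rest hp hx
    rcases L.piece_cup hk hp hx with ⟨rfl, m, m', hm, hm', rfl⟩ | ⟨-, -, rfl, rfl⟩
    · generalize hA : A.length = p at *
      cases hm <;> simp only [LagPoint.numIn, LagPoint.numOut] at * <;> omega
    · exact ⟨(), rfl⟩

/-- No strip has only one of its arcs on the new strands, and the outer piece at the end needs a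
further right gate, which nothing can fill. -/
theorem Layout.left_cup_mixed (L : Layout D) (φ : Gen D → ℤ)
    (hk : D[k]? = some ⟨A, .cup x, B⟩) {t b : ℕ}
    (h : (t < A.length ∧ A.length ≤ b ∧ b < A.length + 2) ∨
      (A.length ≤ t ∧ t < A.length + 2 ∧ A.length + 2 ≤ b)) :
    halfSum φ .left (k + 1) t b = 0 := by
  rw [L.halfSum_left_eq_sum φ k _ _ (ι := Empty) (fun i => i.elim) (fun i => i.elim)
    (fun i => i.elim)]
  · simp
  · intro c rest hp hx
    rcases L.piece_cup hk hp hx with ⟨rfl, m, m', hm, hm', rfl⟩ | ⟨rfl, rfl, rfl, rfl⟩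
    · cases hm <;> cases hm' <;> simp only [LagPoint.numIn, LagPoint.numOut] at * <;> omega
    · omega

end Cup

/-! ### Counts of halves at a rounded right end. -/

section Cap

variable {k : ℕ} {A B : List (ZMod N)} {x : ZMod N}

theorem Layout.piece_cap (hk : D[k]? = some ⟨A, .cap x, B⟩) {t b : ℕ}
    {c : List (Corner D)} {rest : List (Gate × List (Corner D))}
    (h : Piece D k ((⟨.right, t, b⟩, c) :: rest)) :
    (c = [] ∧ ∃ l l', Passes ⟨A, .cap x, B⟩ l t ∧ Passes ⟨A, .cap x, B⟩ l' b ∧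
      rest = [(⟨.left, l, l'⟩, [])]) ∨
    (t < A.length ∧ c = [] ∧ ∃ m < B.length, b = A.length + m ∧
      rest = [(⟨.left, t, A.length⟩, []), (⟨.left, A.length + 1, A.length + 2 + m⟩, [])]) := by
  obtain ⟨bd, h1, h2⟩ := h
  cases h1 with
  | strip tl tr bl br ct cb ht hb hl hr =>
    simp only [isRotated_pair_cons, Prod.mk.injEq, Gate.mk.injEq, reduceCtorEq, false_and,
      false_or, true_and, and_assoc] at h2
    obtain ⟨rfl, rfl, rfl, rfl⟩ := h2
    obtain ⟨rfl, ht'⟩ := upperArc_pass hk (by simp) ht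
    obtain ⟨rfl, hb'⟩ := lowerArc_pass hk (by simp) hb
    exact .inl ⟨rfl, tl, bl, ht', hb', rfl⟩
  | capInner _ _ _ hk' =>
    simp at h2
  | capOuter A x B hk' t m ht hm =>
    cases slab_inj hk hk'
    rw [isRotated_triple_cons] at h2
    simp only [Prod.mk.injEq, Gate.mk.injEq, reduceCtorEq, false_and, or_false, true_and] at h2
    obtain ⟨⟨⟨rfl, rfl⟩, rfl⟩, rfl⟩ := h2
    exact .inr ⟨ht, rfl, m, hm, rfl, rfl⟩
  | cupInner _ _ _ hk' => cases slab_inj hk hk'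
  | cupOuter _ _ _ hk' => cases slab_inj hk hk'
  | fan _ _ _ _ hk' => cases slab_inj hk hk'

theorem Layout.left_cap_same (L : Layout D) (φ : Gen D → ℤ)
    (hk : D[k]? = some ⟨A, .cap x, B⟩) {l r l' r' : ℕ} (h : Passes ⟨A, .cap x, B⟩ l r)
    (h' : Passes ⟨A, .cap x, B⟩ l' r') (hr : r < r') (hs : r' < A.length ∨ A.length ≤ r) :
    halfSum φ .left (k + 1) r r' = halfSum φ .left k l l' := by
  rw [L.halfSum_left_eq_sum φ k r r' (ι := Unit) (fun _ => ([], [(⟨.left, l, l'⟩, [])]))]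
  · simp [gateSum, Gate.slice]
  · intro i j h; rfl
  · intro i
    exact piece_strip_right (.pass _ hk _ _ h) (.pass _ hk _ _ h') (h.left_right_lt h' hr) hr
  · intro c rest hp hx
    rcases Layout.piece_cap hk hp with ⟨rfl, m, m', hm, hm', rfl⟩ | ⟨h1, rfl, m, hm, h2, rfl⟩
    · obtain rfl := h.left_unique hm
      obtain rfl := h'.left_unique hm'
      exact ⟨(), rfl⟩
    · omega

/-- The root is either a strip that passes over both ending strands, or it surrounds the rounded end
and has an independent part on each side of it; hence the product. This term is the correction
produced by cancelling the block of the two strands. -/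
theorem Layout.left_cap_mixed (L : Layout D) (φ : Gen D → ℤ)
    (hk : D[k]? = some ⟨A, .cap x, B⟩) {t m : ℕ} (ht : t < A.length) (hm : m < B.length) :
    halfSum φ .left (k + 1) t (A.length + m) = halfSum φ .left k t (A.length + 2 + m) +
      halfSum φ .left k t A.length *
        halfSum φ .left k (A.length + 1) (A.length + 2 + m) := by
  have h : Passes ⟨A, .cap x, B⟩ t t := .above t ht
  have h' : Passes ⟨A, .cap x, B⟩ (A.length + 2 + m) (A.length + m) := .below m hm
  rw [L.halfSum_left_eq_sum φ k _ _ (ι := Bool) (fun i => bif i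
    then ([], [(⟨.left, t, A.length + 2 + m⟩, [])])
    else ([], [(⟨.left, t, A.length⟩, []), (⟨.left, A.length + 1, A.length + 2 + m⟩, [])]))]
  · simp [gateSum, Gate.slice]
  · intro i j h; cases i <;> cases j <;> simp_all
  · intro i
    cases i
    · exact ⟨_, .capOuter A x B hk t m ht hm, List.IsRotated.refl _⟩
    · exact piece_strip_right (.pass _ hk _ _ h) (.pass _ hk _ _ h') (by omega) (by omega)
  · intro c rest hp hx
    rcases Layout.piece_cap hk hp with ⟨rfl, l, l', hl, hl', rfl⟩ | ⟨h1, rfl, m', hm', h2, rfl⟩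
    · obtain rfl := h.left_unique hl
      obtain rfl := h'.left_unique hl'
      exact ⟨true, rfl⟩
    · obtain rfl : m = m' := by omega
      exact ⟨false, rfl⟩

theorem Layout.right_cap_self (L : Layout D) (φ : Gen D → ℤ)
    (hk : D[k]? = some ⟨A, .cap x, B⟩) :
    halfSum φ .right k A.length (A.length + 1) = 1 := by
  rw [L.halfSum_right_eq_sum φ k _ _ (ι := Unit) (fun _ => ([], []))]
  · simp
  · intro i j h; rfl
  · intro i
    exact ⟨_, .capInner A x B hk, List.IsRotated.refl _⟩
  · intro c rest hp hx
    obtain ⟨bd, h1, h2⟩ := hp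
    cases h1 with
    | strip tl tr bl br ct cb ht hb hl hr =>
      simp only [isRotated_pair_cons, Prod.mk.injEq, Gate.mk.injEq, reduceCtorEq, false_and,
        or_false, true_and, and_assoc] at h2
      obtain ⟨rfl, rfl, rfl, rfl⟩ := h2
      obtain ⟨rfl, ht'⟩ := upperArc_pass hk (by simp) ht
      generalize hA : A.length = p at *
      cases ht' <;> simp only [LagPoint.numIn, LagPoint.numOut] at * <;> omega
    | capInner _ _ _ hk' =>
      simp only [isRotated_single_cons, Prod.mk.injEq] at h2
      exact ⟨(), by simp [h2]⟩
    | capOuter A x B hk' t m ht hm =>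
      cases slab_inj hk hk'
      rw [isRotated_triple_cons] at h2
      simp only [Prod.mk.injEq, Gate.mk.injEq, reduceCtorEq, false_and, false_or, true_and] at h2
      omega
    | cupInner _ _ _ hk' => cases slab_inj hk hk'
    | cupOuter _ _ _ hk' => cases slab_inj hk hk'
    | fan _ _ _ _ hk' => cases slab_inj hk hk'

end Cap

/-! ### Recursion formulas: vertices -/

/-- Whether a gate is on the right side of its slab. -/
def Gate.isRight (g : Gate) : Bool :=
  match g.wall with
  | .left => false
  | .right => true

/-- In the applications a fillable fan has no right gate except possibly the one from which it is
read. Such a sweep can turn past the vertical line only a few times, and this lemma and the next two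
list the possibilities. -/
theorem Sweep.of_countP_zero {p a b c x j : ℕ} {w : Wall} {gs : List Gate}
    (h : Sweep p a b c w x j gs) (hc : gs.countP Gate.isRight = 0) :
    w = .left ∧ ∃ y, p ≤ y ∧ y < p + a ∧ y < x ∧ x < p + a + c ∧ j = min x (p + a) - y ∧
      gs = [⟨.left, y, x⟩] := by
  cases h with
  | leftStop _ y hx hy hya hyx => exact ⟨rfl, y, hy, hya, hyx, hx, rfl, rfl⟩
  | leftCross _ s j gs hx hpx hs h =>
    cases h <;> simp [Gate.isRight, List.countP_cons] at hc
  | rightStop => simp [Gate.isRight] at hc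
  | rightCross => simp [Gate.isRight] at hc

theorem Sweep.right_of_countP_one {p a b c x j : ℕ} {gs : List Gate}
    (h : Sweep p a b c .right x j gs) (hc : gs.countP Gate.isRight = 1) :
    (∃ y, p ≤ y ∧ y < p + b ∧ x < y ∧ j = y + 1 - max (x + 1) p ∧ gs = [⟨.right, x, y⟩]) ∨
    (∃ m y, x < p + b ∧ m < c ∧ p ≤ y ∧ y < p + a ∧
      j = (p + b - max (x + 1) p) + (p + a - y) ∧
      gs = [⟨.right, x, p + b + m⟩, ⟨.left, y, p + a + m⟩]) := by
  cases h with
  | rightStop _ y hy hyb hxy => exact .inl ⟨y, hy, hyb, hxy, rfl, rfl⟩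
  | rightCross _ m j gs hx hm h =>
    rw [List.countP_cons] at hc
    obtain ⟨-, y, h1, h2, -, -, rfl, rfl⟩ := h.of_countP_zero
      (by simpa [Gate.isRight] using hc)
    exact .inr ⟨m, y, hx, hm, h1, h2, by rw [min_eq_right (by omega)], rfl⟩

theorem Sweep.left_of_countP_one {p a b c x j : ℕ} {gs : List Gate}
    (h : Sweep p a b c .left x j gs) (hc : gs.countP Gate.isRight = 1) :
    (∃ s y, s < p ∧ p ≤ y ∧ y < p + b ∧ p ≤ x ∧ j = (min x (p + a) - p) + (y + 1 - p) ∧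
      gs = [⟨.left, s, x⟩, ⟨.right, s, y⟩]) ∨
    (∃ s m y, s < p ∧ m < c ∧ p ≤ y ∧ y < p + a ∧ p ≤ x ∧
      j = (min x (p + a) - p) + (b + (p + a - y)) ∧
      gs = [⟨.left, s, x⟩, ⟨.right, s, p + b + m⟩, ⟨.left, y, p + a + m⟩]) := by
  cases h with
  | leftStop => simp [Gate.isRight] at hc
  | leftCross _ s j gs hx hpx hs h =>
    rw [List.countP_cons] at hc
    rcases h.right_of_countP_one (by simpa [Gate.isRight] using hc) with
      ⟨y, h1, h2, h3, rfl, rfl⟩ | ⟨m, y, h1, h2, h3, h4, rfl, rfl⟩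
    · exact .inl ⟨s, y, hs, h1, h2, hpx, by omega, rfl⟩
    · exact .inr ⟨s, m, y, hs, h2, h3, h4, hpx, by omega, rfl⟩

theorem countP_rest {g : Gate} {c : List (Corner D)} {rest : List (Gate × List (Corner D))}
    (hw : ∀ gc ∈ rest, gc.1.wall = .left) :
    ((g, c) :: rest).countP (fun gc => gc.1.isRight) = if g.isRight then 1 else 0 := by
  rw [List.countP_cons, List.countP_eq_zero.2 fun gc hgc => by simp [Gate.isRight, hw gc hgc]]
  simp

section Vertex

variable {k : ℕ} {A X Y B : List (ZMod N)}

/-- The value of the generator `v_{h,q}` at a vertex, and `0` if there is no such generator. -/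
def vertexVal (φ : Gen D → ℤ) (hk : D[k]? = some ⟨A, .vertex X Y, B⟩) (h q : ℕ) : ℤ :=
  if hh : h < Y.length + X.length ∧ 0 < q then φ (.vertex k A X Y B hk ⟨h, hh.1⟩ ⟨q, hh.2⟩) else 0

/-- The corner with the generator `v_{h,q}`. -/
def vertexCorner (hk : D[k]? = some ⟨A, .vertex X Y, B⟩) (h q : ℕ)
    (hh : h < Y.length + X.length) (hq : 0 < q) : Corner D :=
  ⟨.vertex k A X Y B hk ⟨h, hh⟩ ⟨q, hq⟩, 1⟩

theorem wt_vertexCorner (φ : Gen D → ℤ) (hk : D[k]? = some ⟨A, .vertex X Y, B⟩) {h q : ℕ}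
    (hh : h < Y.length + X.length) (hq : 0 < q) :
    wt φ [vertexCorner hk h q hh hq] = vertexVal φ hk h q := by
  simp [vertexCorner, vertexVal, hh, hq]

theorem vertexCorner_eq (hk : D[k]? = some ⟨A, .vertex X Y, B⟩) (h : Fin (Y.length + X.length))
    (j : ℕ+) {h' j' : ℕ} (hh : (h : ℕ) = h') (hj : (j : ℕ) = j') :
    (⟨.vertex k A X Y B hk h j, 1⟩ : Corner D) =
      vertexCorner hk h' j' (hh ▸ h.2) (hj ▸ j.2) := by
  subst hh hj
  rfl

/-- The gate from which the piece is read is its only right gate. Besides strips there remain four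
fans, according to whether each end of the gate is a right edge of the vertex or a strand above or
below it. -/
theorem Layout.piece_vertex (L : Layout D) (hk : D[k]? = some ⟨A, .vertex X Y, B⟩) {t b : ℕ}
    {c : List (Corner D)} {rest : List (Gate × List (Corner D))}
    (h : Piece D k ((⟨.right, t, b⟩, c) :: rest)) (hx : Behind D k rest) :
    (c = [] ∧ ∃ l l', Passes ⟨A, .vertex X Y, B⟩ l t ∧ Passes ⟨A, .vertex X Y, B⟩ l' b ∧
      rest = [(⟨.left, l, l'⟩, [])]) ∨
    (∃ i i', ∃ (h1 : i < i') (h2 : i' < Y.length), t = A.length + i ∧ b = A.length + i' ∧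
      c = [vertexCorner hk i (i' - i) (by omega) (by omega)] ∧ rest = []) ∨
    (∃ i m y, ∃ (h1 : i < Y.length) (_ : m < B.length) (h3 : y < X.length),
      t = A.length + i ∧ b = A.length + Y.length + m ∧
      c = [vertexCorner hk i (Y.length - (i + 1) + (X.length - y)) (by omega) (by omega)] ∧
      rest = [(⟨.left, A.length + y, A.length + X.length + m⟩, [])]) ∨
    (∃ i x, ∃ (_ : t < A.length) (h1 : i < Y.length) (h2 : x < X.length), b = A.length + i ∧
      c = [] ∧ rest = [(⟨.left, t, A.length + x⟩,
        [vertexCorner hk (Y.length + X.length - 1 - x) (x + (i + 1)) (by omega) (by omega)])]) ∨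
    (∃ m x y, ∃ (_ : t < A.length) (_ : m < B.length) (h2 : x < X.length) (h3 : y < X.length),
      b = A.length + Y.length + m ∧ c = [] ∧
      rest = [(⟨.left, t, A.length + x⟩, [vertexCorner hk (Y.length + X.length - 1 - x)
          (x + (Y.length + (X.length - y))) (by omega) (by omega)]),
        (⟨.left, A.length + y, A.length + X.length + m⟩, [])]) := by
  have hw := L.wall_eq_left (L.vertex hk).2.2.2 hx
  obtain ⟨bd, h1, h2⟩ := h
  cases h1 with
  | strip tl tr bl br ct cb ht hb hl hr =>
    simp only [isRotated_pair_cons, Prod.mk.injEq, Gate.mk.injEq, reduceCtorEq, false_and,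
      false_or, true_and, and_assoc] at h2
    obtain ⟨rfl, rfl, rfl, rfl⟩ := h2
    obtain ⟨rfl, ht'⟩ := upperArc_pass hk (by simp) ht
    obtain ⟨rfl, hb'⟩ := lowerArc_pass hk (by simp) hb
    exact .inl ⟨rfl, tl, bl, ht', hb', rfl⟩
  | fan _ _ _ _ hk' h j g gs hs =>
    cases slab_inj hk hk'
    have hcount : (g :: gs).countP Gate.isRight = 1 := by
      have e := h2.perm.countP_eq (fun gc => gc.1.isRight)
      rw [countP_rest hw] at e
      rw [List.countP_cons, List.countP_map, List.countP_reverse] at e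
      rw [List.countP_cons]
      exact e
    have hh := h.2
    generalize hgs : g :: gs = gs' at hs hcount
    unfold halfEdgeWall halfEdgeStrand at hs
    split_ifs at hs with hb
    · rcases hs.right_of_countP_one hcount with
        ⟨y, h1, h3, h4, h5, rfl⟩ | ⟨m, y, h1, h3, h4, h5, h6, rfl⟩
      · obtain ⟨rfl, rfl⟩ := List.cons.inj hgs
        simp only [List.reverse_nil, List.map_nil, isRotated_single_cons, Prod.mk.injEq,
          Gate.mk.injEq, true_and] at h2
        obtain ⟨⟨⟨rfl, rfl⟩, rfl⟩, rfl⟩ := h2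
        refine .inr (.inl ⟨h, b - A.length, by omega, by omega, rfl, by omega, ?_, rfl⟩)
        rw [vertexCorner_eq hk h j rfl (by omega : (j : ℕ) = b - A.length - h)]
      · obtain ⟨rfl, rfl⟩ := List.cons.inj hgs
        simp only [List.reverse_singleton, List.map_cons, List.map_nil, isRotated_pair_cons,
          Prod.mk.injEq, Gate.mk.injEq, true_and, reduceCtorEq, false_and, or_false] at h2
        obtain ⟨⟨⟨rfl, rfl⟩, rfl⟩, rfl⟩ := h2
        refine .inr (.inr (.inl ⟨h, m, y - A.length, hb, h3, by omega, rfl, rfl, ?_, ?_⟩))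
        · rw [vertexCorner_eq hk h j rfl (by omega :
            (j : ℕ) = Y.length - (h + 1) + (X.length - (y - A.length)))]
        · rw [Nat.add_sub_cancel' h4]
    · rcases hs.left_of_countP_one hcount with
        ⟨s, y, h1, h3, h4, h5, h6, rfl⟩ | ⟨s, m, y, h1, h3, h4, h5, h6, h7, rfl⟩
      · obtain ⟨rfl, rfl⟩ := List.cons.inj hgs
        simp only [List.reverse_singleton, List.map_cons, List.map_nil, isRotated_pair_cons,
          Prod.mk.injEq, Gate.mk.injEq, true_and, reduceCtorEq, false_and, false_or] at h2
        obtain ⟨⟨⟨rfl, rfl⟩, rfl⟩, rfl⟩ := h2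
        refine .inr (.inr (.inr (.inl ⟨b - A.length, Y.length + X.length - 1 - h, h1, by omega,
          by omega, by omega, rfl, ?_⟩)))
        rw [vertexCorner_eq hk h j
          (by omega : (h : ℕ) = Y.length + X.length - 1 - (Y.length + X.length - 1 - h))
          (by omega : (j : ℕ) = Y.length + X.length - 1 - h + (b - A.length + 1))]
      · obtain ⟨rfl, rfl⟩ := List.cons.inj hgs
        simp only [List.reverse_cons, List.reverse_nil, List.nil_append, List.singleton_append,
          List.map_cons, List.map_nil, isRotated_triple_cons,
          Prod.mk.injEq, Gate.mk.injEq, true_and, reduceCtorEq, false_and, false_or] at h2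
        obtain ⟨⟨⟨rfl, rfl⟩, rfl⟩, rfl⟩ := h2
        refine .inr (.inr (.inr (.inr ⟨m, Y.length + X.length - 1 - h, y - A.length, h1, h3,
          by omega, by omega, rfl, rfl, ?_⟩)))
        rw [vertexCorner_eq hk h j
          (by omega : (h : ℕ) = Y.length + X.length - 1 - (Y.length + X.length - 1 - h))
          (by omega : (j : ℕ) = Y.length + X.length - 1 - h +
            (Y.length + (X.length - (y - A.length)))), Nat.add_sub_cancel' h4]
  | cupInner _ _ _ hk' => cases slab_inj hk hk'
  | cupOuter _ _ _ hk' => cases slab_inj hk hk'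
  | capInner _ _ _ hk' => cases slab_inj hk hk'
  | capOuter _ _ _ hk' => cases slab_inj hk hk'

theorem basePiece_vertex (hk : D[k]? = some ⟨A, .vertex X Y, B⟩) {h j : ℕ}
    (hh : h < Y.length + X.length) (hj : 0 < j) {g : Gate} {gs : List Gate} {w : Wall} {x : ℕ}
    (hs : Sweep A.length X.length Y.length B.length w x j (g :: gs))
    (hw : w = halfEdgeWall Y.length h)
    (hx : x = halfEdgeStrand A.length X.length Y.length h) :
    BasePiece D k ((g, [vertexCorner hk h j hh hj]) :: gs.reverse.map fun g' => (g', [])) := by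
  subst hw hx
  exact .fan A X Y B hk ⟨h, hh⟩ ⟨j, hj⟩ g gs hs

theorem Layout.left_vertex_pass (L : Layout D) (φ : Gen D → ℤ)
    (hk : D[k]? = some ⟨A, .vertex X Y, B⟩) {l r l' r' : ℕ} (h : Passes ⟨A, .vertex X Y, B⟩ l r)
    (h' : Passes ⟨A, .vertex X Y, B⟩ l' r') (hr : r < r')
    (hs : r' < A.length ∨ A.length + Y.length ≤ r) :
    halfSum φ .left (k + 1) r r' = halfSum φ .left k l l' := by
  rw [L.halfSum_left_eq_sum φ k r r' (ι := Unit) (fun _ => ([], [(⟨.left, l, l'⟩, [])]))]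
  · simp [gateSum, Gate.slice]
  · intro i j h; rfl
  · intro i
    exact piece_strip_right (.pass _ hk _ _ h) (.pass _ hk _ _ h') (h.left_right_lt h' hr) hr
  · intro c rest hp hx
    rcases L.piece_vertex hk hp hx with ⟨rfl, m, m', hm, hm', rfl⟩ | ⟨i, i', h1, h2, h3, h4, -⟩ |
      ⟨i, m, y, h1, h2, h3, h4, h5, -⟩ | ⟨i, x, h1, h2, h3, h4, -⟩ | ⟨m, x, y, h1, h2, h3, h4, h5, -⟩
    · obtain rfl := h.left_unique hm
      obtain rfl := h'.left_unique hm'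
      exact ⟨(), rfl⟩
    all_goals omega

/-- In the names of this lemma and the next three, `P` stands for the strands above the vertex, `Y`
for its right edges and `Q` for the strands below it; the two letters give the ends of the gate. -/
theorem Layout.left_vertex_YY (L : Layout D) (φ : Gen D → ℤ)
    (hk : D[k]? = some ⟨A, .vertex X Y, B⟩) {i i' : ℕ} (hi : i < i') (hi' : i' < Y.length) :
    halfSum φ .left (k + 1) (A.length + i) (A.length + i') = vertexVal φ hk i (i' - i) := by
  rw [L.halfSum_left_eq_sum φ k _ _ (ι := Unit)
    (fun _ => ([vertexCorner hk i (i' - i) (by omega) (by omega)], []))]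
  · simp [wt_vertexCorner]
  · intro i j h; rfl
  · intro _
    have := Sweep.rightStop (a := X.length) (c := B.length) (A.length + i) (A.length + i')
      (p := A.length) (b := Y.length) (by omega) (by omega) (by omega)
    rw [show A.length + i' + 1 - max (A.length + i + 1) A.length = i' - i by omega] at this
    exact ⟨_, basePiece_vertex hk (h := i) (by omega) (by omega) this
      (by rw [halfEdgeWall, if_pos (by omega)]) (by rw [halfEdgeStrand, if_pos (by omega)]),
      List.IsRotated.refl _⟩
  · intro c rest hp hx
    rcases L.piece_vertex hk hp hx with ⟨rfl, m, m', hm, hm', rfl⟩ |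
      ⟨i1, i2, h1, h2, h3, h4, rfl, rfl⟩ |
      ⟨i, m, y, h1, h2, h3, h4, h5, -⟩ | ⟨i, x, h1, h2, h3, h4, -⟩ | ⟨m, x, y, h1, h2, h3, h4, h5, -⟩
    · generalize hr : A.length + i = r at hm
      cases hm <;> simp only [LagPoint.numIn, LagPoint.numOut] at * <;> omega
    · obtain rfl : i1 = i := by omega
      obtain rfl : i2 = i' := by omega
      exact ⟨(), rfl⟩
    all_goals omega

theorem Layout.left_vertex_YQ (L : Layout D) (φ : Gen D → ℤ)
    (hk : D[k]? = some ⟨A, .vertex X Y, B⟩) {i m : ℕ} (hi : i < Y.length) (hm : m < B.length) :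
    halfSum φ .left (k + 1) (A.length + i) (A.length + Y.length + m) =
      ∑ y : Fin X.length, vertexVal φ hk i (Y.length - (i + 1) + (X.length - y)) *
        halfSum φ .left k (A.length + y) (A.length + X.length + m) := by
  rw [L.halfSum_left_eq_sum φ k _ _ (ι := Fin X.length)
    (fun y => ([vertexCorner hk i (Y.length - (i + 1) + (X.length - y)) (by omega) (by omega)],
      [(⟨.left, A.length + y, A.length + X.length + m⟩, [])]))]
  · simp [wt_vertexCorner, gateSum, Gate.slice]
  · intro y y' h
    simp only [Prod.mk.injEq, List.cons.injEq, Gate.mk.injEq] at h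
    apply Fin.ext; omega
  · intro y
    have h1 := Sweep.leftStop (b := Y.length) (A.length + X.length + m) (A.length + y)
      (p := A.length) (a := X.length) (c := B.length) (by omega) (by omega) (by omega) (by omega)
    have := Sweep.rightCross (A.length + i) m _ _ (by omega) hm h1
    rw [show A.length + Y.length - max (A.length + i + 1) A.length +
      (min (A.length + X.length + m) (A.length + X.length) - (A.length + ↑y)) =
      Y.length - (i + 1) + (X.length - y) by omega] at this
    exact ⟨_, basePiece_vertex hk (h := i) (by omega) (by omega) this
      (by rw [halfEdgeWall, if_pos (by omega)]) (by rw [halfEdgeStrand, if_pos (by omega)]),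
      List.IsRotated.refl _⟩
  · intro c rest hp hx
    rcases L.piece_vertex hk hp hx with ⟨rfl, m, m', hm, hm', rfl⟩ |
      ⟨i1, i2, h1, h2, h3, h4, rfl, rfl⟩ |
      ⟨i1, m1, y, h1, h2, h3, h4, h5, rfl, rfl⟩ | ⟨i, x, h1, h2, h3, h4, -⟩ |
      ⟨m, x, y, h1, h2, h3, h4, h5, -⟩
    · generalize hr : A.length + i = r at hm
      cases hm <;> simp only [LagPoint.numIn, LagPoint.numOut] at * <;> omega
    · omega
    · obtain rfl : i1 = i := by omega
      obtain rfl : m1 = m := by omega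
      exact ⟨⟨y, h3⟩, rfl⟩
    all_goals omega

theorem Layout.left_vertex_PY (L : Layout D) (φ : Gen D → ℤ)
    (hk : D[k]? = some ⟨A, .vertex X Y, B⟩) {s i : ℕ} (hs : s < A.length) (hi : i < Y.length) :
    halfSum φ .left (k + 1) s (A.length + i) =
      ∑ x : Fin X.length, halfSum φ .left k s (A.length + x) *
        vertexVal φ hk (Y.length + X.length - 1 - x) (x + (i + 1)) := by
  rw [L.halfSum_left_eq_sum φ k _ _ (ι := Fin X.length)
    (fun x => ([], [(⟨.left, s, A.length + x⟩, [vertexCorner hk (Y.length + X.length - 1 - x)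
      (x + (i + 1)) (by omega) (by omega)])]))]
  · simp [wt_vertexCorner, gateSum, Gate.slice]
  · intro y y' h
    simp only [Prod.mk.injEq, List.cons.injEq, Gate.mk.injEq] at h
    apply Fin.ext; omega
  · intro x
    have h1 := Sweep.rightStop (a := X.length) (c := B.length) s (A.length + i)
      (p := A.length) (b := Y.length) (by omega) (by omega) (by omega)
    have := Sweep.leftCross (A.length + x) s _ _ (by omega) (by omega) hs h1
    rw [show min (A.length + x) (A.length + X.length) - A.length +
      (A.length + i + 1 - max (s + 1) A.length) = x + (i + 1) by omega] at this
    exact ⟨_, basePiece_vertex hk (h := Y.length + X.length - 1 - x) (by omega) (by omega) this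
      (by rw [halfEdgeWall, if_neg (by omega)])
      (by rw [halfEdgeStrand, if_neg (by omega)]; omega),
      isRotated_pair_cons.2 (.inr ⟨rfl, rfl⟩)⟩
  · intro c rest hp hx
    rcases L.piece_vertex hk hp hx with ⟨rfl, m, m', hm, hm', rfl⟩ |
      ⟨i1, i2, h1, h2, h3, h4, rfl, rfl⟩ |
      ⟨i1, m1, y, h1, h2, h3, h4, h5, rfl, rfl⟩ | ⟨i1, x, h1, h2, h3, h4, rfl, rfl⟩ |
      ⟨m, x, y, h1, h2, h3, h4, h5, -⟩
    · generalize hr : A.length + i = r at hm'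
      cases hm' <;> simp only [LagPoint.numIn, LagPoint.numOut] at * <;> omega
    · omega
    · omega
    · obtain rfl : i1 = i := by omega
      exact ⟨⟨x, h3⟩, rfl⟩
    · omega

/-- The first term comes from strips that contain the vertex in their boundary slab without touching
it; the double sum comes from fans that start at a left edge, turn past all right edges and end at a
left edge. -/
theorem Layout.left_vertex_PQ (L : Layout D) (φ : Gen D → ℤ)
    (hk : D[k]? = some ⟨A, .vertex X Y, B⟩) {s m : ℕ} (hs : s < A.length) (hm : m < B.length) :
    halfSum φ .left (k + 1) s (A.length + Y.length + m) =
      halfSum φ .left k s (A.length + X.length + m) +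
      ∑ x : Fin X.length, ∑ y : Fin X.length, halfSum φ .left k s (A.length + x) *
        vertexVal φ hk (Y.length + X.length - 1 - x) (x + (Y.length + (X.length - y))) *
        halfSum φ .left k (A.length + y) (A.length + X.length + m) := by
  have hps : Passes ⟨A, .vertex X Y, B⟩ s s := .above s hs
  have hpm : Passes ⟨A, .vertex X Y, B⟩ (A.length + X.length + m) (A.length + Y.length + m) :=
    .below m hm
  rw [L.halfSum_left_eq_sum φ k _ _ (ι := Option (Fin X.length × Fin X.length))
    (fun o => o.elim ([], [(⟨.left, s, A.length + X.length + m⟩, [])])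
      fun z => ([], [(⟨.left, s, A.length + z.1⟩, [vertexCorner hk (Y.length + X.length - 1 - z.1)
        (z.1 + (Y.length + (X.length - z.2))) (by omega) (by omega)]),
        (⟨.left, A.length + z.2, A.length + X.length + m⟩, [])]))]
  · rw [Fintype.sum_option, Fintype.sum_prod_type]
    simp [wt_vertexCorner, gateSum, Gate.slice]
  · rintro (_ | ⟨x, y⟩) (_ | ⟨x', y'⟩) h
    · rfl
    · simp at h
    · simp at h
    · simp only [Option.elim_some, Prod.mk.injEq, List.cons.injEq, Gate.mk.injEq] at h
      rw [Option.some.injEq, Prod.mk.injEq, Fin.ext_iff, Fin.ext_iff]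
      omega
  · rintro (_ | ⟨x, y⟩)
    · exact piece_strip_right (.pass _ hk _ _ hps) (.pass _ hk _ _ hpm) (by omega) (by omega)
    have h1 := Sweep.leftStop (b := Y.length) (A.length + X.length + m) (A.length + y)
      (p := A.length) (a := X.length) (c := B.length) (by omega) (by omega) (by omega) (by omega)
    have h2 := Sweep.rightCross s m _ _ (by omega) hm h1
    have := Sweep.leftCross (A.length + x) s _ _ (by omega) (by omega) hs h2
    rw [show min (A.length + x) (A.length + X.length) - A.length +
      (A.length + Y.length - max (s + 1) A.length +
      (min (A.length + X.length + m) (A.length + X.length) - (A.length + ↑y))) =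
        x + (Y.length + (X.length - y)) by omega] at this
    exact ⟨_, basePiece_vertex hk (h := Y.length + X.length - 1 - x) (by omega) (by omega) this
      (by rw [halfEdgeWall, if_neg (by omega)])
      (by rw [halfEdgeStrand, if_neg (by omega)]; omega),
      isRotated_triple_cons.2 (.inr (.inr ⟨rfl, rfl⟩))⟩
  · intro c rest hp hx
    rcases L.piece_vertex hk hp hx with ⟨rfl, l, l', hl, hl', rfl⟩ |
      ⟨i1, i2, h1, h2, h3, h4, rfl, rfl⟩ |
      ⟨i1, m1, y, h1, h2, h3, h4, h5, rfl, rfl⟩ | ⟨i1, x, h1, h2, h3, h4, rfl, rfl⟩ |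
      ⟨m1, x, y, h1, h2, h3, h4, h5, rfl, rfl⟩
    · obtain rfl := hps.left_unique hl
      obtain rfl := hpm.left_unique hl'
      exact ⟨none, rfl⟩
    · omega
    · omega
    · omega
    · obtain rfl : m1 = m := by omega
      exact ⟨some (⟨x, h3⟩, ⟨y, h4⟩), rfl⟩

/-- Right halves at the left edges of a vertex are single fans: any other piece would need a right
gate, behind which nothing can lie. -/
theorem Layout.right_vertex (L : Layout D) (φ : Gen D → ℤ)
    (hk : D[k]? = some ⟨A, .vertex X Y, B⟩) {i i' : ℕ} (hi : i < i') (hi' : i' < X.length) :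
    halfSum φ .right k (A.length + i) (A.length + i') =
      vertexVal φ hk (Y.length + X.length - 1 - i') (i' - i) := by
  rw [L.halfSum_right_eq_sum φ k _ _ (ι := Unit)
    (fun _ => ([vertexCorner hk (Y.length + X.length - 1 - i') (i' - i) (by omega) (by omega)],
      []))]
  · simp [wt_vertexCorner]
  · intro i j h; rfl
  · intro _
    have := Sweep.leftStop (b := Y.length) (A.length + i') (A.length + i)
      (p := A.length) (a := X.length) (c := B.length) (by omega) (by omega) (by omega) (by omega)
    rw [show min (A.length + i') (A.length + X.length) - (A.length + i) = i' - i by omega] at this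
    exact ⟨_, basePiece_vertex hk (h := Y.length + X.length - 1 - i') (by omega) (by omega) this
      (by rw [halfEdgeWall, if_neg (by omega)])
      (by rw [halfEdgeStrand, if_neg (by omega)]; omega), List.IsRotated.refl _⟩
  · intro c rest hp hx
    have hw := L.wall_eq_left (L.vertex hk).2.2.2 hx
    obtain ⟨bd, h1, h2⟩ := hp
    cases h1 with
    | strip tl tr bl br ct cb ht hb hl hr =>
      simp only [isRotated_pair_cons, Prod.mk.injEq, Gate.mk.injEq, reduceCtorEq, false_and,
        or_false, true_and, and_assoc] at h2
      obtain ⟨rfl, rfl, rfl, rfl⟩ := h2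
      simp at hw
    | fan _ _ _ _ hk' h j g gs hs =>
      cases slab_inj hk hk'
      have hcount : (g :: gs).countP Gate.isRight = 0 := by
        have e := h2.perm.countP_eq (fun gc => gc.1.isRight)
        rw [countP_rest hw] at e
        rw [List.countP_cons, List.countP_map, List.countP_reverse] at e
        rw [List.countP_cons]
        exact e
      have hh := h.2
      generalize hgs : g :: gs = gs' at hs hcount
      unfold halfEdgeWall halfEdgeStrand at hs
      split_ifs at hs with hb
      · have := (hs.of_countP_zero hcount).1
        simp at this
      · obtain ⟨-, y, h1, h3, h4, h5, h6, rfl⟩ := hs.of_countP_zero hcount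
        obtain ⟨rfl, rfl⟩ := List.cons.inj hgs
        simp only [List.reverse_nil, List.map_nil, isRotated_single_cons, Prod.mk.injEq,
          Gate.mk.injEq, true_and] at h2
        obtain ⟨⟨⟨h7, h8⟩, rfl⟩, rfl⟩ := h2
        refine ⟨(), ?_⟩
        rw [vertexCorner_eq hk h j (by omega : (h : ℕ) = Y.length + X.length - 1 - i')
          (by omega : (j : ℕ) = i' - i)]
    | cupInner _ _ _ hk' => cases slab_inj hk hk'
    | cupOuter _ _ _ hk' => cases slab_inj hk hk'
    | capInner _ _ _ hk' => cases slab_inj hk hk'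
    | capOuter _ _ _ hk' => cases slab_inj hk hk'

end Vertex

/-! ### Acyclic differentials over the integers -/

/-- A square matrix which is a contractible differential. -/
def IsAcyclic {ι : Type} [Fintype ι] [DecidableEq ι] (M : Matrix ι ι ℤ) : Prop :=
  M * M = 0 ∧ ∃ h : Matrix ι ι ℤ, M * h + h * M = 1

section Algebra

variable {ι κ : Type} [Fintype ι] [DecidableEq ι] [Fintype κ] [DecidableEq κ]

/-- Because `M * M = 0`, the matrix `M * g + g * M` commutes with `M`, and so does its inverse;
multiplying `g` by the inverse gives an exact contraction. -/
theorem isAcyclic_of_isUnit {M g : Matrix ι ι ℤ} (hM : M * M = 0)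
    (hg : IsUnit (M * g + g * M)) : IsAcyclic M := by
  obtain ⟨v, hv, hv'⟩ := isUnit_iff_exists.1 hg
  set u := M * g + g * M with hu
  refine ⟨hM, g * v, ?_⟩
  have hc : M * u = u * M := by
    rw [hu, mul_add, add_mul, ← mul_assoc, hM, mul_assoc g M M, hM]
    simp [mul_assoc]
  have hc' : v * M = M * v := by
    calc v * M = v * (M * u) * v := by rw [mul_assoc, mul_assoc M, hv, mul_one]
      _ = M * v := by rw [hc, ← mul_assoc, hv', one_mul]
  rw [mul_assoc, hc', ← mul_assoc, ← mul_assoc, ← add_mul, ← hu, hv]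

theorem IsAcyclic.submatrix {M : Matrix ι ι ℤ} (h : IsAcyclic M) (e : κ ≃ ι) :
    IsAcyclic (M.submatrix e e) := by
  obtain ⟨h1, g, h2⟩ := h
  refine ⟨?_, g.submatrix e e, ?_⟩
  · rw [Matrix.submatrix_mul_equiv, h1]; rfl
  · rw [Matrix.submatrix_mul_equiv, Matrix.submatrix_mul_equiv, ← Matrix.submatrix_one_equiv e, ← h2]
    rfl

theorem IsAcyclic.conj {M R C : Matrix ι ι ℤ} (h : IsAcyclic M) (hRC : R * C = 1) :
    IsAcyclic (R * M * C) := by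
  have hCR : C * R = 1 := mul_eq_one_comm.1 hRC
  obtain ⟨h1, g, h2⟩ := h
  refine ⟨?_, R * g * C, ?_⟩
  · calc R * M * C * (R * M * C) = R * (M * (C * R) * M) * C := by simp only [mul_assoc]
      _ = 0 := by rw [hCR, mul_one, h1]; simp
  · calc R * M * C * (R * g * C) + R * g * C * (R * M * C)
        = R * (M * (C * R) * g + g * (C * R) * M) * C := by
          simp only [mul_assoc, mul_add, add_mul]
      _ = 1 := by rw [hCR, mul_one, mul_one, h2, mul_one, hRC]

/-- Conjugation by the elementary matrix `1 - e E_{pq}`, whose inverse is `1 + e E_{pq}`, written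
out in entries. -/
theorem IsAcyclic.handleSlide {M : Matrix ι ι ℤ} (h : IsAcyclic M) {p q : ι} (hpq : p ≠ q)
    (e : ℤ) :
    IsAcyclic (Matrix.of fun i j => M i j - (if i = p then e * M q j else 0) +
      (if j = q then e * M i p else 0) - if i = p ∧ j = q then e * e * M q p else 0) := by
  have h1 : (1 - Matrix.single p q e) * (1 + Matrix.single p q e) = 1 := by
    have : Matrix.single p q e * Matrix.single p q e = 0 :=
      Matrix.single_mul_single_of_ne _ _ _ _ hpq.symm _
    rw [sub_mul, one_mul, mul_add, this]
    simp
  convert h.conj h1 using 1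
  ext i j
  have hr : ∀ (A : Matrix ι ι ℤ) i j, (A * Matrix.single p q e) i j =
      if j = q then e * A i p else 0 := by
    intro A i j
    simp only [Matrix.mul_apply, Matrix.single_apply]
    split_ifs with hj
    · subst hj; simp [mul_comm]
    · exact Finset.sum_eq_zero fun x _ => by rw [if_neg (fun h => hj h.2.symm), mul_zero]
  have hl : ∀ (A : Matrix ι ι ℤ) i j, (Matrix.single p q e * A) i j =
      if i = p then e * A q j else 0 := by
    intro A i j
    simp only [Matrix.mul_apply, Matrix.single_apply]
    split_ifs with hi
    · subst hi; simp
    · exact Finset.sum_eq_zero fun x _ => by rw [if_neg (fun h => hi h.1.symm), zero_mul]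
  rw [mul_add, mul_one, sub_mul, one_mul]
  simp only [Matrix.of_apply, Matrix.add_apply, Matrix.sub_apply, hr, hl]
  split_ifs <;> simp_all
  ring

/-- Replacing a block `X` of an acyclic differential by a homotopy equivalent block `Y`. -/
theorem IsAcyclic.replaceBlock {O X Y : Type} [Fintype O] [DecidableEq O] [Fintype X]
    [DecidableEq X] [Fintype Y] [DecidableEq Y] {OO : Matrix O O ℤ} {OX : Matrix O X ℤ}
    {XO : Matrix X O ℤ} {XX : Matrix X X ℤ} (h : IsAcyclic (Matrix.fromBlocks OO OX XO XX))
    (h0 : XO * OX = 0) {G : Matrix X Y ℤ} {F : Matrix Y X ℤ} {H : Matrix X X ℤ}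
    {K YY : Matrix Y Y ℤ} (hYY : YY * YY = 0) (hF : YY * F = F * XX) (hG : XX * G = G * YY)
    (hGF : G * F = 1 + XX * H + H * XX) (hFG : F * G = 1 + YY * K + K * YY) :
    IsAcyclic (Matrix.fromBlocks (OO + OX * H * XO) (OX * G) (F * XO) YY) := by
  obtain ⟨hsq, g, hg⟩ := h
  rw [Matrix.fromBlocks_multiply, ← Matrix.fromBlocks_zero, Matrix.fromBlocks_inj] at hsq
  obtain ⟨s1, s2, s3, s4⟩ := hsq
  have e1 : OO * OO = -(OX * XO) := eq_neg_of_add_eq_zero_left s1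
  have e2 : OO * OX = -(OX * XX) := eq_neg_of_add_eq_zero_left s2
  have e3 : XO * OO = -(XX * XO) := eq_neg_of_add_eq_zero_left s3
  have e4 : XX * XX = 0 := by rwa [h0, zero_add] at s4
  have r1 : ∀ {n : Type} (Z : Matrix O n ℤ), OO * (OO * Z) = -(OX * (XO * Z)) := fun Z => by
    rw [← Matrix.mul_assoc, e1, Matrix.neg_mul, Matrix.mul_assoc]
  have r2 : ∀ {n : Type} (Z : Matrix X n ℤ), OO * (OX * Z) = -(OX * (XX * Z)) := fun Z => by
    rw [← Matrix.mul_assoc, e2, Matrix.neg_mul, Matrix.mul_assoc]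
  have r3 : ∀ {n : Type} (Z : Matrix O n ℤ), XO * (OO * Z) = -(XX * (XO * Z)) := fun Z => by
    rw [← Matrix.mul_assoc, e3, Matrix.neg_mul, Matrix.mul_assoc]
  have r0 : ∀ {n : Type} (Z : Matrix X n ℤ), XO * (OX * Z) = 0 := fun Z => by
    rw [← Matrix.mul_assoc, h0, Matrix.zero_mul]
  have rF : ∀ {n : Type} (Z : Matrix X n ℤ), YY * (F * Z) = F * (XX * Z) := fun Z => by
    rw [← Matrix.mul_assoc, hF, Matrix.mul_assoc]
  have hG' := hG.symm
  have rGF : ∀ {n : Type} (Z : Matrix X n ℤ), G * (F * Z) = Z + XX * (H * Z) + H * (XX * Z) :=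
    fun Z => by
      rw [← Matrix.mul_assoc, hGF, Matrix.add_mul, Matrix.add_mul, Matrix.one_mul,
        Matrix.mul_assoc, Matrix.mul_assoc]
  -- The matrices `Ψ` and `Φ` extend `F` and `G` to chain maps between the old and the new complex
  -- (`c1`, `c2`), and `κ` extends the homotopy `K`.
  let d' := Matrix.fromBlocks (OO + OX * H * XO) (OX * G) (F * XO) YY
  let Ψ : Matrix (O ⊕ Y) (O ⊕ X) ℤ := Matrix.fromBlocks 1 (OX * H) 0 F
  let Φ : Matrix (O ⊕ X) (O ⊕ Y) ℤ := Matrix.fromBlocks 1 0 (H * XO) G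
  let κ : Matrix (O ⊕ Y) (O ⊕ Y) ℤ := Matrix.fromBlocks 0 0 0 K
  let M := Matrix.fromBlocks OO OX XO XX
  have c1 : d' * Ψ = Ψ * M := by
    simp only [d', Ψ, M, Matrix.fromBlocks_multiply, Matrix.fromBlocks_inj]
    refine ⟨?_, ?_, ?_, ?_⟩ <;>
      simp only [Matrix.add_mul, Matrix.mul_add, Matrix.mul_assoc, r2, r0, hF, hGF, Matrix.mul_one,
        Matrix.one_mul, Matrix.mul_zero, Matrix.zero_mul] <;> abel
  have c2 : M * Φ = Φ * d' := by
    simp only [d', Φ, M, Matrix.fromBlocks_multiply, Matrix.fromBlocks_inj]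
    refine ⟨?_, ?_, ?_, ?_⟩ <;>
      simp only [Matrix.mul_add, Matrix.mul_assoc, e3, r0, rGF, hG', Matrix.mul_one,
        Matrix.one_mul, Matrix.mul_zero, Matrix.zero_mul, Matrix.mul_neg] <;> abel
  have c3 : d' * d' = 0 := by
    rw [← Matrix.fromBlocks_zero]
    simp only [d', Matrix.fromBlocks_multiply, Matrix.fromBlocks_inj]
    refine ⟨?_, ?_, ?_, ?_⟩ <;>
      simp only [Matrix.add_mul, Matrix.mul_add, Matrix.mul_assoc, e1, r2, e3, r0, rF, rGF, hG', hYY,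
        Matrix.mul_zero, Matrix.mul_neg] <;> abel
  refine isAcyclic_of_isUnit (g := Ψ * g * Φ - κ) c3 ?_
  -- The composite `Ψ * Φ` is homotopic only to `1 + E`: the defect `E` appears since `F`, `G`, `H`,
  -- `K` are not assumed to satisfy side conditions.
  let W : Matrix O Y ℤ := OX * (H * G - G * K)
  let W' : Matrix Y O ℤ := (F * H - K * F) * XO
  let E : Matrix (O ⊕ Y) (O ⊕ Y) ℤ := Matrix.fromBlocks (OX * (H * (H * XO))) W W' 0
  have c4 : d' * (Ψ * g * Φ - κ) + (Ψ * g * Φ - κ) * d' = 1 + E := by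
    have a1 : d' * (Ψ * g * Φ) + Ψ * g * Φ * d' = Ψ * Φ := by
      calc d' * (Ψ * g * Φ) + Ψ * g * Φ * d'
          = (d' * Ψ) * g * Φ + Ψ * g * (Φ * d') := by simp only [Matrix.mul_assoc]
        _ = Ψ * (M * g + g * M) * Φ := by
          rw [c1, ← c2]; simp only [Matrix.mul_assoc, Matrix.mul_add, Matrix.add_mul]
        _ = Ψ * Φ := by rw [hg, Matrix.mul_one]
    have a2 : Ψ * Φ = 1 + E + (d' * κ + κ * d') := by
      rw [← Matrix.fromBlocks_one]
      simp only [d', Ψ, Φ, κ, E, W, W', Matrix.fromBlocks_multiply, Matrix.fromBlocks_add,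
        Matrix.fromBlocks_inj]
      refine ⟨?_, ?_, ?_, ?_⟩ <;>
        simp only [Matrix.mul_sub, Matrix.sub_mul, Matrix.mul_assoc, hFG, Matrix.mul_one,
          Matrix.mul_zero, Matrix.zero_mul] <;> abel
    rw [mul_sub, sub_mul]
    calc _ = (d' * (Ψ * g * Φ) + Ψ * g * Φ * d') - (d' * κ + κ * d') := by abel
      _ = 1 + E := by rw [a1, a2]; abel
  rw [c4]
  -- Every factor `XO * OX` vanishes, so `E` is nilpotent and the approximate contraction can be
  -- corrected.
  refine IsNilpotent.isUnit_one_add ⟨3, ?_⟩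
  have b1 : E * E = Matrix.fromBlocks (W * W') 0 0 0 := by
    simp only [E, W, W', Matrix.fromBlocks_multiply, Matrix.fromBlocks_inj]
    refine ⟨?_, ?_, ?_, ?_⟩ <;>
      simp only [Matrix.mul_sub, Matrix.sub_mul, Matrix.mul_assoc, r0,
        Matrix.mul_zero, Matrix.zero_mul] <;> abel
  rw [pow_succ, pow_two, b1, ← Matrix.fromBlocks_zero]
  simp only [E, W, W', Matrix.fromBlocks_multiply, Matrix.fromBlocks_inj]
  refine ⟨?_, ?_, ?_, ?_⟩ <;>
    simp only [Matrix.mul_sub, Matrix.sub_mul, Matrix.mul_assoc, r0,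
      Matrix.mul_zero, Matrix.zero_mul] <;> abel

end Algebra

/-! ### Indexing by blocks -/

/-- The differential on `n` strands with the coefficients `u`. -/
def strandMatrix (n : ℕ) (u : ℕ → ℕ → ℤ) : Matrix (Fin n) (Fin n) ℤ := Matrix.of fun i j => u i j

theorem isAcyclic_strandMatrix_iff {ι : Type} [Fintype ι] [DecidableEq ι] {n : ℕ}
    (u : ℕ → ℕ → ℤ) (f : ι → ℕ) (hf : Function.Injective f) (hlt : ∀ i, f i < n)
    (hcard : Fintype.card ι = n) :
    IsAcyclic (strandMatrix n u) ↔ IsAcyclic (Matrix.of fun i j => u (f i) (f j)) := by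
  let f' : ι → Fin n := fun i => ⟨f i, hlt i⟩
  have hf' : Function.Bijective f' := (Fintype.bijective_iff_injective_and_card f').2
    ⟨fun i j h => hf (congrArg Fin.val h), by simpa using hcard⟩
  let e := Equiv.ofBijective f' hf'
  have h1 : (strandMatrix n u).submatrix e e = Matrix.of fun i j => u (f i) (f j) := rfl
  constructor
  · intro h; rw [← h1]; exact h.submatrix e
  · intro h
    rw [← h1] at h
    simpa using h.submatrix e.symm

/-- The positions of the strands when `a` strands at a point have `p` strands above and `c` strands
below them. -/
def blockPos (p a c : ℕ) : (Fin p ⊕ Fin c) ⊕ Fin a → ℕ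
  | .inl (.inl i) => i
  | .inl (.inr m) => p + a + m
  | .inr i => p + i

theorem isAcyclic_strandMatrix_block (u : ℕ → ℕ → ℤ) (p a c : ℕ) {n : ℕ} (hn : n = p + a + c) :
    IsAcyclic (strandMatrix n u) ↔
      IsAcyclic (Matrix.of fun i j => u (blockPos p a c i) (blockPos p a c j)) := by
  apply isAcyclic_strandMatrix_iff
  · rintro ((i | i) | i) ((j | j) | j) h <;> simp only [blockPos] at h
    · rw [Fin.ext h]
    · omega
    · omega
    · omega
    · rw [show i = j from Fin.ext (by omega)]
    · omega
    · omega
    · omega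
    · rw [show i = j from Fin.ext (by omega)]
  · rintro ((i | i) | i) <;> simp only [blockPos] <;> omega
  · simp; omega

/-! ### The differential on the strands of a slice -/

namespace Layout

/-- The sign of a strand. -/
def sgn (L : Layout D) (s t : ℕ) : ℤ := koszul (L.potAt s t)

theorem sgn_mul_self (L : Layout D) (s t : ℕ) : L.sgn s t * L.sgn s t = 1 := koszul_mul_self _

/-- The coefficients of the differential on the strands of a slice: signed counts of left halves
above the diagonal and of right halves below it. -/
noncomputable def coeff (L : Layout D) (φ : Gen D → ℤ) (s i j : ℕ) : ℤ :=
  if i < j then L.sgn s i * halfSum φ .left s i j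
  else if j < i then L.sgn s j * halfSum φ .right s j i else 0

theorem coeff_lt (L : Layout D) (φ : Gen D → ℤ) {s i j : ℕ} (h : i < j) :
    L.coeff φ s i j = L.sgn s i * halfSum φ .left s i j := if_pos h

theorem coeff_gt (L : Layout D) (φ : Gen D → ℤ) {s i j : ℕ} (h : j < i) :
    L.coeff φ s i j = L.sgn s j * halfSum φ .right s j i := by
  rw [coeff, if_neg (by omega), if_pos h]

@[simp] theorem coeff_self (L : Layout D) (φ : Gen D → ℤ) (s i : ℕ) : L.coeff φ s i i = 0 := by
  simp [coeff]

theorem coeff_gt_of_ord (L : Layout D) (φ : Gen D → ℤ) {s i j : ℕ} (h : j < i)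
    (ho : L.ord s j < L.ord s i) : L.coeff φ s i j = 0 := by
  rw [L.coeff_gt φ h, L.halfSum_right_eq_zero φ ho, mul_zero]

theorem coeff_lt_of_ord (L : Layout D) (φ : Gen D → ℤ) {s i j : ℕ} (h : i < j)
    (hs : s ≤ D.length) (ho : ¬ L.ord s i < L.ord s j) : L.coeff φ s i j = 0 := by
  rw [L.coeff_lt φ h, L.halfSum_left_eq_zero φ hs ho, mul_zero]

/-- The differential on the strands of a slice. -/
noncomputable def diff (L : Layout D) (φ : Gen D → ℤ) (s : ℕ) :
    Matrix (Fin (L.pot s).length) (Fin (L.pot s).length) ℤ :=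
  strandMatrix _ (L.coeff φ s)

/-- The new matrix is obtained from the old one by a handle slide with coefficient `φ c` and the
transposition of the two strands. Each corner term in the crossing recursions is one of the terms of
the handle slide; its quadratic term vanishes with the entry at `(p + 1, p)`. -/
theorem isAcyclic_crossing (hN : Even N) (L : Layout D) (φ : Gen D → ℤ) {k : ℕ}
    {A B : List (ZMod N)} {x y : ZMod N} (hk : D[k]? = some ⟨A, .crossing x y, B⟩)
    (heq : halfSum φ .left k A.length (A.length + 1) +
      koszul (x - y - 1) * halfSum φ .right (k + 1) A.length (A.length + 1) = 0)
    (h : IsAcyclic (L.diff φ k)) : IsAcyclic (L.diff φ (k + 1)) := by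
  have hn : (L.pot k).length = A.length + 2 + B.length := by
    rw [(L.crossing hk).1]; simp; omega
  have hn' : (L.pot (k + 1)).length = A.length + 2 + B.length := by
    rw [(L.crossing hk).2.1]; simp; omega
  set p := A.length with hp
  set e := φ (.crossing k A x y B hk) with he
  have hs : koszul (x - y - 1) = - (koszul x * koszul y) := by
    rw [koszul_sub hN, koszul_sub hN, koszul_one hN]; ring
  have hpx : L.sgn k p = koszul x := by rw [sgn, (L.potAt_crossing hk).1]
  have hpy : L.sgn k (p + 1) = koszul y := by rw [sgn, (L.potAt_crossing hk).2.1]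
  have hpx' : L.sgn (k + 1) (p + 1) = koszul x := by rw [sgn, (L.potAt_crossing hk).2.2.2]
  have hpy' : L.sgn (k + 1) p = koszul y := by rw [sgn, (L.potAt_crossing hk).2.2.1]
  have hx2 := koszul_mul_self x
  have hy2 := koszul_mul_self y
  have hsg : ∀ t, t < p + 2 + B.length → t ≠ p → t ≠ p + 1 → L.sgn (k + 1) t = L.sgn k t := by
    intro t h1 h2 h3
    rw [sgn, sgn]
    rcases Nat.lt_or_ge t p with h | h
    · rw [L.potAt_pass hk (.above t h)]
    · obtain ⟨m, rfl⟩ := Nat.exists_eq_add_of_le (show p + 2 ≤ t by omega)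
      have := L.potAt_pass hk (.below m (by simp only; omega))
      simp only [LagPoint.numIn, LagPoint.numOut] at this
      rw [this]
  have h1 : IsAcyclic (strandMatrix (p + 2 + B.length) (L.coeff φ k)) := by
    rw [← hn]; exact h
  have h2 := h1.handleSlide (p := ⟨p, by omega⟩) (q := ⟨p + 1, by omega⟩) (by simp) e
  have h3 := (isAcyclic_strandMatrix_iff (n := p + 2 + B.length) (ι := Fin (p + 2 + B.length))
    (fun i j => L.coeff φ k i j - (if i = p then e * L.coeff φ k (p + 1) j else 0) +
      (if j = p + 1 then e * L.coeff φ k i p else 0) -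
      if i = p ∧ j = p + 1 then e * e * L.coeff φ k (p + 1) p else 0)
    (fun i => swapAt p i)
    (fun i j hij => Fin.ext (by
      have := congrArg (swapAt p) hij
      simpa [swapAt_swapAt] using this))
    (fun i => by unfold swapAt; split_ifs <;> omega) (by simp)).1 (by
      convert h2 using 1
      ext i j
      simp [strandMatrix, Fin.ext_iff])
  rw [diff, hn']
  convert h3 using 1
  ext i j
  simp only [strandMatrix, Matrix.of_apply]
  have hi := i.2
  have hj := j.2
  generalize (i : ℕ) = i at hi ⊢
  generalize (j : ℕ) = j at hj ⊢
  have hqp : L.coeff φ k (p + 1) p = 0 := by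
    rw [L.coeff_gt φ (by omega), L.right_crossing_self φ hk, mul_zero]
  have hei : ∀ t, swapAt p t = p ↔ t = p + 1 := by intro t; unfold swapAt; split_ifs <;> omega
  have hei' : ∀ t, swapAt p t = p + 1 ↔ t = p := by intro t; unfold swapAt; split_ifs <;> omega
  simp only [hei, hei', hqp, mul_zero, ite_self, sub_zero]
  rcases lt_trichotomy i j with hij | hij | hij
  · by_cases hne : i = p ∧ j = p + 1
    · obtain ⟨rfl, rfl⟩ := hne
      rw [L.coeff_lt φ hij, L.left_crossing_self φ hk]
      simp [swapAt, hqp]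
    · have hsw := swapAt_lt hij hne
      rw [L.coeff_lt φ hij, L.left_crossing φ hk hij hj hne, L.coeff_lt φ hsw]
      by_cases hi1 : i = p + 1
      · subst hi1
        have e1 : swapAt p (p + 1) = p := (hei _).2 rfl
        have e2 : swapAt p j = j := by unfold swapAt; split_ifs <;> omega
        rw [e1, e2, if_pos rfl, if_pos rfl, if_neg (by omega), if_neg (by omega),
          L.coeff_lt φ (by omega : p + 1 < j), hpx, hpx', hpy, hs]
        linear_combination (-koszul y * e * halfSum φ .left k (p + 1) j) * hx2
      · rw [if_neg hi1, if_neg hi1]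
        by_cases hj1 : j = p
        · subst hj1
          have e2 : swapAt p i = i := by unfold swapAt; split_ifs <;> omega
          rw [if_pos rfl, if_pos rfl, ← hp, (hei' _).2 rfl, e2, L.coeff_lt φ hij,
            hsg i hi (by omega) (by omega)]
          ring
        · rw [if_neg hj1, if_neg hj1]
          by_cases hi2 : i = p
          · subst hi2
            rw [(hei' _).2 rfl, hpy, hpy']; ring
          · have e2 : swapAt p i = i := by unfold swapAt; split_ifs; omega
            rw [e2, hsg i hi hi2 hi1]; ring
  · subst hij
    rw [coeff_self, coeff_self]
    by_cases hi1 : i = p + 1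
    · subst hi1
      rw [(hei _).2 rfl, hqp]; simp
    · by_cases hi2 : i = p
      · subst hi2
        rw [(hei' _).2 rfl, hqp]; simp
      · simp [hi1, hi2]
  -- At this entry a left count before the crossing must equal, up to sign, a right count after it.
  -- This is the only place where the equation of the crossing is used.
  · by_cases hne : j = p ∧ i = p + 1
    · obtain ⟨rfl, rfl⟩ := hne
      rw [(hei' _).2 rfl, (hei _).2 rfl]
      simp only [coeff_self, mul_zero, ite_self, sub_zero, add_zero]
      rw [L.coeff_gt φ hij, L.coeff_lt φ hij, hpx, hpy']
      rw [hs] at heq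
      linear_combination (-koszul x) * heq -
        koszul y * halfSum φ .right (k + 1) p (p + 1) * hx2
    · have hsw := swapAt_lt hij hne
      have hlt : ∀ {t}, t < p + 2 + B.length → swapAt p t < p + 2 + B.length := by
        intro t ht; unfold swapAt; split_ifs <;> omega
      have hne' : ¬ (swapAt p j = p ∧ swapAt p i = p + 1) := by
        rw [hei, hei']; omega
      have hr := L.right_crossing φ hk hsw (hlt hi) hne'
      rw [swapAt_swapAt, swapAt_swapAt] at hr
      simp only [← hp, hei, hei'] at hr
      rw [L.coeff_gt φ hij, L.coeff_gt φ hsw]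
      by_cases hj1 : j = p
      · subst hj1
        have hi1 : i ≠ p + 1 := by omega
        have e2 : swapAt p i = i := by unfold swapAt; split_ifs <;> omega
        have hr2 := L.right_crossing φ hk (t := p) (b := i) (by omega) hi (by omega)
        simp only [← hp, e2, (hei' _).2, if_neg (show ¬ p = p + 1 by omega),
          if_neg (show ¬ i = p by omega), add_zero] at hr2
        rw [if_pos rfl, if_neg hi1, (hei' _).2 rfl, e2] at hr
        rw [(hei' _).2 rfl, e2, if_neg hi1, if_pos rfl, L.coeff_gt φ hij, hpy', hpy, hpx, hr, hr2,
          hs]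
        linear_combination (koszul x * e * halfSum φ .right (k + 1) (p + 1) i) * hy2
      · by_cases hi1 : i = p + 1
        · subst hi1
          have e2 : swapAt p j = j := by unfold swapAt; split_ifs <;> omega
          have hr2 := L.right_crossing φ hk (t := j) (b := p + 1) (by omega) hi (by omega)
          simp only [← hp, e2, (hei _).2, if_neg (show ¬ j = p + 1 by omega),
            if_neg (show ¬ p + 1 = p by omega), add_zero] at hr2
          rw [if_neg hj1, if_pos rfl, (hei _).2 rfl, e2] at hr
          rw [(hei _).2 rfl, e2, if_pos rfl, if_neg hj1, L.coeff_gt φ (by omega : j < p + 1),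
            hsg j hj hj1 (by omega), hr, hr2]
          ring
        · rw [if_neg hj1, if_neg hi1] at hr
          rw [if_neg hj1, if_neg hi1, hr]
          by_cases hj2 : j = p + 1
          · subst hj2
            rw [(hei _).2 rfl, hpx, hpx']; ring
          · have e2 : swapAt p j = j := by unfold swapAt; split_ifs; omega
            rw [e2, hsg j hj hj1 hj2]; ring

end Layout

/-! ### Acyclicity across rounded ends. -/

namespace Layout

theorem sgn_pass (L : Layout D) {k l r : ℕ} {e : LagSlab N} (hk : D[k]? = some e)
    (h : Passes e l r) : L.sgn (k + 1) r = L.sgn k l := by rw [sgn, sgn, L.potAt_pass hk h]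

/-- An empty block is replaced by the contractible differential on the two new strands, whose only
entry counts the half-disk in the rounded end. -/
theorem isAcyclic_cup (hN : Even N) (L : Layout D) (φ : Gen D → ℤ) {k : ℕ}
    {A B : List (ZMod N)} {x : ZMod N} (hk : D[k]? = some ⟨A, .cup x, B⟩)
    (h : IsAcyclic (L.diff φ k)) : IsAcyclic (L.diff φ (k + 1)) := by
  have hn : (L.pot k).length = A.length + 0 + B.length := by
    rw [(L.cup hk).1]; simp
  have hn' : (L.pot (k + 1)).length = A.length + 2 + B.length := by
    rw [(L.cup hk).2.2.1]; simp; omega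
  have hid := (L.cup hk).2.1
  have hid' := (L.cup hk).2.2.2
  have hlow : ∀ {i j}, j < i → L.coeff φ k i j = 0 := fun {i j} h =>
    L.coeff_gt_of_ord φ h (by simpa [hid] using h)
  have hlow' : ∀ {i j}, j < i → L.coeff φ (k + 1) i j = 0 := fun {i j} h =>
    L.coeff_gt_of_ord φ h (by simpa [hid'] using h)
  rw [diff, isAcyclic_strandMatrix_block _ A.length 0 B.length hn] at h
  rw [diff, isAcyclic_strandMatrix_block _ A.length 2 B.length hn']
  set p := A.length with hp
  have hself : L.coeff φ (k + 1) p (p + 1) = - koszul x := by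
    rw [L.coeff_lt φ (by omega), hp, L.left_cup_self φ hk, sgn, (L.potAt_cup hk).1,
      koszul_add hN, koszul_one hN]
    ring
  have hmix : ∀ {i j}, (i < p ∧ p ≤ j ∧ j < p + 2) ∨ (p ≤ i ∧ i < p + 2 ∧ p + 2 ≤ j) →
      L.coeff φ (k + 1) i j = 0 := by
    intro i j hij
    rw [L.coeff_lt φ (by omega), L.left_cup_mixed φ hk hij, mul_zero]
  have hpass : ∀ {l r l' r'}, Passes ⟨A, .cup x, B⟩ l r → Passes ⟨A, .cup x, B⟩ l' r' →
      L.coeff φ (k + 1) r r' = L.coeff φ k l l' := by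
    intro l r l' r' h1 h2
    rcases lt_trichotomy r r' with hr | hr | hr
    · rw [L.coeff_lt φ hr, L.coeff_lt φ (h1.left_right_lt h2 hr), L.left_cup_pass φ hk h1 h2 hr,
        L.sgn_pass hk h1]
    · subst hr
      obtain rfl := h1.left_unique h2
      rw [coeff_self, coeff_self]
    · rw [hlow' hr, hlow (h2.left_right_lt h1 hr)]
  have habove : ∀ i : Fin p, Passes ⟨A, .cup x, B⟩ i i := fun i => .above i i.2
  have hbelow : ∀ m : Fin B.length, Passes ⟨A, .cup x, B⟩ (p + 0 + m) (p + 2 + m) :=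
    fun m => .below m m.2
  rw [← Matrix.fromBlocks_toBlocks (Matrix.of fun i j => L.coeff φ k _ _)] at h
  have hx2 := koszul_mul_self x
  have h2 := h.replaceBlock (Y := Fin 2) (by ext i; exact i.elim0) (G := 0) (F := 0) (H := 0)
    (K := !![0, 0; koszul x, 0]) (YY := !![0, - koszul x; 0, 0])
    (by ext i j; fin_cases i <;> fin_cases j <;> simp [Matrix.mul_apply])
    (by ext i j; exact j.elim0) (by ext i; exact i.elim0) (by ext i; exact i.elim0)
    (by
      ext i j
      fin_cases i <;> fin_cases j <;> simp [Matrix.mul_apply, hx2])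
  convert h2 using 1
  ext i j
  rcases i with (i | i) | i <;> rcases j with (j | j) | j <;>
    simp only [Matrix.of_apply, blockPos, Matrix.fromBlocks_apply₁₁, Matrix.fromBlocks_apply₁₂,
      Matrix.fromBlocks_apply₂₁, Matrix.fromBlocks_apply₂₂, Matrix.mul_zero,
      Matrix.zero_mul, Matrix.zero_apply, add_zero, Matrix.toBlocks₁₁, Matrix.toBlocks₁₂]
  · exact hpass (habove i) (habove j)
  · exact hpass (habove i) (hbelow j)
  · exact hmix (by omega)
  · exact hpass (hbelow i) (habove j)
  · exact hpass (hbelow i) (hbelow j)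
  · exact hlow' (by omega)
  · exact hlow' (by omega)
  · exact hmix (by omega)
  · fin_cases i <;> fin_cases j
    · simp
    · simpa using hself
    · simpa using hlow' (show p < p + 1 by omega)
    · simp

/-- The two ending strands are inverted, so their block has one entry, a unit below the diagonal
that counts the half-disk on the right. Cancelling this block adds the correction `OX * H * XO`,
which is the product in `left_cap_mixed`. -/
theorem isAcyclic_cap (hN : Even N) (L : Layout D) (φ : Gen D → ℤ) {k : ℕ}
    {A B : List (ZMod N)} {x : ZMod N} (hk : D[k]? = some ⟨A, .cap x, B⟩)
    (h : IsAcyclic (L.diff φ k)) : IsAcyclic (L.diff φ (k + 1)) := by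
  have hn : (L.pot k).length = A.length + 2 + B.length := by
    rw [(L.cap hk).1]; simp; omega
  have hn' : (L.pot (k + 1)).length = A.length + 0 + B.length := by
    rw [(L.cap hk).2.2.1]; simp
  have hord := (L.cap hk).2.1
  have hid' := (L.cap hk).2.2.2
  have hlen := (lt_length_of_getElem? hk).le
  set p := A.length with hp
  have hlow : ∀ {i j}, j < i → ¬ (j = p ∧ i = p + 1) → L.coeff φ k i j = 0 := fun {i j} h h' =>
    L.coeff_gt_of_ord φ h (by rw [hord]; exact swapAt_lt h h')
  have hlow' : ∀ {i j}, j < i → L.coeff φ (k + 1) i j = 0 := fun {i j} h =>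
    L.coeff_gt_of_ord φ h (by simpa [hid'] using h)
  rw [diff, isAcyclic_strandMatrix_block _ p 2 B.length hn] at h
  rw [diff, isAcyclic_strandMatrix_block _ p 0 B.length hn']
  have h10 : L.coeff φ k (p + 1) p = koszul x := by
    rw [L.coeff_gt φ (by omega), hp, L.right_cap_self φ hk, sgn, (L.potAt_cap hk).1, mul_one]
  have h01 : L.coeff φ k p (p + 1) = 0 := by
    refine L.coeff_lt_of_ord φ (by omega) hlen ?_
    rw [hord]; simp [swapAt]
  have hsgn : L.sgn k (p + 1) = - koszul x := by
    rw [sgn, hp, (L.potAt_cap hk).2, koszul_add hN, koszul_one hN]; ring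
  have hpass : ∀ {l r l' r'}, Passes ⟨A, .cap x, B⟩ l r → Passes ⟨A, .cap x, B⟩ l' r' →
      (r < p ∧ r' < p ∨ p ≤ r ∧ p ≤ r' ∨ p ≤ r ∧ r' < p) →
      L.coeff φ (k + 1) r r' = L.coeff φ k l l' := by
    intro l r l' r' h1 h2 h3
    rcases lt_trichotomy r r' with hr | hr | hr
    · rw [L.coeff_lt φ hr, L.coeff_lt φ (h1.left_right_lt h2 hr),
        L.left_cap_same φ hk h1 h2 hr (by omega), L.sgn_pass hk h1]
    · subst hr
      obtain rfl := h1.left_unique h2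
      rw [coeff_self, coeff_self]
    · rw [hlow' hr, hlow (h2.left_right_lt h1 hr)]
      rintro ⟨rfl, -⟩
      generalize hpp : p = l' at h2
      cases h2 <;> simp only [LagPoint.numIn] at * <;> omega
  have habove : ∀ i : Fin p, Passes ⟨A, .cap x, B⟩ i i := fun i => .above i i.2
  have hbelow : ∀ m : Fin B.length, Passes ⟨A, .cap x, B⟩ (p + 2 + m) (p + 0 + m) :=
    fun m => .below m m.2
  rw [← Matrix.fromBlocks_toBlocks (Matrix.of fun i j => L.coeff φ k _ _)] at h
  have hx2 := koszul_mul_self x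
  have hXX : (Matrix.of fun i j => L.coeff φ k (blockPos p 2 B.length i)
      (blockPos p 2 B.length j)).toBlocks₂₂ = !![0, 0; koszul x, 0] := by
    ext i j
    fin_cases i <;> fin_cases j <;> simp [Matrix.toBlocks₂₂, blockPos, h10, h01]
  rw [hXX] at h
  -- Only the two ending strands are inverted. Hence the block maps only to strands below it and
  -- receives only from strands above it, and no composite returns to the block.
  have h2 := h.replaceBlock (Y := Fin 0) (by
      ext i j
      rw [Matrix.mul_apply]
      refine Finset.sum_eq_zero fun o _ => ?_
      rcases o with o | o
      · have : L.coeff φ k (p + i) o = 0 := hlow (by omega) (by omega)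
        simp [Matrix.toBlocks₂₁, blockPos, this]
      · have : L.coeff φ k (p + 2 + o) (p + j) = 0 := hlow (by omega) (by omega)
        simp [Matrix.toBlocks₁₂, blockPos, this])
    (G := 0) (F := 0) (H := !![0, - koszul x; 0, 0]) (K := 0) (YY := 0)
    (by simp) (by simp) (by simp)
    (by
      ext i j
      fin_cases i <;> fin_cases j <;>
        simp [Matrix.mul_apply, hx2])
    (by ext i; exact i.elim0)
  convert h2 using 1
  ext i j
  have hmul : ∀ i j : Fin p ⊕ Fin B.length,
      ((Matrix.of fun i j => L.coeff φ k (blockPos p 2 B.length i)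
          (blockPos p 2 B.length j)).toBlocks₁₂ * !![0, - koszul x; 0, 0] *
        (Matrix.of fun i j => L.coeff φ k (blockPos p 2 B.length i)
          (blockPos p 2 B.length j)).toBlocks₂₁) i j =
        - (L.coeff φ k (blockPos p 2 B.length (.inl i)) p * koszul x *
          L.coeff φ k (p + 1) (blockPos p 2 B.length (.inl j))) := by
    intro i j
    simp [Matrix.mul_apply, Matrix.toBlocks₁₂, Matrix.toBlocks₂₁, blockPos, Fin.sum_univ_two]
  rcases i with (i | i) | i <;> rcases j with (j | j) | j <;>
    first
    | exact i.elim0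
    | exact j.elim0
    | rw [Matrix.fromBlocks_apply₁₁, Matrix.add_apply, hmul]
      simp only [Matrix.of_apply, blockPos, Matrix.toBlocks₁₁]
  · rw [hpass (habove i) (habove j) (by omega),
      show L.coeff φ k (p + 1) j = 0 from hlow (by omega) (by omega)]
    simp
  · have e1 := L.left_cap_mixed φ hk i.2 j.2
    rw [L.coeff_lt φ (by omega), L.coeff_lt φ (by omega), L.coeff_lt φ (by omega),
      L.coeff_lt φ (by omega), hsgn, L.sgn_pass hk (habove i)]
    simp only [add_zero]
    rw [e1]
    linear_combination (-(L.sgn k i * halfSum φ .left k i p *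
      halfSum φ .left k (p + 1) (p + 2 + j))) * hx2
  · rw [hpass (hbelow i) (habove j) (by omega),
      show L.coeff φ k (p + 1) j = 0 from hlow (by omega) (by omega)]
    simp
  · rw [hpass (hbelow i) (hbelow j) (by omega),
      show L.coeff φ k (p + 2 + i) p = 0 from hlow (by omega) (by omega)]
    simp

end Layout

/-! ### The relations at a vertex -/

/-- The coefficients of a vertex of valency `n` on the corners with winding number `w`. -/
def levelMatrix (n : ℕ) (S : ℕ → ℤ) (V : ℕ → ℕ → ℤ) (w : ℕ) : Matrix (Fin n) (Fin n) ℤ :=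
  Matrix.of fun h k => S h * V h (k + w * n - h)

theorem sum_range_mul_eq {M : Type*} [AddCommMonoid M] (f : ℕ → M) (n w : ℕ) :
    ∑ m ∈ Finset.range (w * n), f m = ∑ u ∈ Finset.range w, ∑ m : Fin n, f (m + u * n) := by
  induction w with
  | zero => simp
  | succ w ih =>
    rw [add_mul, one_mul, Finset.sum_range_add, ih, Finset.sum_range_succ]
    congr 1
    rw [Finset.sum_range]
    exact Finset.sum_congr rfl fun m _ => by rw [add_comm]

/-- The intermediate half-edge is counted on past full turns as `m + u * n`, with `u` the winding of
the first factor; terms with no room for the second factor vanish by `hV`. -/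
theorem sum_levelMatrix {n : ℕ} (S : ℕ → ℤ) {V : ℕ → ℕ → ℤ} (hV : ∀ h, V h 0 = 0) (h k : Fin n)
    (w : ℕ) :
    (∑ u ∈ Finset.range (w + 1), levelMatrix n S V u * levelMatrix n S V (w - u)) h k =
      ∑ m ∈ Finset.range (k + w * n), S h * S (m % n) * V h (m - h) *
        V (m % n) (k + w * n - m) := by
  have hk := k.2
  have e : ∑ m ∈ Finset.range (k + w * n), S h * S (m % n) * V h (m - h) *
        V (m % n) (k + w * n - m) = ∑ m ∈ Finset.range ((w + 1) * n), S h * S (m % n) *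
          V h (m - h) * V (m % n) (k + w * n - m) := by
    refine Finset.sum_subset (Finset.range_mono (by rw [add_mul]; omega)) fun m _ hm => ?_
    rw [Finset.mem_range] at hm
    rw [show k + w * n - m = 0 by omega, hV, mul_zero]
  rw [e, sum_range_mul_eq, Matrix.sum_apply]
  refine Finset.sum_congr rfl fun u hu => ?_
  rw [Matrix.mul_apply]
  refine Finset.sum_congr rfl fun m _ => ?_
  rw [Finset.mem_range] at hu
  obtain ⟨v, rfl⟩ := Nat.exists_eq_add_of_le (show u ≤ w by omega)
  simp only [levelMatrix, Matrix.of_apply, Nat.add_mul_mod_self_right, Nat.mod_eq_of_lt m.2]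
  rw [show k + (u + v) * n - (m + u * n) = k + (u + v - u) * n - m by
    rw [Nat.add_sub_cancel_left, add_mul]; omega]
  ring

/-- With `M = h + j` the left side lists the equations for all `v_{h,j}`. Sorting them by winding
number gives the coefficients of `(∑ M_w z^w)² = -z`: one full turn, where the constant `1` occurs,
goes from a half-edge to itself with winding number one. -/
theorem levelMatrix_iff {n : ℕ} (S : ℕ → ℤ) {V : ℕ → ℕ → ℤ} (hV : ∀ h, V h 0 = 0) :
    (∀ h < n, ∀ M, h < M → (if M = h + n then 1 else 0) + ∑ m ∈ Finset.range M,
      S h * S (m % n) * V h (m - h) * V (m % n) (M - m) = 0) ↔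
    ∀ w, ∑ u ∈ Finset.range (w + 1), levelMatrix n S V u * levelMatrix n S V (w - u) =
      if w = 1 then -1 else 0 := by
  have key : ∀ (h k : Fin n) (w : ℕ), (if w = 1 then -1 else 0 : Matrix (Fin n) (Fin n) ℤ) h k =
      - if k + w * n = h + n then 1 else 0 := by
    intro h k w
    have hh := h.2
    have hk := k.2
    rcases w with _ | _ | w
    · simp; omega
    · simp [Matrix.one_apply, Fin.ext_iff, eq_comm]
    · have : ¬ (k + (w + 1 + 1) * n = h + n) := by
        rw [add_mul, add_mul]; omega
      simp [this]
  constructor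
  · intro H w
    ext h k
    rw [sum_levelMatrix S hV, key]
    by_cases hM : (h : ℕ) < k + w * n
    · linarith [H h h.2 _ hM]
    · have hh := h.2
      rw [if_neg (by have := h.2; omega), neg_zero]
      refine Finset.sum_eq_zero fun m hm => ?_
      rw [Finset.mem_range] at hm
      rw [show m - h = 0 by omega, hV]; ring
  · intro H h hh M hM
    have hw := congrFun₂ (H (M / n)) ⟨h, hh⟩ ⟨M % n, Nat.mod_lt _ (by omega)⟩
    rw [sum_levelMatrix S hV, key] at hw
    simp only [Nat.mod_add_div'] at hw
    linarith

/-- The sign of a half-edge of a vertex. -/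
def halfEdgeSign (X Y : List (ZMod N)) (h : ℕ) : ℤ :=
  (if Y.length ≤ h then -1 else 1) * koszul ((Y ++ X.reverse).getD h 0)

/-- The parity of the spiral count records only whether its ends lie on different sides. The sign
therefore splits into one factor for each end, which turns the quadratic relation into a matrix
product. -/
theorem koszul_degree_vertex (hN : Even N) {k : ℕ} {A X Y B : List (ZMod N)}
    (hk : D[k]? = some ⟨A, .vertex X Y, B⟩) (h : Fin (Y.length + X.length)) (j : ℕ+) :
    koszul ((Gen.vertex k A X Y B hk h j).degree - 1) =
      halfEdgeSign X Y h * halfEdgeSign X Y ((h + j) % (Y.length + X.length)) := by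
  have hp : ∀ h : Fin (Y.length + X.length),
      halfEdgePotential X Y h = (Y ++ X.reverse).getD h 0 := by
    intro h
    rw [halfEdgePotential, List.get_eq_getElem, List.getD_eq_getElem?_getD,
      List.getElem?_eq_getElem, Option.getD_some]
    rfl
  obtain ⟨κ, W, h1, h2, h3⟩ := exists_spiralCrossings X.length Y.length h j h.2
  have hκ : ((h : ℕ) + j) % (Y.length + X.length) = κ := by
    rw [h2, Nat.add_mul_mod_self_right, Nat.mod_eq_of_lt h1]
  have hr : ((rotate h j : Fin _) : ℕ) = κ := by rw [← hκ]; rfl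
  simp only [Gen.degree, hp, hr, hκ]
  rw [show ∀ a b c : ZMod N, a - b + (c - 1) - 1 = a - b + (c - 1 - 1) by intros; ring,
    koszul_add hN, koszul_sub hN, koszul_sub hN, koszul_sub hN, koszul_one hN, koszul_natCast hN,
    halfEdgeSign, halfEdgeSign]
  have : ((-1 : ℤ)) ^ spiralCrossings X.length Y.length h j =
      (if Y.length ≤ (h : ℕ) then -1 else 1) * if Y.length ≤ κ then -1 else 1 := by
    have e := congrArg (fun m => (-1 : ℤ) ^ m) h3
    simp only [pow_add, pow_mul] at e
    split_ifs at e ⊢ <;> simp at e ⊢ <;> linarith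
  rw [this]; ring

/-- The value of the differential of a vertex generator. -/
theorem lift_dGen_vertex (hN : Even N) (φ : Gen D → ℤ) {k : ℕ} {A X Y B : List (ZMod N)}
    (hk : D[k]? = some ⟨A, .vertex X Y, B⟩) (h : Fin (Y.length + X.length)) (j : ℕ+) :
    FreeAlgebra.lift ℤ φ (dGen (.vertex k A X Y B hk h j)) =
      (if (h : ℕ) + j = h + (Y.length + X.length) then 1 else 0) +
        ∑ m ∈ Finset.range (h + j), halfEdgeSign X Y h *
          halfEdgeSign X Y (m % (Y.length + X.length)) * vertexVal φ hk h (m - h) *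
          vertexVal φ hk (m % (Y.length + X.length)) (h + j - m) := by
  have h0 : ∀ h, vertexVal φ hk h 0 = 0 := fun h => by simp [vertexVal]
  rw [dGen, map_add, map_sum, Finset.sum_range_add]
  congr 1
  · simp only [add_right_inj]
    split_ifs <;> simp
  -- Terms with `m ≤ h` would involve a generator of index `0`, to which `vertexVal` assigns the
  -- value zero.
  have hz : ∑ m ∈ Finset.range (h : ℕ), halfEdgeSign X Y h *
      halfEdgeSign X Y (m % (Y.length + X.length)) * vertexVal φ hk h (m - h) *
      vertexVal φ hk (m % (Y.length + X.length)) (h + j - m) = 0 :=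
    Finset.sum_eq_zero fun m hm => by
      rw [Finset.mem_range] at hm
      rw [show m - (h : ℕ) = 0 by omega, h0]; ring
  rw [hz, zero_add]
  have hq : ∀ q ∈ Finset.Iio j, FreeAlgebra.lift ℤ φ
      (koszul ((Gen.vertex k A X Y B hk h q).degree - 1) •
        (FreeAlgebra.ι ℤ (Gen.vertex k A X Y B hk h q) *
          FreeAlgebra.ι ℤ (Gen.vertex k A X Y B hk (rotate h q) (j - q)))) =
      halfEdgeSign X Y h * halfEdgeSign X Y ((h + q) % (Y.length + X.length)) *
        vertexVal φ hk h (h + q - h) *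
        vertexVal φ hk ((h + q) % (Y.length + X.length)) (h + j - (h + q)) := by
    intro q hq
    have hlt : (q : ℕ) < j := PNat.coe_lt_coe _ _ |>.2 (Finset.mem_Iio.1 hq)
    rw [map_smul, map_mul, FreeAlgebra.lift_ι_apply, FreeAlgebra.lift_ι_apply,
      koszul_degree_vertex hN, smul_eq_mul, Nat.add_sub_cancel_left, Nat.add_sub_add_left, mul_assoc,
      mul_assoc, mul_assoc]
    have e1 : vertexVal φ hk h q = φ (.vertex k A X Y B hk h q) := by
      rw [vertexVal, dif_pos ⟨h.2, q.2⟩]; rfl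
    have e2 : vertexVal φ hk ((h + q) % (Y.length + X.length)) (j - q) =
        φ (.vertex k A X Y B hk (rotate h q) (j - q)) := by
      rw [vertexVal, dif_pos ⟨(rotate h q).2, by omega⟩]
      congr 2
      exact PNat.eq (by rw [PNat.sub_coe, if_pos (Finset.mem_Iio.1 hq)]; rfl)
    rw [e1, e2]
  rw [Finset.sum_congr rfl hq]
  symm
  refine Finset.sum_bij_ne_zero (fun q _ hq => ⟨q, Nat.pos_of_ne_zero ?_⟩) ?_ ?_ ?_ ?_
  · rintro rfl
    exact hq (by simp [h0])
  · intro q hq hq'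
    rw [Finset.mem_range] at hq
    exact Finset.mem_Iio.2 (PNat.coe_lt_coe _ _ |>.1 hq)
  · intro q _ _ q' _ _ e
    exact congrArg PNat.val e
  · intro q hq hq'
    exact ⟨q, Finset.mem_range.2 (PNat.coe_lt_coe _ _ |>.2 (Finset.mem_Iio.1 hq)), hq', rfl⟩
  · intro q _ _
    rfl

theorem levelMatrix_zero_one {n : ℕ} {S : ℕ → ℤ} {V : ℕ → ℕ → ℤ}
    (h : ∀ w, ∑ u ∈ Finset.range (w + 1), levelMatrix n S V u * levelMatrix n S V (w - u) =
      if w = 1 then -1 else 0) :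
    levelMatrix n S V 0 * levelMatrix n S V 0 = 0 ∧
    levelMatrix n S V 0 * levelMatrix n S V 1 + levelMatrix n S V 1 * levelMatrix n S V 0 = -1 := by
  constructor
  · simpa using h 0
  · simpa [Finset.sum_range_succ] using h 1

/-- The half-edges of a vertex, sorted into those on the right and those on the left. -/
def halfEdgeIndex (b a : ℕ) : Fin b ⊕ Fin a → Fin (b + a)
  | .inl i => ⟨i, by omega⟩
  | .inr x => ⟨b + a - 1 - x, by omega⟩

theorem halfEdgeIndex_bijective (b a : ℕ) : Function.Bijective (halfEdgeIndex b a) := by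
  refine (Fintype.bijective_iff_injective_and_card _).2 ⟨?_, by simp⟩
  rintro (i | i) (j | j) h <;> simp only [halfEdgeIndex, Fin.mk.injEq] at h
  · rw [Fin.ext h]
  · omega
  · omega
  · rw [show i = j from Fin.ext (by omega)]

/-! ### Acyclicity across a vertex. -/

namespace Layout

theorem halfEdgeSign_right (L : Layout D) {k : ℕ} {A X Y B : List (ZMod N)}
    (hk : D[k]? = some ⟨A, .vertex X Y, B⟩) {i : ℕ} (hi : i < Y.length) :
    halfEdgeSign X Y i = L.sgn (k + 1) (A.length + i) := by
  rw [halfEdgeSign, if_neg (by omega), one_mul, sgn]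
  congr 1
  simp [potAt, L.vertex hk, List.getD_eq_getElem?_getD, List.getElem?_append, hi]

theorem halfEdgeSign_left (L : Layout D) {k : ℕ} {A X Y B : List (ZMod N)}
    (hk : D[k]? = some ⟨A, .vertex X Y, B⟩) {x : ℕ} (hx : x < X.length) :
    halfEdgeSign X Y (Y.length + X.length - 1 - x) = - L.sgn k (A.length + x) := by
  rw [halfEdgeSign, if_pos (by omega), neg_one_mul, sgn]
  congr 2
  simp only [potAt, (L.vertex hk).1, List.getD_eq_getElem?_getD, List.append_assoc]
  rw [List.getElem?_append_right (by omega), List.getElem?_append_right (by omega),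
    List.getElem?_append_left (by omega), List.getElem?_reverse (by omega)]
  congr 2; omega

/-- Let `U₀` and `U₁` be the matrices of winding number zero and one, sorted into right and left
edges. The diagonal blocks of `U₀` are, up to signs, the differentials on the right and left edges,
its remaining nonzero block is a chain map `F` between them, and `-U₁` contracts `U₀`. The blocks of
`U₁` thus provide a homotopy inverse `G` of `F` and the homotopies `H`, `K` for `replaceBlock`; the
fans with wrapping corners are exactly the products that occur there. -/
theorem isAcyclic_vertex (L : Layout D) (φ : Gen D → ℤ) {k : ℕ}
    {A X Y B : List (ZMod N)} (hk : D[k]? = some ⟨A, .vertex X Y, B⟩)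
    (hV : ∀ w, ∑ u ∈ Finset.range (w + 1),
      levelMatrix (Y.length + X.length) (halfEdgeSign X Y) (vertexVal φ hk) u *
        levelMatrix (Y.length + X.length) (halfEdgeSign X Y) (vertexVal φ hk) (w - u) =
      if w = 1 then -1 else 0)
    (h : IsAcyclic (L.diff φ k)) : IsAcyclic (L.diff φ (k + 1)) := by
  have hn : (L.pot k).length = A.length + X.length + B.length := by
    rw [(L.vertex hk).1]; simp [add_assoc]
  have hn' : (L.pot (k + 1)).length = A.length + Y.length + B.length := by
    rw [(L.vertex hk).2.2.1]; simp [add_assoc]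
  have hord := (L.vertex hk).2.1
  have hid' := (L.vertex hk).2.2.2
  have hlen := (lt_length_of_getElem? hk).le
  have sY : ∀ i : Fin Y.length, halfEdgeSign X Y i = L.sgn (k + 1) (A.length + i) :=
    fun i => L.halfEdgeSign_right hk i.2
  have sX : ∀ x : Fin X.length, halfEdgeSign X Y (Y.length + X.length - 1 - x) =
    - L.sgn k (A.length + x) := fun x => L.halfEdgeSign_left hk x.2
  have hV0 : ∀ h, vertexVal φ hk h 0 = 0 := fun h => by simp [vertexVal]
  have hpass : ∀ {l r}, Passes ⟨A, .vertex X Y, B⟩ l r → L.sgn (k + 1) r = L.sgn k l :=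
    fun h => L.sgn_pass hk h
  have hYY := fun {i i' : ℕ} => L.left_vertex_YY φ hk (i := i) (i' := i')
  have hYQ := fun {i m : ℕ} => L.left_vertex_YQ φ hk (i := i) (m := m)
  have hPY := fun {s i : ℕ} => L.left_vertex_PY φ hk (s := s) (i := i)
  have hPQ := fun {s m : ℕ} => L.left_vertex_PQ φ hk (s := s) (m := m)
  have hXX := fun {i i' : ℕ} => L.right_vertex φ hk (i := i) (i' := i')
  have hsame := fun {l r l' r' : ℕ} => L.left_vertex_pass φ hk (l := l) (r := r) (l' := l')
    (r' := r')
  set V := vertexVal φ hk with hVdef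
  set S := halfEdgeSign X Y with hS
  have hlow' : ∀ {i j}, j < i → L.coeff φ (k + 1) i j = 0 := fun {i j} h =>
    L.coeff_gt_of_ord φ h (by simpa [hid'] using h)
  have hlow : ∀ {i j}, j < i → ¬ (A.length ≤ j ∧ i < A.length + X.length) →
      L.coeff φ k i j = 0 := fun {i j} h h' =>
    L.coeff_gt_of_ord φ h (by rw [hord]; unfold revBlock; split_ifs <;> omega)
  obtain ⟨q0, q1⟩ := levelMatrix_zero_one hV
  let e := Equiv.ofBijective _ (halfEdgeIndex_bijective Y.length X.length)
  obtain ⟨U₀, hU₀⟩ : ∃ U, U = (levelMatrix (Y.length + X.length) S V 0).submatrix e e := ⟨_, rfl⟩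
  obtain ⟨U₁, hU₁⟩ : ∃ U, U = (levelMatrix (Y.length + X.length) S V 1).submatrix e e := ⟨_, rfl⟩
  have hUU : U₀ * U₀ = 0 := by
    rw [hU₀, Matrix.submatrix_mul_equiv, q0]; rfl
  have hUV : U₀ * U₁ + U₁ * U₀ = -1 := by
    rw [hU₀, hU₁, Matrix.submatrix_mul_equiv, Matrix.submatrix_mul_equiv,
      ← Matrix.submatrix_one_equiv e]
    exact congrArg (fun M => M.submatrix e e) q1
  -- A corner that starts at a left edge reaches a right edge only after passing half-edge `0`, that
  -- is, with winding number at least one.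
  have hR0 : U₀.toBlocks₂₁ = 0 := by
    ext x i
    simp only [hU₀, Matrix.toBlocks₂₁, Matrix.of_apply, Matrix.submatrix_apply, levelMatrix, e,
      Equiv.ofBijective_apply, halfEdgeIndex, Matrix.zero_apply]
    rw [show (i : ℕ) + 0 * (Y.length + X.length) - (Y.length + X.length - 1 - x) = 0 by omega,
      hV0, mul_zero]
  rw [← Matrix.fromBlocks_toBlocks U₀, hR0, Matrix.fromBlocks_multiply,
    ← Matrix.fromBlocks_zero, Matrix.fromBlocks_inj] at hUU
  rw [← Matrix.fromBlocks_toBlocks U₀, ← Matrix.fromBlocks_toBlocks U₁, hR0,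
    Matrix.fromBlocks_multiply, Matrix.fromBlocks_multiply, Matrix.fromBlocks_add,
    ← Matrix.fromBlocks_one, Matrix.fromBlocks_neg, Matrix.fromBlocks_inj] at hUV
  simp only [Matrix.mul_zero, Matrix.zero_mul, add_zero, zero_add] at hUU hUV
  obtain ⟨a1, a2, -, a4⟩ := hUU
  obtain ⟨b1, -, b3, b4⟩ := hUV
  let σ : Matrix (Fin X.length) (Fin X.length) ℤ :=
    Matrix.diagonal fun x => L.sgn k (A.length + x)
  have hσ : σ * σ = 1 := by
    rw [Matrix.diagonal_mul_diagonal, ← Matrix.diagonal_one]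
    congr 1; ext x; exact L.sgn_mul_self _ _
  have rσ : ∀ {n : Type} (Z : Matrix (Fin X.length) n ℤ), σ * (σ * Z) = Z := fun Z => by
    rw [← Matrix.mul_assoc, hσ, Matrix.one_mul]
  rw [diff, isAcyclic_strandMatrix_block _ A.length X.length B.length hn] at h
  rw [diff, isAcyclic_strandMatrix_block _ A.length Y.length B.length hn']
  rw [← Matrix.fromBlocks_toBlocks (Matrix.of fun i j => L.coeff φ k _ _)] at h
  -- The left edges are mutually inverted, so only right halves contribute to this block, and these
  -- are the fans of `right_vertex`.
  have hblock : (Matrix.of fun i j => L.coeff φ k (blockPos A.length X.length B.length i)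
      (blockPos A.length X.length B.length j)).toBlocks₂₂ = -(σ * U₀.toBlocks₂₂ * σ) := by
    ext x y
    simp only [Matrix.toBlocks₂₂, Matrix.of_apply, blockPos, σ, Matrix.neg_apply,
      Matrix.mul_diagonal, Matrix.diagonal_mul, hU₀, Matrix.submatrix_apply, levelMatrix, e,
      Equiv.ofBijective_apply, halfEdgeIndex, sX]
    have hs := L.sgn_mul_self k (A.length + x)
    rcases lt_trichotomy (x : ℕ) y with hxy | hxy | hxy
    · rw [L.coeff_lt_of_ord φ (by omega) hlen (by
        rw [hord]; unfold revBlock; split_ifs <;> omega),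
        show Y.length + X.length - 1 - (y : ℕ) + 0 * (Y.length + X.length) -
          (Y.length + X.length - 1 - x) = 0 by omega, hV0]
      ring
    · rw [hxy, coeff_self, zero_mul, add_zero, Nat.sub_self, hV0]
      ring
    · rw [L.coeff_gt φ (by omega), hXX hxy x.2,
        show Y.length + X.length - 1 - (y : ℕ) + 0 * (Y.length + X.length) -
          (Y.length + X.length - 1 - x) = x - y by omega]
      linear_combination (-(L.sgn k (A.length + y) *
        V (Y.length + X.length - 1 - x) (x - y))) * hs
  rw [hblock] at h
  have hF : ∀ (i : Fin Y.length) (y : Fin X.length), (U₀.toBlocks₁₂ * σ) i y =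
      L.sgn (k + 1) (A.length + i) * V i (Y.length - (i + 1) + (X.length - y)) *
        L.sgn k (A.length + y) := by
    intro i y
    simp only [Matrix.toBlocks₁₂, Matrix.of_apply, σ, Matrix.mul_diagonal, hU₀,
      Matrix.submatrix_apply, levelMatrix, e, Equiv.ofBijective_apply, halfEdgeIndex, sY]
    congr 3
    omega
  have hG : ∀ (x : Fin X.length) (i : Fin Y.length), (-(σ * U₁.toBlocks₂₁)) x i =
      V (Y.length + X.length - 1 - x) (x + (i + 1)) := by
    intro x i
    simp only [Matrix.toBlocks₂₁, Matrix.of_apply, σ, Matrix.diagonal_mul, hU₁, Matrix.neg_apply,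
      Matrix.submatrix_apply, levelMatrix, e, Equiv.ofBijective_apply, halfEdgeIndex, sX]
    rw [show (i : ℕ) + 1 * (Y.length + X.length) - (Y.length + X.length - 1 - x) =
      x + (i + 1) by omega]
    linear_combination (V (Y.length + X.length - 1 - x) (x + (i + 1))) *
      L.sgn_mul_self k (A.length + x)
  have hH : ∀ x y : Fin X.length, (-(σ * U₁.toBlocks₂₂ * σ)) x y =
      V (Y.length + X.length - 1 - x) (x + (Y.length + (X.length - y))) *
        L.sgn k (A.length + y) := by
    intro x y
    simp only [Matrix.toBlocks₂₂, Matrix.of_apply, σ, Matrix.diagonal_mul, hU₁, Matrix.neg_apply,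
      Matrix.mul_diagonal,
      Matrix.submatrix_apply, levelMatrix, e, Equiv.ofBijective_apply, halfEdgeIndex, sX]
    rw [show Y.length + X.length - 1 - (y : ℕ) + 1 * (Y.length + X.length) -
      (Y.length + X.length - 1 - x) = x + (Y.length + (X.length - y)) by omega]
    linear_combination (V (Y.length + X.length - 1 - x) (x + (Y.length + (X.length - y))) *
      L.sgn k (A.length + y)) * L.sgn_mul_self k (A.length + x)
  have h2 := h.replaceBlock (Y := Fin Y.length) (by
      ext i j
      rw [Matrix.mul_apply]
      refine Finset.sum_eq_zero fun o _ => ?_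
      rcases o with o | o
      · have : L.coeff φ k (A.length + i) o = 0 := hlow (by omega) (by omega)
        simp [Matrix.toBlocks₂₁, blockPos, this]
      · have : L.coeff φ k (A.length + X.length + o) (A.length + j) = 0 :=
          hlow (by omega) (by omega)
        simp [Matrix.toBlocks₁₂, blockPos, this])
    (G := -(σ * U₁.toBlocks₂₁)) (F := U₀.toBlocks₁₂ * σ) (H := -(σ * U₁.toBlocks₂₂ * σ))
    (K := U₁.toBlocks₁₁) (YY := U₀.toBlocks₁₁) a1
    (by
      simp only [Matrix.mul_neg, Matrix.mul_assoc, rσ]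
      rw [← Matrix.mul_assoc, ← Matrix.mul_assoc, eq_neg_of_add_eq_zero_left a2, Matrix.neg_mul])
    (by
      simp only [Matrix.mul_neg, Matrix.neg_mul, neg_neg, Matrix.mul_assoc, rσ]
      rw [eq_neg_of_add_eq_zero_left b3, Matrix.mul_neg])
    (by
      have e1 : U₁.toBlocks₂₁ * U₀.toBlocks₁₂ =
          -1 - U₀.toBlocks₂₂ * U₁.toBlocks₂₂ - U₁.toBlocks₂₂ * U₀.toBlocks₂₂ := by
        rw [← b4]; abel
      simp only [Matrix.mul_neg, Matrix.neg_mul, neg_neg, Matrix.mul_assoc, rσ]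
      rw [← Matrix.mul_assoc U₁.toBlocks₂₁, e1]
      simp only [Matrix.sub_mul, Matrix.mul_sub, Matrix.neg_mul, Matrix.mul_neg, Matrix.one_mul, hσ,
        Matrix.mul_assoc]
      abel)
    (by
      simp only [Matrix.mul_neg, Matrix.mul_assoc, rσ]
      have e1 : U₀.toBlocks₁₂ * U₁.toBlocks₂₁ =
          -1 - U₀.toBlocks₁₁ * U₁.toBlocks₁₁ - U₁.toBlocks₁₁ * U₀.toBlocks₁₁ := by
        rw [← b1]; abel
      rw [e1]; abel)
  convert h2 using 1
  ext i j
  have habove : ∀ i : Fin A.length, Passes ⟨A, .vertex X Y, B⟩ i i := fun i => .above i i.2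
  have hbelow : ∀ m : Fin B.length, Passes ⟨A, .vertex X Y, B⟩ (A.length + X.length + m)
    (A.length + Y.length + m) := fun m => .below m m.2
  have hcoeff : ∀ {l r l' r'}, Passes ⟨A, .vertex X Y, B⟩ l r →
      Passes ⟨A, .vertex X Y, B⟩ l' r' →
      (r < A.length ∧ r' < A.length ∨ A.length + Y.length ≤ r ∧ A.length ≤ r' ∨
        A.length ≤ r ∧ r' < A.length) →
      L.coeff φ (k + 1) r r' = L.coeff φ k l l' := by
    intro l r l' r' h1 h2 h3
    rcases lt_trichotomy r r' with hr | hr | hr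
    · rw [L.coeff_lt φ hr, L.coeff_lt φ (h1.left_right_lt h2 hr), hsame h1 h2 hr (by omega),
        hpass h1]
    · subst hr
      obtain rfl := h1.left_unique h2
      rw [coeff_self, coeff_self]
    · rw [hlow' hr, hlow (h2.left_right_lt h1 hr)]
      rintro ⟨h3, h4⟩
      cases h1 <;> cases h2 <;> simp only [LagPoint.numIn, LagPoint.numOut] at * <;> omega
  rcases i with (i | i) | i <;> rcases j with (j | j) | j <;>
    simp only [Matrix.of_apply, Matrix.fromBlocks_apply₁₁, Matrix.fromBlocks_apply₁₂,
      Matrix.fromBlocks_apply₂₁, Matrix.fromBlocks_apply₂₂, Matrix.add_apply]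
  · rw [Matrix.mul_apply, Finset.sum_eq_zero, add_zero]
    · have := hcoeff (habove i) (habove j) (by omega)
      exact this
    · intro y _
      have : L.coeff φ k (A.length + y) j = 0 := hlow (by omega) (by omega)
      simp [Matrix.toBlocks₂₁, blockPos, this]
  · rw [Matrix.mul_assoc]
    simp only [Matrix.toBlocks₁₁, Matrix.toBlocks₁₂, Matrix.toBlocks₂₁, Matrix.of_apply, blockPos]
    simp only [Matrix.mul_apply, hH, Matrix.of_apply]
    rw [L.coeff_lt φ (by omega), hPQ i.2 j.2, hpass (habove i), L.coeff_lt φ (by omega), mul_add,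
      Finset.mul_sum]
    congr 1
    refine Finset.sum_congr rfl fun x _ => ?_
    rw [Finset.mul_sum, Finset.mul_sum]
    refine Finset.sum_congr rfl fun y _ => ?_
    rw [L.coeff_lt φ (by omega), L.coeff_lt φ (by omega)]
    linear_combination (-(L.sgn k i * halfSum φ .left k i (A.length + x) *
      V (Y.length + X.length - 1 - x) (x + (Y.length + (X.length - y))) *
      halfSum φ .left k (A.length + y) (A.length + X.length + j))) * L.sgn_mul_self k (A.length + y)
  · simp only [Matrix.mul_apply, hG, Matrix.toBlocks₁₂, Matrix.of_apply, blockPos]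
    rw [L.coeff_lt φ (by omega), hPY i.2 j.2, hpass (habove i), Finset.mul_sum]
    refine Finset.sum_congr rfl fun x _ => ?_
    rw [L.coeff_lt φ (by omega), mul_assoc]
  · rw [Matrix.mul_apply, Finset.sum_eq_zero, add_zero]
    · have := hcoeff (hbelow i) (habove j) (by omega)
      exact this
    · intro y _
      have : L.coeff φ k (A.length + y) j = 0 := hlow (by omega) (by omega)
      simp [Matrix.toBlocks₂₁, blockPos, this]
  · rw [Matrix.mul_assoc, Matrix.mul_apply, Finset.sum_eq_zero, add_zero]
    · have := hcoeff (hbelow i) (hbelow j) (by omega)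
      exact this
    · intro y _
      have : L.coeff φ k (A.length + X.length + i) (A.length + y) = 0 := hlow (by omega) (by omega)
      simp [Matrix.toBlocks₁₂, blockPos, this]
  · rw [Matrix.mul_apply, Finset.sum_eq_zero]
    · exact hlow' (by simp only [blockPos]; omega)
    · intro y _
      have : L.coeff φ k (A.length + X.length + i) (A.length + y) = 0 := hlow (by omega) (by omega)
      simp [Matrix.toBlocks₁₂, blockPos, this]
  · rw [Matrix.mul_apply, Finset.sum_eq_zero]
    · exact hlow' (by simp only [blockPos]; omega)
    · intro y _
      have : L.coeff φ k (A.length + y) j = 0 := hlow (by omega) (by omega)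
      simp [Matrix.toBlocks₂₁, blockPos, this]
  · rw [Matrix.mul_apply]
    simp only [hF, Matrix.toBlocks₂₁, Matrix.of_apply, blockPos]
    rw [L.coeff_lt φ (by omega), hYQ i.2 j.2, Finset.mul_sum]
    refine Finset.sum_congr rfl fun y _ => ?_
    rw [L.coeff_lt φ (by omega)]
    linear_combination (-(L.sgn (k + 1) (A.length + i) *
      V i (Y.length - (i + 1) + (X.length - y)) *
      halfSum φ .left k (A.length + y) (A.length + X.length + j))) * L.sgn_mul_self k (A.length + y)
  · simp only [Matrix.toBlocks₁₁, Matrix.of_apply, blockPos, hU₀, Matrix.submatrix_apply,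
      levelMatrix, e, Equiv.ofBijective_apply, halfEdgeIndex, sY, zero_mul, add_zero]
    rcases lt_or_ge (i : ℕ) j with hij | hij
    · rw [L.coeff_lt φ (by omega), hYY hij j.2]
    · rw [Nat.sub_eq_zero_of_le hij, hV0, mul_zero]
      rcases hij.lt_or_eq with hij | hij
      · exact hlow' (by omega)
      · rw [hij, coeff_self]

end Layout

/-! ### Augmentations as solutions of the equations on the generators -/

theorem d_mul_eq (a b : Alg D) :
    d D (a * b) = dMatrix D a 0 0 * d D b + d D a * b := by
  change dMatrix D (a * b) 0 1 = _ * dMatrix D b 0 1 + dMatrix D a 0 1 * _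
  rw [map_mul, Matrix.mul_apply, Fin.sum_univ_two, (dMatrix_diag D b).2]

/-- By the Leibniz rule each term of the differential of a product contains the differential of a
factor, so the condition on generators suffices. -/
theorem map_d_eq_zero (ψ : Alg D →ₐ[ℤ] ℤ) (h : ∀ g, ψ (dGen g) = 0) (a : Alg D) :
    ψ (d D a) = 0 := by
  induction a using FreeAlgebra.induction with
  | grade0 r =>
    change ψ (dMatrix D _ 0 1) = 0
    rw [AlgHom.commutes]; simp [Matrix.algebraMap_matrix_apply]
  | grade1 g => rw [d_ι, h]
  | mul a b ha hb => rw [d_mul_eq, map_add, map_mul, map_mul, ha, hb]; simp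
  | add a b ha hb => rw [map_add, map_add, ha, hb, add_zero]

/-- An assignment of integers to the generators which extends to a `ρ`-graded augmentation. -/
structure IsSolution (ρ : ℤ) (φ : Gen D → ℤ) : Prop where
  lift_dGen : ∀ g, FreeAlgebra.lift ℤ φ (dGen g) = 0
  graded : ∀ g : Gen D, ¬ ((ρ : ZMod N) ∣ g.degree) → φ g = 0

theorem nonempty_augmentation_iff (ρ : ℤ) :
    Nonempty (Augmentation D ρ) ↔ ∃ φ : Gen D → ℤ, IsSolution ρ φ := by
  constructor
  · rintro ⟨ε⟩
    refine ⟨fun g => ε.toAlgHom (FreeAlgebra.ι ℤ g), fun g => ?_, ε.graded⟩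
    have : FreeAlgebra.lift ℤ (fun g => ε.toAlgHom (FreeAlgebra.ι ℤ g)) = ε.toAlgHom :=
      FreeAlgebra.hom_ext (by ext g; simp)
    rw [this, ← d_ι, ε.map_d]
  · rintro ⟨φ, h1, h2⟩
    exact ⟨⟨FreeAlgebra.lift ℤ φ, map_d_eq_zero _ h1, fun g hg => by
      rw [FreeAlgebra.lift_ι_apply, h2 g hg]⟩⟩

/-- The value of the differential of a crossing. -/
theorem Layout.lift_dGen_crossing (L : Layout D) (φ : Gen D → ℤ) {k : ℕ} {A B : List (ZMod N)}
    {x y : ZMod N} (hk : D[k]? = some ⟨A, .crossing x y, B⟩) :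
    FreeAlgebra.lift ℤ φ (dGen (.crossing k A x y B hk)) =
      halfSum φ .left k A.length (A.length + 1) +
        koszul (x - y - 1) * halfSum φ .right (k + 1) A.length (A.length + 1) := by
  have := L.finite_half
  have f1 := Fintype.ofFinite (Half D .left k A.length (A.length + 1))
  have f2 := Fintype.ofFinite (Half D .right (k + 1) A.length (A.length + 1))
  have hw : ∀ c : List (Corner D), FreeAlgebra.lift ℤ φ
      ((c.map fun c => c.sign • FreeAlgebra.ι ℤ c.gen).prod) = wt φ c := by
    intro c
    rw [map_list_prod, List.map_map, wt]
    congr 2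
    funext c
    simp
  rw [dGen, L.moduli_eq_univ hk, finsum_mem_univ, finsum_eq_sum_of_fintype, map_sum,
    Fintype.sum_sum_type, halfSum, halfSum, finsum_eq_sum_of_fintype, finsum_eq_sum_of_fintype,
    Finset.mul_sum]
  congr 1
  · refine Finset.sum_congr rfl fun f _ => ?_
    rw [map_smul, hw]
    exact one_smul _ _
  · refine Finset.sum_congr rfl fun f _ => ?_
    rw [map_smul, hw]
    rfl

/-- The empty complex on slice `0` is contractible, and passing any singular point preserves
contractibility. At a crossing and at a vertex this uses that `φ` solves the equations of its
generators. -/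
theorem Layout.isAcyclic_diff (hN : Even N) (L : Layout D) (h0 : L.pot 0 = []) {φ : Gen D → ℤ}
    (h : ∀ g, FreeAlgebra.lift ℤ φ (dGen g) = 0) (s : ℕ) (hs : s ≤ D.length) :
    IsAcyclic (L.diff φ s) := by
  induction s with
  | zero =>
    have : IsEmpty (Fin (L.pot 0).length) := by rw [h0]; exact Fin.isEmpty
    exact ⟨Subsingleton.elim _ _, 0, Subsingleton.elim _ _⟩
  | succ k ih =>
    have ih := ih (by omega)
    obtain ⟨⟨A, pt, B⟩, hk⟩ : ∃ e, D[k]? = some e := ⟨_, List.getElem?_eq_getElem (by omega)⟩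
    cases pt with
    | crossing x y =>
      exact L.isAcyclic_crossing hN φ hk (by rw [← L.lift_dGen_crossing φ hk]; exact h _) ih
    | cup x => exact L.isAcyclic_cup hN φ hk ih
    | cap x => exact L.isAcyclic_cap hN φ hk ih
    | vertex X Y =>
      refine L.isAcyclic_vertex φ hk ((levelMatrix_iff _ fun h => by simp [vertexVal]).1 ?_) ih
      intro i hi M hM
      have := (lift_dGen_vertex hN φ hk ⟨i, hi⟩ ⟨M - i, by omega⟩).symm.trans (h _)
      simpa only [PNat.mk_coe, Nat.add_sub_cancel' hM.le] using this

/-! ### Initial parts of a Lagrangian projection -/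

theorem getElem?_append_of_some {α : Type*} {D E : List α} {k : ℕ} {e : α} (h : D[k]? = some e) :
    (D ++ E)[k]? = some e := by
  rw [List.getElem?_append_left (lt_length_of_getElem? h), h]

/-- The generators of an initial part. -/
def Gen.extend (E : List (LagSlab N)) : Gen D → Gen (D ++ E)
  | .crossing k A x y B hk => .crossing k A x y B (getElem?_append_of_some hk)
  | .vertex k A X Y B hk h j => .vertex k A X Y B (getElem?_append_of_some hk) h j

theorem Gen.extend_injective (E : List (LagSlab N)) :
    Function.Injective (Gen.extend E : Gen D → Gen (D ++ E)) := by
  intro g g' h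
  cases g <;> cases g' <;> simp only [Gen.extend] at h <;> cases h <;> rfl

theorem Gen.degree_extend (E : List (LagSlab N)) (g : Gen D) :
    (g.extend E).degree = g.degree := by cases g <;> rfl

/-- The corners of an initial part. -/
def Corner.extend (E : List (LagSlab N)) (c : Corner D) : Corner (D ++ E) := ⟨c.gen.extend E, c.sign⟩

theorem Corner.extend_injective (E : List (LagSlab N)) :
    Function.Injective (Corner.extend E : Corner D → Corner (D ++ E)) := by
  rintro ⟨g, s⟩ ⟨g', s'⟩ h
  simp only [Corner.extend, Corner.mk.injEq] at h
  rw [Gen.extend_injective E h.1, h.2]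

/-- The boundaries of pieces of an initial part. -/
def extendSide (E : List (LagSlab N)) (gc : Gate × List (Corner D)) :
    Gate × List (Corner (D ++ E)) := (gc.1, gc.2.map (Corner.extend E))

theorem extendSide_injective (E : List (LagSlab N)) :
    Function.Injective (extendSide E : Gate × List (Corner D) → _) := by
  rintro ⟨g, c⟩ ⟨g', c'⟩ h
  simp only [extendSide, Prod.mk.injEq] at h
  rw [h.1, (Corner.extend_injective E).list_map h.2]

section

variable {E : List (LagSlab N)} {k : ℕ}

theorem getElem?_of_append (hk : k < D.length) {e : LagSlab N} (h : (D ++ E)[k]? = some e) :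
    D[k]? = some e := by rwa [List.getElem?_append_left hk] at h

theorem UpperArc.extend {l r : ℕ} {c : List (Corner D)} (h : UpperArc D k l r c) :
    UpperArc (D ++ E) k l r (c.map (Corner.extend E)) := by
  rcases h with ⟨e, hk, _, _, h⟩ | ⟨A, x, y, B, hk⟩ | ⟨A, x, y, B, hk⟩ | ⟨A, x, y, B, hk⟩
  · exact .pass e (getElem?_append_of_some hk) l r h
  · exact .over A x y B (getElem?_append_of_some hk)
  · exact .under A x y B (getElem?_append_of_some hk)
  · exact .corner A x y B (getElem?_append_of_some hk)

theorem LowerArc.extend {l r : ℕ} {c : List (Corner D)} (h : LowerArc D k l r c) :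
    LowerArc (D ++ E) k l r (c.map (Corner.extend E)) := by
  rcases h with ⟨e, hk, _, _, h⟩ | ⟨A, x, y, B, hk⟩ | ⟨A, x, y, B, hk⟩ | ⟨A, x, y, B, hk⟩
  · exact .pass e (getElem?_append_of_some hk) l r h
  · exact .over A x y B (getElem?_append_of_some hk)
  · exact .under A x y B (getElem?_append_of_some hk)
  · exact .corner A x y B (getElem?_append_of_some hk)

theorem BasePiece.extend {bd : List (Gate × List (Corner D))} (h : BasePiece D k bd) :
    BasePiece (D ++ E) k (bd.map (extendSide E)) := by
  cases h with
  | strip tl tr bl br ct cb ht hb hl hr => exact .strip tl tr bl br _ _ ht.extend hb.extend hl hr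
  | cupInner A x B hk => exact .cupInner A x B (getElem?_append_of_some hk)
  | cupOuter A x B hk t m ht hm => exact .cupOuter A x B (getElem?_append_of_some hk) t m ht hm
  | capInner A x B hk => exact .capInner A x B (getElem?_append_of_some hk)
  | capOuter A x B hk t m ht hm => exact .capOuter A x B (getElem?_append_of_some hk) t m ht hm
  | fan A X Y B hk h j g gs hs =>
    have := BasePiece.fan A X Y B (getElem?_append_of_some (E := E) hk) h j g gs hs
    rw [List.map_cons, List.map_map]
    exact this

theorem UpperArc.exists_extend (hk' : k < D.length) {l r : ℕ} {c : List (Corner (D ++ E))}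
    (h : UpperArc (D ++ E) k l r c) : ∃ c', UpperArc D k l r c' ∧ c = c'.map (Corner.extend E) := by
  rcases h with ⟨e, hk, _, _, h⟩ | ⟨A, x, y, B, hk⟩ | ⟨A, x, y, B, hk⟩ | ⟨A, x, y, B, hk⟩
  · exact ⟨_, .pass e (getElem?_of_append hk' hk) l r h, rfl⟩
  · exact ⟨_, .over A x y B (getElem?_of_append hk' hk), rfl⟩
  · exact ⟨_, .under A x y B (getElem?_of_append hk' hk), rfl⟩
  · exact ⟨_, .corner A x y B (getElem?_of_append hk' hk), rfl⟩

theorem LowerArc.exists_extend (hk' : k < D.length) {l r : ℕ} {c : List (Corner (D ++ E))}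
    (h : LowerArc (D ++ E) k l r c) : ∃ c', LowerArc D k l r c' ∧ c = c'.map (Corner.extend E) := by
  rcases h with ⟨e, hk, _, _, h⟩ | ⟨A, x, y, B, hk⟩ | ⟨A, x, y, B, hk⟩ | ⟨A, x, y, B, hk⟩
  · exact ⟨_, .pass e (getElem?_of_append hk' hk) l r h, rfl⟩
  · exact ⟨_, .over A x y B (getElem?_of_append hk' hk), rfl⟩
  · exact ⟨_, .under A x y B (getElem?_of_append hk' hk), rfl⟩
  · exact ⟨_, .corner A x y B (getElem?_of_append hk' hk), rfl⟩

theorem BasePiece.exists_extend (hk' : k < D.length) {bd : List (Gate × List (Corner (D ++ E)))}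
    (h : BasePiece (D ++ E) k bd) : ∃ bd', BasePiece D k bd' ∧ bd = bd'.map (extendSide E) := by
  cases h with
  | strip tl tr bl br ct cb ht hb hl hr =>
    obtain ⟨_, ht', rfl⟩ := ht.exists_extend hk'
    obtain ⟨_, hb', rfl⟩ := hb.exists_extend hk'
    exact ⟨_, .strip tl tr bl br _ _ ht' hb' hl hr, rfl⟩
  | cupInner A x B hk => exact ⟨_, .cupInner A x B (getElem?_of_append hk' hk), rfl⟩
  | cupOuter A x B hk t m ht hm =>
    exact ⟨_, .cupOuter A x B (getElem?_of_append hk' hk) t m ht hm, rfl⟩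
  | capInner A x B hk => exact ⟨_, .capInner A x B (getElem?_of_append hk' hk), rfl⟩
  | capOuter A x B hk t m ht hm =>
    exact ⟨_, .capOuter A x B (getElem?_of_append hk' hk) t m ht hm, rfl⟩
  | fan A X Y B hk h j g gs hs =>
    refine ⟨_, BasePiece.fan A X Y B (getElem?_of_append hk' hk) h j g gs hs, ?_⟩
    rw [List.map_cons, List.map_map]
    rfl

theorem Piece.extend {bd : List (Gate × List (Corner D))} (h : Piece D k bd) :
    Piece (D ++ E) k (bd.map (extendSide E)) := by
  obtain ⟨bd₀, h1, h2⟩ := h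
  exact ⟨_, h1.extend, h2.map _⟩

theorem Piece.exists_extend (hk' : k < D.length) {bd : List (Gate × List (Corner (D ++ E)))}
    (h : Piece (D ++ E) k bd) : ∃ bd', Piece D k bd' ∧ bd = bd'.map (extendSide E) := by
  obtain ⟨bd₀, h1, n, h2⟩ := h
  obtain ⟨bd₁, h3, rfl⟩ := h1.exists_extend hk'
  exact ⟨bd₁.rotate n, ⟨bd₁, h3, n, rfl⟩, by rw [← h2, List.map_rotate]⟩

/-- The pieces of an initial part. -/
noncomputable def pieceEquiv (E : List (LagSlab N)) (hk : k < D.length) (g : Gate) :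
    PieceAt D k g ≃ PieceAt (D ++ E) k g :=
  Equiv.ofBijective
    (fun κ => ⟨(κ.1.1.map (Corner.extend E), κ.1.2.map (extendSide E)), κ.2.extend⟩) (by
      constructor
      · rintro ⟨⟨c, r⟩, h⟩ ⟨⟨c', r'⟩, h'⟩ e
        have e := Prod.mk.inj (congrArg Subtype.val e)
        simp only [Subtype.mk.injEq, Prod.mk.injEq]
        exact ⟨(Corner.extend_injective E).list_map e.1, (extendSide_injective E).list_map e.2⟩
      · rintro ⟨⟨c, r⟩, h⟩
        obtain ⟨bd, h1, h2⟩ := h.exists_extend hk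
        rcases bd with _ | ⟨⟨g', c'⟩, r'⟩
        · cases h2
        · simp only [List.map_cons, extendSide, List.cons.injEq, Prod.mk.injEq] at h2
          obtain ⟨⟨rfl, rfl⟩, rfl⟩ := h2
          exact ⟨⟨(c', r'), h1⟩, rfl⟩)

theorem wt_extend (φ : Gen (D ++ E) → ℤ) (c : List (Corner D)) :
    wt φ (c.map (Corner.extend E)) = wt (φ ∘ Gen.extend E) c := by
  rw [wt, wt, List.map_map]; rfl

theorem Layout.halfSum_eq_zero_of_energy (L : Layout D) (φ : Gen D → ℤ) {w : Wall} {s t b : ℕ}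
    (h : L.halfEnergy w s t b ≤ 0) : halfSum φ w s t b = 0 :=
  halfSum_eq_zero φ fun x => by
    have := L.one_le_halfEnergy x
    omega

/-- The energy between inverted strands depends on the length of the diagram, so it changes under
restriction to an initial part; only its sign, which decides whether halves can exist, is compared.
-/
theorem Layout.halfEnergy_init (L : Layout (D ++ E)) {w : Wall} {s t b : ℕ} (hs : s ≤ D.length) :
    L.init.halfEnergy w s t b ≤ 0 ↔ L.halfEnergy w s t b ≤ 0 := by
  have hpos : (0 : ℤ) < 4 ^ s := by positivity
  cases w <;> simp only [halfEnergy, energy, Layout.init, List.length_append] <;> split_ifs <;>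
    push_cast <;> omega

/-- If some gate has nonpositive energy, both products contain a vanishing factor. Otherwise all
energies are positive with sum below `n`, so the induction hypothesis applies to each factor. -/
theorem Layout.restSum_extend (L : Layout (D ++ E)) (φ : Gen (D ++ E) → ℤ) (hk : k < D.length)
    {n : ℕ} (ih : ∀ w s t b, s ≤ D.length → L.halfEnergy w s t b < n →
      halfSum φ w s t b = halfSum (φ ∘ Gen.extend E) w s t b)
    {g : Gate} {c : List (Corner D)} {rest : List (Gate × List (Corner D))}
    (h : Piece D k ((g, c) :: rest)) (hn : - L.gateEnergy k g < n + 1) :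
    restSum φ k (rest.map (extendSide E)) = restSum (φ ∘ Gen.extend E) k rest := by
  have he := L.piece_energy (gc := extendSide E (g, c)) (rest := rest.map (extendSide E)) h.extend
  rw [List.map_map] at he
  change (rest.map fun gc => L.gateEnergy k gc.1).sum + 1 ≤ - L.gateEnergy k g at he
  have hslice : ∀ g : Gate, g.slice k ≤ D.length := by
    rintro ⟨w, t, b⟩
    cases w <;> simp only [Gate.slice] <;> omega
  by_cases h0 : ∃ gc ∈ rest, L.gateEnergy k gc.1 ≤ 0
  · obtain ⟨gc, h1, h2⟩ := h0
    rw [restSum, restSum, List.prod_eq_zero, List.prod_eq_zero]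
    · refine List.mem_map.2 ⟨gc, h1, ?_⟩
      rw [gateSum, L.init.halfSum_eq_zero_of_energy _ ((L.halfEnergy_init (hslice _)).2 h2),
        zero_mul]
    · refine List.mem_map.2 ⟨extendSide E gc, List.mem_map_of_mem h1, ?_⟩
      have : gateSum φ k (extendSide E gc).1 = 0 := L.halfSum_eq_zero_of_energy φ h2
      rw [this, zero_mul]
  · push Not at h0
    rw [restSum, restSum, List.map_map]
    congr 1
    refine List.map_congr_left fun gc hgc => ?_
    have h4 := List.single_le_sum (l := rest.map fun gc => L.gateEnergy k gc.1) (by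
      simp only [List.mem_map]
      rintro _ ⟨gc', h, rfl⟩
      exact (h0 gc' h).le) _ (List.mem_map_of_mem (f := fun gc => L.gateEnergy k gc.1) hgc)
    change gateSum φ k gc.1 * wt φ (gc.2.map (Corner.extend E)) = _
    rw [wt_extend]
    congr 1
    exact ih _ _ _ _ (hslice _) (by
      change L.gateEnergy k gc.1 < n
      have h5 : L.gateEnergy k gc.1 ≤ (rest.map fun gc => L.gateEnergy k gc.1).sum := h4
      omega)

/-- The sums over halves do not depend on what follows a slice without inverted strands. -/
theorem Layout.halfSum_extend (L : Layout (D ++ E)) (hid : L.ord D.length = id)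
    (φ : Gen (D ++ E) → ℤ) (w : Wall) (s t b : ℕ) (hs : s ≤ D.length) :
    halfSum φ w s t b = halfSum (φ ∘ Gen.extend E) w s t b := by
  suffices ∀ n : ℕ, ∀ w s t b, s ≤ D.length → L.halfEnergy w s t b < n →
      halfSum φ w s t b = halfSum (φ ∘ Gen.extend E) w s t b from
    this ((L.halfEnergy w s t b).toNat + 1) w s t b hs (by push_cast; omega)
  intro n
  induction n with
  | zero =>
    intro w s t b hs h
    have h' : L.halfEnergy w s t b ≤ 0 := by push_cast at h; omega
    rw [L.halfSum_eq_zero_of_energy φ h', L.init.halfSum_eq_zero_of_energy _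
      ((L.halfEnergy_init hs).2 h')]
  | succ n ih =>
    intro w s t b hs h
    push_cast at h
    cases w with
    | left =>
      cases s with
      | zero => rw [halfSum_eq_zero _ (IsEmpty.false), halfSum_eq_zero _ (IsEmpty.false)]
      | succ k =>
        rw [L.halfSum_left, L.init.halfSum_left, ← finsum_comp_equiv (pieceEquiv E (by omega) _)]
        refine finsum_congr fun κ => ?_
        change wt φ (κ.1.1.map (Corner.extend E)) * restSum φ k (κ.1.2.map (extendSide E)) = _
        rw [wt_extend, L.restSum_extend φ (by omega) ih κ.2]
        simpa [gateEnergy, halfEnergy, Gate.slice] using h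
    | right =>
      -- On the last slice of the initial part a right half would lie entirely in `E`, but its gate
      -- would have to be between inverted strands.
      rcases hs.lt_or_eq with hs | rfl
      · rw [L.halfSum_right, L.init.halfSum_right, ← finsum_comp_equiv (pieceEquiv E hs _)]
        refine finsum_congr fun κ => ?_
        change wt φ (κ.1.1.map (Corner.extend E)) * restSum φ s (κ.1.2.map (extendSide E)) = _
        rw [wt_extend, L.restSum_extend φ hs ih κ.2]
        simpa [gateEnergy, halfEnergy, Gate.slice] using h
      · rcases lt_or_ge t b with htb | htb
        · rw [L.halfSum_right_eq_zero φ (by simpa [hid] using htb),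
            L.init.halfSum_right_eq_zero _ (by simpa [Layout.init, hid] using htb)]
        · rw [halfSum_of_le _ htb, halfSum_of_le _ htb]

/-- The equations of the generators of an initial part. -/
theorem Layout.lift_dGen_extend (hN : Even N) (L : Layout (D ++ E)) (hid : L.ord D.length = id)
    (φ : Gen (D ++ E) → ℤ) (g : Gen D) :
    FreeAlgebra.lift ℤ φ (dGen (g.extend E)) = FreeAlgebra.lift ℤ (φ ∘ Gen.extend E) (dGen g) := by
  rcases g with ⟨k, A, x, y, B, hk⟩ | ⟨k, A, X, Y, B, hk, h, j⟩
  · have := lt_length_of_getElem? hk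
    rw [Gen.extend, L.lift_dGen_crossing, L.init.lift_dGen_crossing,
      L.halfSum_extend hid φ _ _ _ _ (by omega), L.halfSum_extend hid φ _ _ _ _ (by omega)]
  · rw [Gen.extend, lift_dGen_vertex hN, lift_dGen_vertex hN]
    rfl

theorem IsSolution.restrict (hN : Even N) (L : Layout (D ++ E)) (hid : L.ord D.length = id)
    {ρ : ℤ} {φ : Gen (D ++ E) → ℤ} (h : IsSolution ρ φ) : IsSolution ρ (φ ∘ Gen.extend E) where
  lift_dGen g := by rw [← L.lift_dGen_extend hN hid, h.lift_dGen]
  graded g hg := h.graded _ (by rwa [Gen.degree_extend])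

end

/-! ### Graded contractions -/

/-- A nonzero weight uses only generators of degree divisible by `ρ`, and the degrees along the word
add up to the degree prescribed by the potentials at the gate. -/
theorem Layout.dvd_of_halfSum_ne_zero (L : Layout D) {ρ : ZMod N} {φ : Gen D → ℤ}
    (hφ : ∀ g : Gen D, ¬ ρ ∣ g.degree → φ g = 0) {w : Wall} {s t b : ℕ}
    (h : halfSum φ w s t b ≠ 0) : ρ ∣ L.halfDeg w s t b := by
  obtain ⟨x, hx⟩ : ∃ x : Half D w s t b, wt φ x.word ≠ 0 := by
    by_contra! hall
    exact h (by rw [halfSum, finsum_congr hall, finsum_zero])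
  rw [← L.half_deg x]
  refine List.dvd_sum ?_
  simp only [List.mem_map]
  rintro _ ⟨c, hc, rfl⟩
  by_contra hd
  refine hx (List.prod_eq_zero (List.mem_map.2 ⟨c, hc, ?_⟩))
  rw [hφ _ hd, mul_zero]

theorem exists_graded_contraction {n : ℕ} {U : Matrix (Fin n) (Fin n) ℤ} (hU : IsAcyclic U)
    (ν : ℕ → ZMod N) (ρ : ZMod N) (hg : ∀ i j, U i j ≠ 0 → ρ ∣ ν i - ν j - 1) :
    ∃ h : Matrix (Fin n) (Fin n) ℤ, h * h = 0 ∧ U * h + h * U = 1 ∧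
      ∀ i j, h i j ≠ 0 → ρ ∣ ν i - ν j + 1 := by
  classical
  obtain ⟨hUU, h, hh⟩ := hU
  -- Dropping the entries of wrong degree keeps a contraction, because `U` and the identity are
  -- homogeneous.
  let g : Matrix (Fin n) (Fin n) ℤ := Matrix.of fun i j => if ρ ∣ ν i - ν j + 1 then h i j else 0
  have hgg : ∀ i j, g i j ≠ 0 → ρ ∣ ν i - ν j + 1 := by
    intro i j hij
    by_contra hd
    exact hij (if_neg hd)
  have e1 : U * g + g * U = 1 := by
    ext i k
    by_cases hd : ρ ∣ ν i - ν k
    · rw [← hh, Matrix.add_apply, Matrix.add_apply, Matrix.mul_apply, Matrix.mul_apply,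
        Matrix.mul_apply, Matrix.mul_apply]
      congr 1
      · refine Finset.sum_congr rfl fun j _ => ?_
        by_cases hu : U i j = 0
        · rw [hu, zero_mul, zero_mul]
        · have := dvd_sub hd (hg i j hu)
          rw [show ν i - ν k - (ν i - ν j - 1) = ν j - ν k + 1 by ring] at this
          simp only [g, Matrix.of_apply, if_pos this]
      · refine Finset.sum_congr rfl fun j _ => ?_
        by_cases hu : U j k = 0
        · rw [hu, mul_zero, mul_zero]
        · have := dvd_sub hd (hg j k hu)
          rw [show ν i - ν k - (ν j - ν k - 1) = ν i - ν j + 1 by ring] at this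
          simp only [g, Matrix.of_apply, if_pos this]
    · rw [Matrix.one_apply_ne (by rintro rfl; simp at hd), Matrix.add_apply, Matrix.mul_apply,
        Matrix.mul_apply, Finset.sum_eq_zero, Finset.sum_eq_zero, add_zero]
      · intro j _
        by_contra hne
        have := dvd_add (hgg _ _ (left_ne_zero_of_mul hne)) (hg _ _ (right_ne_zero_of_mul hne))
        rw [show ν i - ν j + 1 + (ν j - ν k - 1) = ν i - ν k by ring] at this
        exact hd this
      · intro j _
        by_contra hne
        have := dvd_add (hg _ _ (left_ne_zero_of_mul hne)) (hgg _ _ (right_ne_zero_of_mul hne))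
        rw [show ν i - ν j - 1 + (ν j - ν k + 1) = ν i - ν k by ring] at this
        exact hd this
  have e2 : U * g = 1 - g * U := eq_sub_of_add_eq e1
  have e3 : g * U = 1 - U * g := eq_sub_of_add_eq' e1
  have e4 : U * g * U = U := by rw [e2, sub_mul, one_mul, mul_assoc, hUU, mul_zero, sub_zero]
  -- The idempotents `U * g` and `g * U` are complementary.
  have e5 : U * g * (g * U) = 0 := by
    calc U * g * (g * U) = (1 - g * U) * (1 - U * g) := by rw [← e2, ← e3]
      _ = 1 - U * g - g * U + g * (U * U) * g := by noncomm_ring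
      _ = 0 := by rw [hUU, e3]; simp
  -- The usual correction `g U g` of a contraction: it still contracts `U`, has the same degree as
  -- `g`, and now squares to zero.
  refine ⟨g * U * g, ?_, ?_, ?_⟩
  · calc g * U * g * (g * U * g) = g * (U * g * (g * U)) * g := by simp only [mul_assoc]
      _ = 0 := by rw [e5, mul_zero, zero_mul]
  · rw [← mul_assoc, ← mul_assoc, e4, mul_assoc (g * U), mul_assoc g, ← mul_assoc U, e4, e1]
  · intro i j hij
    rw [Matrix.mul_apply] at hij
    obtain ⟨l, -, hl⟩ := Finset.exists_ne_zero_of_sum_ne_zero hij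
    have h1 := left_ne_zero_of_mul hl
    rw [Matrix.mul_apply] at h1
    obtain ⟨k, -, hk⟩ := Finset.exists_ne_zero_of_sum_ne_zero h1
    have := dvd_add (dvd_add (hgg _ _ (left_ne_zero_of_mul hk)) (hg _ _ (right_ne_zero_of_mul hk)))
      (hgg _ _ (right_ne_zero_of_mul hl))
    rwa [show ν i - ν k + 1 + (ν k - ν l - 1) + (ν l - ν j + 1) = ν i - ν j + 1 by ring] at this

/-- The value on `v_{h,q}` at a vertex with `r` edges on the left, for a differential `u` on
these edges with the contraction `v`. -/
def contractionVal (r : ℕ) (S : ℕ → ℤ) (u v : ℕ → ℕ → ℤ) (h q : ℕ) : ℤ :=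
  if (h + q) / r = 0 then S ((h + q) % r) * u h ((h + q) % r)
  else if (h + q) / r = 1 then - (S ((h + q) % r) * v h ((h + q) % r)) else 0

theorem contractionVal_zero {r : ℕ} (S : ℕ → ℤ) {u : ℕ → ℕ → ℤ} (v : ℕ → ℕ → ℤ)
    (hu : ∀ i j, j ≤ i → u i j = 0) {h : ℕ} (hh : h < r) : contractionVal r S u v h 0 = 0 := by
  rw [contractionVal, add_zero, Nat.div_eq_of_lt hh, Nat.mod_eq_of_lt hh, if_pos rfl,
    hu _ _ le_rfl, mul_zero]

/-- Conjugated by the diagonal matrix `T` of signs, the levels are `-u`, `v`, `0`, `0`, …. The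
relations for winding numbers zero, one and two are `u² = 0`, `u v + v u = 1` and `v² = 0`; the last
one is the reason for a contraction of square zero. -/
theorem levelMatrix_contractionVal {r : ℕ} {S : ℕ → ℤ} (hS : ∀ i, S i * S i = 1)
    {u v : ℕ → ℕ → ℤ} (hu : ∀ i j, j ≤ i → u i j = 0)
    (huu : strandMatrix r u * strandMatrix r u = 0)
    (hvv : strandMatrix r v * strandMatrix r v = 0)
    (huv : strandMatrix r u * strandMatrix r v + strandMatrix r v * strandMatrix r u = 1) (w : ℕ) :
    ∑ m ∈ Finset.range (w + 1), levelMatrix r (fun h => - S h) (contractionVal r S u v) m *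
      levelMatrix r (fun h => - S h) (contractionVal r S u v) (w - m) =
      if w = 1 then -1 else 0 := by
  let T : Matrix (Fin r) (Fin r) ℤ := Matrix.diagonal fun i => S i
  have hT : T * T = 1 := by
    rw [Matrix.diagonal_mul_diagonal, ← Matrix.diagonal_one]
    congr 1; ext x; exact hS _
  have rT : ∀ Z Z' : Matrix (Fin r) (Fin r) ℤ, T * Z * T * (T * Z' * T) = T * (Z * Z') * T := by
    intro Z Z'
    calc T * Z * T * (T * Z' * T) = T * Z * (T * T) * Z' * T := by simp only [mul_assoc]
      _ = T * (Z * Z') * T := by rw [hT, mul_one]; simp only [mul_assoc]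
  have l0 : levelMatrix r (fun h => - S h) (contractionVal r S u v) 0 =
      -(T * strandMatrix r u * T) := by
    ext i k
    simp only [levelMatrix, Matrix.of_apply, T, Matrix.neg_apply, Matrix.mul_diagonal,
      Matrix.diagonal_mul, strandMatrix, zero_mul, add_zero]
    rcases le_or_gt (k : ℕ) i with hki | hki
    · rw [Nat.sub_eq_zero_of_le hki, contractionVal_zero S v hu i.2, hu _ _ hki]; ring
    · rw [contractionVal, Nat.add_sub_cancel' hki.le, Nat.div_eq_of_lt k.2, if_pos rfl,
        Nat.mod_eq_of_lt k.2]
      ring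
  have lw : ∀ (w : ℕ) (i k : Fin r), levelMatrix r (fun h => - S h) (contractionVal r S u v)
      (w + 1) i k = if w = 0 then S i * v i k * S k else 0 := by
    intro w i k
    have h1 : (i : ℕ) + (k + (w + 1) * r - i) = k + (w + 1) * r := by
      have := i.2; rw [add_mul]; omega
    have h2 : ((k : ℕ) + (w + 1) * r) / r = w + 1 := by
      rw [Nat.add_mul_div_right _ _ (Nat.lt_of_le_of_lt (Nat.zero_le _) k.2),
        Nat.div_eq_of_lt k.2, zero_add]
    simp only [levelMatrix, Matrix.of_apply, contractionVal, h1, h2, Nat.add_mul_mod_self_right,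
      Nat.mod_eq_of_lt k.2]
    rw [if_neg (by omega)]
    by_cases hw : w = 0
    · rw [if_pos (by omega), if_pos hw]; ring
    · rw [if_neg (by omega), if_neg hw, mul_zero]
  have l1 : levelMatrix r (fun h => - S h) (contractionVal r S u v) 1 =
      T * strandMatrix r v * T := by
    ext i k
    rw [lw 0]
    simp only [T, Matrix.mul_diagonal, Matrix.diagonal_mul, strandMatrix, Matrix.of_apply, if_true]
  have l2 : ∀ w, levelMatrix r (fun h => - S h) (contractionVal r S u v) (w + 2) = 0 := by
    intro w
    ext i k
    rw [lw (w + 1), if_neg (by omega)]; rfl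
  rcases w with _ | _ | _ | w
  · simp only [zero_add, Finset.sum_range_one, Nat.sub_zero, l0, neg_mul_neg]
    rw [rT, huu]
    simp
  · simp only [zero_add, Finset.sum_range_succ, Finset.sum_range_zero, Nat.sub_zero, Nat.sub_self,
      l0, l1, if_true]
    rw [neg_mul, mul_neg, rT, rT, ← neg_add, ← add_mul, ← mul_add, huv, mul_one, hT]
  · simp only [Finset.sum_range_succ, Finset.sum_range_zero, zero_add, Nat.reduceAdd, Nat.reduceSub,
      l1, show levelMatrix r (fun h => - S h) (contractionVal r S u v) 2 = 0 from l2 0, mul_zero,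
      zero_mul, add_zero]
    rw [if_neg (by omega), rT, hvv]
    simp
  · rw [if_neg (by omega)]
    refine Finset.sum_eq_zero fun m hm => ?_
    rw [Finset.mem_range] at hm
    rcases Nat.lt_or_ge m 2 with h | h
    · obtain ⟨c, hc⟩ := Nat.exists_eq_add_of_le' (show 2 ≤ w + 1 + 1 + 1 - m by omega)
      rw [hc, l2, mul_zero]
    · obtain ⟨c, rfl⟩ := Nat.exists_eq_add_of_le' h
      rw [l2, zero_mul]

/-! ### Crossings of value zero -/

theorem getD_swapAt (A B : List (ZMod N)) (x y : ZMod N) (t : ℕ) :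
    (A ++ y :: x :: B).getD t 0 = (A ++ x :: y :: B).getD (swapAt A.length t) 0 := by
  simp only [List.getD_eq_getElem?_getD, swapAt]
  split_ifs with h1 h2
  · subst h1; simp
  · subst h2; simp
  · rcases Nat.lt_or_ge t A.length with h | h
    · simp [List.getElem?_append, h]
    · obtain ⟨m, rfl⟩ := Nat.exists_eq_add_of_le (show A.length + 2 ≤ t by omega)
      rw [List.getElem?_append_right (by omega), List.getElem?_append_right (by omega)]
      rw [show A.length + 2 + m - A.length = m + 2 by omega]
      simp

/-- With value zero on all its crossings, the braid only transports counts along the strands: left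
counts live on pairs not yet inverted, right counts on pairs already inverted. Each crossing joins a
pair of the first kind on its left to the same pair on its right, now inverted, and its equation
holds because `hl` and `hr` give the two counts opposite signed values. -/
theorem Layout.braid (L : Layout D) (φ : Gen D → ℤ) (ν : ℕ → ZMod N) (β : ℕ → ℕ → ℤ)
    {μ μ' : List (ZMod N)} {σ σ' : ℕ → ℕ} {F : List (LagSlab N)} (hF : Braid μ σ F μ' σ') (k : ℕ)
    (hD : ∀ (i : ℕ) e, F[i]? = some e → D[k + i]? = some e)
    (h0 : ∀ i A x y B hk, k ≤ i → i < k + F.length → φ (.crossing i A x y B hk) = 0)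
    (hν : ∀ t, μ.getD t 0 = ν (σ t))
    (hl : ∀ t b, t < b → b < μ.length → halfSum φ .left k t b =
      if σ t < σ b then - (koszul (ν (σ t) - ν (σ b) - 1) * β (σ t) (σ b)) else 0)
    (hr : ∀ t b, t < b → b < μ'.length → halfSum φ .right (k + F.length) t b =
      if σ' b < σ' t then β (σ' b) (σ' t) else 0) :
    (∀ t b, t < b → b < μ.length → halfSum φ .right k t b =
      if σ b < σ t then β (σ b) (σ t) else 0) ∧
    ∀ i A x y B hk, k ≤ i → i < k + F.length →
      FreeAlgebra.lift ℤ φ (dGen (.crossing i A x y B hk)) = 0 := by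
  induction hF generalizing k with
  | nil μ σ => exact ⟨by simpa using hr, fun i _ _ _ _ _ h1 h2 => by simp at h2; omega⟩
  | @cons A x y B σ σ' μ' es hσ hs ih =>
    have hk : D[k]? = some ⟨A, .crossing x y, B⟩ := hD 0 _ rfl
    have hz : φ (.crossing k A x y B hk) = 0 := h0 _ _ _ _ _ _ le_rfl (by simp)
    have hlen : (A ++ x :: y :: B).length = A.length + 2 + B.length := by simp; omega
    have hlen' : (A ++ y :: x :: B).length = A.length + 2 + B.length := by simp; omega
    rw [hlen] at hl ⊢
    rw [hlen'] at ih
    have hsw : ∀ {t}, t < A.length + 2 + B.length → swapAt A.length t < A.length + 2 + B.length := by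
      intro t ht; unfold swapAt; split_ifs <;> omega
    have e1 : swapAt A.length A.length = A.length + 1 := by simp [swapAt]
    have e2 : swapAt A.length (A.length + 1) = A.length := by simp [swapAt]
    obtain ⟨ih1, ih2⟩ := ih (k + 1)
      (fun i e h => by
        have := hD (i + 1) e (by simpa using h)
        rwa [show k + (i + 1) = k + 1 + i by omega] at this)
      (fun i A x y B hk h1 h2 => h0 i A x y B hk (by omega) (by simp; omega))
      (fun t => by rw [getD_swapAt, hν]; rfl)
      (fun t b htb hb => by
        by_cases hne : t = A.length ∧ b = A.length + 1
        · obtain ⟨rfl, rfl⟩ := hne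
          rw [L.left_crossing_self φ hk, Function.comp, Function.comp, e1, e2, if_neg (by omega)]
        · rw [L.left_crossing φ hk htb hb hne, hz]
          simp only [mul_zero, zero_mul, ite_self, add_zero]
          exact hl _ _ (swapAt_lt htb hne) (hsw hb))
      (by rwa [List.length_cons, show k + (es.length + 1) = k + 1 + es.length by omega] at hr)
    refine ⟨fun t b htb hb => ?_, fun i A' x' y' B' hk' h1 h2 => ?_⟩
    · by_cases hne : t = A.length ∧ b = A.length + 1
      · obtain ⟨rfl, rfl⟩ := hne
        rw [L.right_crossing_self φ hk, if_neg (by omega)]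
      · rw [L.right_crossing φ hk htb hb hne, hz]
        simp only [mul_zero, zero_mul, ite_self, add_zero]
        rw [ih1 _ _ (swapAt_lt htb hne) (hsw hb)]
        simp only [Function.comp, swapAt_swapAt]
    · rcases h1.lt_or_eq with h1 | rfl
      · exact ih2 i A' x' y' B' hk' (by omega) (by simp at h2; omega)
      · cases slab_inj hk hk'
        have hx := hν A.length
        have hy := hν (A.length + 1)
        simp [List.getD_eq_getElem?_getD] at hx hy
        rw [L.lift_dGen_crossing, hl _ _ (by omega) (by omega), ih1 _ _ (by omega) (by omega),
          Function.comp, Function.comp, e1, e2, if_pos hσ, if_pos hσ, ← hx, ← hy]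
        ring

variable {E : List (LagSlab N)}

/-! ### Extension over a vertex on the right -/

/-- The extension of an assignment from an initial part `D`: zero on the further crossings and
given by `W` at the further vertices. -/
def extendVal (φ : Gen D → ℤ) (W : ℕ → ℕ → ℤ) : Gen (D ++ E) → ℤ
  | .crossing k A x y B hk =>
    if h : k < D.length then φ (.crossing k A x y B (getElem?_of_append h hk)) else 0
  | .vertex k A X Y B hk i j =>
    if h : k < D.length then φ (.vertex k A X Y B (getElem?_of_append h hk) i j) else W i j

theorem extendVal_comp_extend (φ : Gen D → ℤ) (W : ℕ → ℕ → ℤ) :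
    extendVal φ W ∘ Gen.extend E = φ := by
  funext g
  rcases g with ⟨k, A, x, y, B, hk⟩ | ⟨k, A, X, Y, B, hk, h, j⟩ <;>
    exact dif_pos (lt_length_of_getElem? hk)

theorem Gen.exists_extend (g : Gen (D ++ E)) : (∃ g' : Gen D, g = g'.extend E) ∨
    (∃ k A x y B hk, D.length ≤ k ∧ g = .crossing k A x y B hk) ∨
    ∃ k A X Y B hk h j, D.length ≤ k ∧ g = .vertex k A X Y B hk h j := by
  rcases g with ⟨k, A, x, y, B, hk⟩ | ⟨k, A, X, Y, B, hk, h, j⟩ <;>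
    rcases lt_or_ge k D.length with hlt | hge
  · exact .inl ⟨.crossing k A x y B (getElem?_of_append hlt hk), rfl⟩
  · exact .inr (.inl ⟨k, A, x, y, B, hk, hge, rfl⟩)
  · exact .inl ⟨.vertex k A X Y B (getElem?_of_append hlt hk) h j, rfl⟩
  · exact .inr (.inr ⟨k, A, X, Y, B, hk, h, j, hge, rfl⟩)

/-- After the half twist the clockwise order of the left edges is the original order `R` of the
strands. With no right edges, each full turn meets the vertical line twice. -/
theorem degree_vertex_left {k : ℕ} {A R B : List (ZMod N)}
    (hk : D[k]? = some ⟨A, .vertex R.reverse [], B⟩) (h : Fin (([] : List (ZMod N)).length +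
      R.reverse.length)) (j : ℕ+) : (Gen.vertex k A R.reverse [] B hk h j).degree =
      R.getD h 0 - R.getD ((h + j) % R.length) 0 + 2 * (((h + j) / R.length : ℕ) : ZMod N) - 1 := by
  have hlen : ([] : List (ZMod N)).length + R.reverse.length = R.length := by simp
  have hp : ∀ h : Fin (([] : List (ZMod N)).length + R.reverse.length),
      halfEdgePotential R.reverse [] h = R.getD h 0 := by
    intro h
    have : (h : ℕ) < R.length := by have := h.2; omega
    rw [halfEdgePotential, List.get_eq_getElem, List.getD_eq_getElem?_getD,
      List.getElem?_eq_getElem this, Option.getD_some]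
    simp
  obtain ⟨κ, W, h1, h2, h3⟩ := exists_spiralCrossings R.reverse.length
    ([] : List (ZMod N)).length h j h.2
  rw [hlen] at h1
  simp only [hlen] at h2
  have h3' : spiralCrossings R.reverse.length ([] : List (ZMod N)).length h j = 2 * W := by
    simpa using h3
  have e1 : ((rotate h j : Fin _) : ℕ) = ((h : ℕ) + j) % R.length := by
    rw [← hlen]; rfl
  rw [Gen.degree, hp, hp, e1, h3']
  have e2 : ((h : ℕ) + j) / R.length = W := by
    rw [h2, Nat.add_mul_div_right _ _ (by omega), Nat.div_eq_of_lt h1, zero_add]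
  rw [e2]
  push_cast
  ring

/-- The strand complex at the end of `D` is contractible, and the vertex on the right accepts
exactly the data of such a complex: its differential, a contraction of square zero, and zero for
higher winding numbers. -/
theorem IsSolution.exists_extend (hN : Even N) {R : List (ZMod N)} (hD : Chain [] id D R id)
    {ρ : ℤ} {φ : Gen D → ℤ} (hφ : IsSolution ρ φ) :
    ∃ φ' : Gen (D ++ FrontSlab.res ⟨[], .vertex R [], []⟩) → ℤ, IsSolution ρ φ' := by
  set F := halfTwist [] R [] with hF
  set v : LagSlab N := ⟨[], .vertex R.reverse [], []⟩ with hv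
  change ∃ φ' : Gen (D ++ (F ++ [v])) → ℤ, IsSolution ρ φ'
  have hbraid : Braid R id F R.reverse (revBlock 0 R.length) := by
    simpa using braid_halfTwist [] R [] id (fun i j _ h _ => h)
  have hE : Chain R id (F ++ [v]) [] id := by
    simpa [FrontSlab.res, FrontSlab.source, FrontSlab.target, FrontPoint.incoming,
      FrontPoint.outgoing] using chain_res_slab (⟨[], .vertex R [], []⟩ : FrontSlab N)
  obtain ⟨L, hL0, -, hpot, hord, -, -⟩ := exists_layout_append hD hE
  have hvk : (D ++ (F ++ [v]))[D.length + F.length]? = some v := by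
    rw [List.getElem?_append_right (by omega), List.getElem?_append_right (by omega)]
    simp
  have hslab : ∀ k e, D.length ≤ k → (D ++ (F ++ [v]))[k]? = some e →
      (k < D.length + F.length ∧ F[k - D.length]? = some e) ∨ (k = D.length + F.length ∧ e = v) := by
    intro k e hk he
    rw [List.getElem?_append_right hk] at he
    rcases lt_or_ge (k - D.length) F.length with h | h
    · rw [List.getElem?_append_left h] at he
      exact .inl ⟨by omega, he⟩
    · have := lt_length_of_getElem? he
      simp only [List.length_append, List.length_cons, List.length_nil] at this
      obtain rfl : k = D.length + F.length := by omega
      rw [← List.getElem?_append_right hk] at he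
      exact .inr ⟨rfl, slab_inj he hvk⟩
  set u := L.init.coeff φ D.length with hu
  have hU : IsAcyclic (strandMatrix R.length u) := by
    have := L.init.isAcyclic_diff hN hL0 hφ.lift_dGen D.length le_rfl
    rw [Layout.diff] at this
    rwa [show L.init.pot D.length = R from hpot] at this
  set ν : ℕ → ZMod N := fun i => R.getD i 0 with hν
  set S : ℕ → ℤ := fun i => koszul (ν i) with hS
  have hSS : ∀ i, S i * S i = 1 := fun i => koszul_mul_self _
  have hsgn : ∀ i, L.init.sgn D.length i = S i := by
    intro i
    simp only [Layout.sgn, Layout.potAt, hS, hν]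
    rw [show L.init.pot D.length = R from hpot]
  have hpotAt : ∀ i, L.init.potAt D.length i = ν i := by
    intro i
    rw [Layout.potAt, show L.init.pot D.length = R from hpot]
  have hlow : ∀ i j, j ≤ i → u i j = 0 := by
    intro i j hij
    rcases hij.lt_or_eq with h | rfl
    · exact L.init.coeff_gt_of_ord φ h (by
        rw [show L.init.ord D.length = id from hord]; exact h)
    · exact L.init.coeff_self _ _ _
  have hudeg : ∀ i j, u i j ≠ 0 → (ρ : ZMod N) ∣ ν i - ν j - 1 := by
    intro i j hij
    rcases lt_or_ge i j with h | h
    · rw [hu, L.init.coeff_lt φ h] at hij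
      have := L.init.dvd_of_halfSum_ne_zero hφ.graded (right_ne_zero_of_mul hij)
      rwa [Layout.halfDeg, hpotAt, hpotAt] at this
    · exact absurd (hlow i j h) hij
  -- The differential `u` has degree `1` and the contraction degree `-1` modulo `ρ`, measured by the
  -- potentials `ν`.
  obtain ⟨h, hhh, hUh, hhdeg⟩ := exists_graded_contraction hU ν ρ (fun i j => hudeg i j)
  let c : ℕ → ℕ → ℤ := fun i j => if hij : i < R.length ∧ j < R.length then
    h ⟨i, hij.1⟩ ⟨j, hij.2⟩ else 0
  have hc : strandMatrix R.length c = h := by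
    ext i j
    simp [strandMatrix, c]
  have hcdeg : ∀ i j, c i j ≠ 0 → (ρ : ZMod N) ∣ ν i - ν j + 1 := by
    intro i j hij
    simp only [c] at hij
    split_ifs at hij with hh
    · exact hhdeg _ _ hij
    · exact absurd rfl hij
  set W := contractionVal R.length S u c with hW
  have hlevel := levelMatrix_contractionVal hSS hlow hU.1 (by rw [hc]; exact hhh)
    (by rw [hc]; exact hUh)
  set φ' : Gen (D ++ (F ++ [v])) → ℤ := extendVal φ W with hφ'
  have hcomp : φ' ∘ Gen.extend (F ++ [v]) = φ := extendVal_comp_extend φ W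
  have hval : ∀ i q, i < R.length → vertexVal φ' hvk i q = W i q := by
    intro i q hi
    rcases Nat.eq_zero_or_pos q with rfl | hq
    · rw [hW, contractionVal_zero S c hlow hi]
      simp [vertexVal]
    · rw [vertexVal, dif_pos ⟨by simpa using hi, hq⟩]
      exact dif_neg (by omega)
  -- All half-edges lie on the left of the vertex, which accounts for the minus sign.
  have hsign : ∀ i, halfEdgeSign R.reverse [] i = - S i := by
    intro i
    simp [halfEdgeSign, hS, hν]
  have hrel : ∀ i < R.length, ∀ M, i < M → (if M = i + R.length then 1 else 0) +
      ∑ m ∈ Finset.range M, - S i * - S (m % R.length) * vertexVal φ' hvk i (m - i) *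
        vertexVal φ' hvk (m % R.length) (M - m) = 0 := by
    refine (levelMatrix_iff (fun i => - S i) fun i => by simp [vertexVal]).2 fun w => ?_
    have hlv : ∀ w, levelMatrix R.length (fun i => - S i) (vertexVal φ' hvk) w =
        levelMatrix R.length (fun i => - S i) W w := by
      intro w
      ext i j
      simp only [levelMatrix, Matrix.of_apply, hval i _ i.2]
    simp only [hlv]
    exact hlevel w
  have hrev : ∀ t < R.length, revBlock 0 R.length t = R.length - 1 - t := by
    intro t ht
    rw [revBlock, if_pos (by omega)]; omega
  -- The right count at the vertex for a pair `i < j` is the value on the corner of winding number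
  -- zero, `W i (j - i) = S j * u i j`. It agrees with the left count that enters the half twist up
  -- to exactly the sign in the crossing equation.
  have hmid := (L.braid φ' ν (fun i j => W i (j - i)) hbraid D.length
    (fun i e he => by
      rw [List.getElem?_append_right (by omega), Nat.add_sub_cancel_left]
      exact getElem?_append_of_some he)
    (fun i A x y B hk h1 h2 => dif_neg (by omega)) (fun t => rfl)
    (fun t b htb hb => by
      have hW' : W t (b - t) = S b * (S t * halfSum φ .left D.length t b) := by
        rw [hW, contractionVal, Nat.add_sub_cancel' htb.le, Nat.div_eq_of_lt hb, if_pos rfl,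
          Nat.mod_eq_of_lt hb, hu, L.init.coeff_lt φ htb, hsgn]
      rw [L.halfSum_extend hord φ' _ _ _ _ le_rfl, hcomp]
      simp only [id]
      rw [if_pos htb, hW', koszul_sub hN, koszul_sub hN, koszul_one hN]
      have h1 := hSS t
      have h2 := hSS b
      simp only [hS] at h1 h2 ⊢
      linear_combination (-(koszul (ν b) * koszul (ν b) * halfSum φ .left D.length t b)) * h1 -
        halfSum φ .left D.length t b * h2)
    (fun t b htb hb => by
      rw [List.length_reverse] at hb
      have := L.right_vertex φ' hvk htb (by simpa using hb)
      rw [hval _ _ (by simp; omega)] at this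
      simp only [List.length_nil, zero_add, List.length_reverse] at this
      rw [this, hrev t (by omega), hrev b hb, if_pos (by omega)]
      congr 1; omega)).2
  have hlast : ∀ {k A X Y B}, (D ++ (F ++ [v]))[k]? = some ⟨A, .vertex X Y, B⟩ → D.length ≤ k →
      k = D.length + F.length ∧ A = [] ∧ X = R.reverse ∧ Y = [] ∧ B = [] := by
    intro k A X Y B hk hle
    rcases hslab k _ hle hk with ⟨-, h2⟩ | ⟨h1, h2⟩
    · obtain ⟨_, _, _, _, he⟩ := hbraid.eq_crossing _ (List.mem_of_getElem? h2)
      simp at he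
    · simp only [hv, LagSlab.mk.injEq, LagPoint.vertex.injEq] at h2
      tauto
  have hcross : ∀ {k A x y B}, (D ++ (F ++ [v]))[k]? = some ⟨A, .crossing x y, B⟩ →
      D.length ≤ k → k < D.length + F.length := by
    intro k A x y B hk hle
    rcases hslab k _ hle hk with ⟨h1, -⟩ | ⟨-, h2⟩
    · exact h1
    · simp [hv] at h2
  refine ⟨φ', fun g => ?_, fun g hg => ?_⟩
  · rcases g.exists_extend with ⟨g, rfl⟩ | ⟨k, A, x, y, B, hk, hle, rfl⟩ |
      ⟨k, A, X, Y, B, hk, i, j, hle, rfl⟩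
    · rw [L.lift_dGen_extend hN hord, hcomp, hφ.lift_dGen]
    · exact hmid k A x y B hk hle (hcross hk hle)
    · obtain ⟨rfl, rfl, rfl, rfl, rfl⟩ := hlast hk hle
      have hi : (i : ℕ) < R.length := by simpa using i.2
      have := hrel i hi (i + j) (by have := j.pos; omega)
      rw [lift_dGen_vertex hN]
      simpa only [hsign, List.length_nil, zero_add, List.length_reverse] using this
  · rcases g.exists_extend with ⟨g, rfl⟩ | ⟨k, A, x, y, B, hk, hle, rfl⟩ |
      ⟨k, A, X, Y, B, hk, i, j, hle, rfl⟩
    · rw [Gen.degree_extend] at hg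
      exact (congrFun hcomp g).trans (hφ.graded g hg)
    · exact dif_neg (by omega)
    · obtain ⟨rfl, rfl, rfl, rfl, rfl⟩ := hlast hk hle
      have hi : (i : ℕ) < R.length := by simpa using i.2
      have he : φ' (.vertex (D.length + F.length) [] R.reverse [] [] hk i j) = W i j :=
        dif_neg (by omega)
      rw [degree_vertex_left] at hg
      rw [he, hW, contractionVal]
      -- Since each full turn adds `2` to the degree, winding number zero matches the degree of `u`
      -- and winding number one that of the contraction.
      split_ifs with h0 h1
      · by_contra hne
        have := hudeg _ _ (right_ne_zero_of_mul hne)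
        rw [h0] at hg
        refine hg ?_
        convert this using 1
        push_cast; ring
      · by_contra hne
        have := hcdeg _ _ (right_ne_zero_of_mul (neg_ne_zero.1 hne))
        rw [h1] at hg
        refine hg ?_
        convert this using 1
        push_cast; ring
      · rfl

theorem chain_res_leftClosure (L : BorderedGraph N) : Chain [] id L.leftClosure.res L.right id :=
  chain_res L.leftClosure.isFront

theorem res_closure (L : BorderedGraph N) :
    L.closure.res = L.leftClosure.res ++ FrontSlab.res ⟨[], .vertex L.right [], []⟩ := by
  simp [BorderedGraph.res, BorderedGraph.closure, BorderedGraph.concat, inftyCorolla]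

end LegendrianGraph

open LegendrianGraph in
theorem theorem4 (N : ℕ) (hN : Even N) (ρ : ℤ) (L : BorderedGraph N) :
    FinitelyManyPolygons L.leftClosure.res ∧ FinitelyManyPolygons L.closure.res ∧
      (Nonempty (Augmentation L.leftClosure.res ρ) ↔
        Nonempty (Augmentation L.closure.res ρ)) := by
  have h1 := chain_res_leftClosure L
  have h2 : Chain L.right id (FrontSlab.res ⟨[], .vertex L.right [], []⟩) [] id := by
    simpa [FrontSlab.source, FrontSlab.target, FrontPoint.incoming, FrontPoint.outgoing] using
      chain_res_slab (⟨[], .vertex L.right [], []⟩ : FrontSlab N)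
  rw [res_closure]
  obtain ⟨Λ, -, -, -, hid, -, -⟩ := exists_layout_append h1 h2
  refine ⟨Λ.init.finitelyManyPolygons, Λ.finitelyManyPolygons, ?_⟩
  rw [nonempty_augmentation_iff, nonempty_augmentation_iff]
  -- Contractibility on the last slice gives the extension; the absence of inverted strands there
  -- gives the restriction.
  exact ⟨fun ⟨_, h⟩ => h.exists_extend hN h1, fun ⟨_, h⟩ => ⟨_, h.restrict hN Λ hid⟩⟩
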